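/- **Setting.** Fix constants $m,\chi,\mathrm c>0$, $q\in\mathbb R$, and a nonlinearity $G_1'$ with antiderivative $G_1$, $G_1(0)=0$: $G_1'$ is continuous on $(0,\infty)$, $G_1$ is continuous on $[0,\infty)$ and differentiable on $(0,\infty)$ with derivative $G_1'$, and $z\mapsto G_1(|z|^2)$, $z\in\mathbb C$, is (real) differentiable with differential $g(z)\,dz^*+g(z)^*dz$, where $g(z)=G_1'(|z|^2)z$ for $z\ne0$, $g(0)=0$, and $g$ is continuous. Put $G_a(s)=a^{-5}G_1(a^3s)$, so that $G_a'(s)=a^{-2}G_1'(a^3s)$. For potentials $\varphi,\mathbf A$ the NLS equation is $$\mathrm i\tilde\partial_t\psi=\tfrac{\chi}{2m}\bigl[-\tilde\nabla^2\psi+G_a'(|\psi|^2)\psi\bigr],\qquad \tilde\partial_t=\partial_t+\tfrac{\mathrm iq}{\chi}\varphi,\quad \tilde\nabla=\nabla-\tfrac{\mathrm iq}{\chi\mathrm c}\mathbf A .$$ Put $\rho=q|\psi|^2$, $\mathbf P=\chi\,\mathrm{Im}(\psi^*\tilde\nabla\psi)$, $\mathbf J=\frac qm\mathbf P$, $\mathbf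 E=-\nabla\varphi-\frac1{\mathrm c}\partial_t\mathbf A$, $\mathbf B=\nabla\times\mathbf A$, $\mathbf f=\rho\mathbf E+\frac1{\mathrm c}\mathbf J\times\mathbf B$ and $$T^{ij}=\tfrac{\chi^2}{m}\mathrm{Re}\bigl(\tilde\partial_i\psi\,(\tilde\partial_j\psi)^*\bigr)-\delta_{ij}\Bigl[\tfrac{\chi^2}{2m}\bigl(|\tilde\nabla\psi|^2+G_a(|\psi|^2)\bigr)+\chi\,\mathrm{Im}(\psi^*\tilde\partial_t\psi)\Bigr].$$ Let $\mathring\psi_1>0$ be a function on $[0,\infty)$ such that $\mathring\psi_1(|\mathbf x|)$ is $C^2$ and square integrable on $\mathbb R^3$ and solves $-\nabla^2\mathring\psi_1+G_1'(\mathring\psi_1^2)\mathring\psi_1=0$, and such that $\theta^2|\mathring\psi_1(\theta)|$ and $\theta^3|\mathring\psi_1'(\theta)|$ are bounded as $\theta\to\infty$. Let $\mathring\psi_a(s)=a^{-3/2}\mathring\psi_1(s/a)$. Let $\varphi,\mathbf A$ be $C^2$ on an open set $D\subset\mathbb R\times\mathbb R^3$, let $T_-<T_+$, and let $\mathbf r:[T_-,T_+]\to\mathbb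 R^3$ be a $C^2$ trajectory with $(t,\mathbf r(t))\in D$ for all $t$. Let $\hat{\mathbf v}=\partial_t\mathbf r$. The limit potentials are the linear parts $$\varphi_\infty=\varphi(t,\mathbf r)+(\mathbf x-\mathbf r)\cdot\nabla\varphi(t,\mathbf r),\qquad \mathbf A_\infty=\mathbf A(t,\mathbf r)+(\mathbf x-\mathbf r)\cdot\nabla\mathbf A(t,\mathbf r),$$ and $\mathbf E_\infty(t),\mathbf B_\infty(t)$ are their fields at $\mathbf x=\mathbf r(t)$. **Concentrating asymptotic solutions.** Let $a_n,R_n>0$, let $\Omega_n=\Omega_n(t)$ be the closed ball with center $\mathbf r(t)$ and radius $R_n$, with outer unit normal $\mathbf n$ on $\partial\Omega_n$, and let $\hat\Omega_n=\{(t,\mathbf x):T_-\le t\le T_+,\ \mathbf x\in\Omega_n(t)\}$. Functions $\psi_n\in C^2(\hat\Omega_n)$ are asymptotic solutions of the NLS equations with potentials $\varphi_n,\mathbf A_n\in C^2(\hat\Omega_n)$ and size parameters $a_n$ that concentrate at $\mathbf r$ if the following holds, where "uniformly" means uniformly in $t\in[T_-,T_+]$, constants do not depend on $n,t,\mathbf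 x$, and densities and fields are those of $\psi_n,\varphi_n,\mathbf A_n,G_{a_n}$. 1. $a_n\to0$, $R_n\to0$, $R_n/a_n\to\infty$; the coefficients of the limit potentials are bounded, and those of order zero have bounded time derivatives; $\varphi_n-\varphi_\infty$, $\mathbf A_n-\mathbf A_\infty$ and their first derivatives in $(t,\mathbf x)$ tend to zero uniformly on $\hat\Omega_n$; $\varphi_n,\mathbf A_n$ and their first derivatives are bounded on $\hat\Omega_n$. 2. $\bigl|\int_{\Omega_n}\mathbf P\,d\mathbf x\bigr|\le C$; and $0<c_0\le\bar\rho_n(t)\le C$ for $n\ge n_0$ and all $t$, where $\bar\rho_n=\int_{\Omega_n}\rho\,d\mathbf x$. Let $\mathbf r_n=\bar\rho_n^{-1}\int_{\Omega_n}\mathbf x\rho\,d\mathbf x$. 3. For some $t_0\in[T_-,T_+]$ the sequence $\bar\rho_n(t_0)$ converges, and, uniformly, $\int_{t_0}^t\int_{\partial\Omega_n}\mathbf n_iT^{ij}d\sigma dt'\to0$, $\int_{t_0}^t\int_{\partial\Omega_n}\mathbf P\,\hat{\mathbf v}\cdot\mathbf n\,d\sigma dt'\to0$, $\int_{\partial\Omega_n}(\mathbf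 x-\mathbf r_n)\,\hat{\mathbf v}\cdot\mathbf n\,\rho\,d\sigma\to0$, $\int_{\partial\Omega_n}(\mathbf x-\mathbf r_n)\,\mathbf n\cdot\mathbf J\,d\sigma\to0$, $\int_{t_0}^t\int_{\partial\Omega_n}(\hat{\mathbf v}\cdot\mathbf n\,\rho-\mathbf n\cdot\mathbf J)\,d\sigma dt'\to0$, $\int_{t_0}^t\int_{\Omega_n}\bigl[(\mathbf E-\mathbf E_\infty)\rho+\frac1{\mathrm c}\mathbf J\times(\mathbf B-\mathbf B_\infty)\bigr]d\mathbf x\,dt'\to0$. 4. With the same $t_0$, there are $C^1$ functions $\rho',\mathbf J',\mathbf P',T'^{ij}$ and continuous $\mathbf f'$ on $\hat\Omega_n$ (depending on $n$) with $$\partial_t(\rho+\rho')+\nabla\cdot(\mathbf J+\mathbf J')=0,\qquad \partial_t(\mathbf P+\mathbf P')+\partial_i(T^{ij}+T'^{ij})=\mathbf f+\mathbf f'\quad\text{on }\hat\Omega_n,$$ such that, uniformly, the following three expressions tend to $0$: $$\Bigl[\int_{\Omega_n}\mathbf P'd\mathbf x\Bigr]_{t_0}^{t}-\int_{t_0}^t\!\int_{\partial\Omega_n}\mathbf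 P'\,\hat{\mathbf v}\cdot\mathbf n\,d\sigma dt'+\int_{t_0}^t\!\int_{\Omega_n}\partial_iT'^{ij}d\mathbf xdt'-\int_{t_0}^t\!\int_{\Omega_n}\mathbf f'd\mathbf xdt',$$ $$\int_{\Omega_n}\partial_t\bigl((\mathbf x-\mathbf r_n)\rho'\bigr)d\mathbf x+\partial_t\mathbf r_n\int_{\Omega_n}\rho'd\mathbf x+\int_{\partial\Omega_n}(\mathbf x-\mathbf r_n)\,\mathbf n\cdot\mathbf J'd\sigma-\int_{\Omega_n}\mathbf J'd\mathbf x,$$ $$\Bigl[\int_{\Omega_n}\rho'd\mathbf x\Bigr]_{t_0}^{t}-\int_{t_0}^t\!\int_{\partial\Omega_n}\hat{\mathbf v}\cdot\mathbf n\,\rho'\,d\sigma dt'+\int_{t_0}^t\!\int_{\partial\Omega_n}\mathbf n\cdot\mathbf J'\,d\sigma dt'.$$ **Wave-corpuscles.** Let $\phi_0(t)\in\mathbb R$, $\phi_1(t),\mathbf a_0(t)\in\mathbb R^3$ and $\mathbf a_1(t)\in\mathbb R^{3\times3}$ be $C^1$ on $[T_-,T_+]$. Suppose that $\mathbf r$ satisfies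 Newton's law $m\partial_t^2\mathbf r=q\mathbf E_W+\frac q{\mathrm c}\partial_t\mathbf r\times\mathbf B_W$, where $\mathbf E_W(t),\mathbf B_W(t)$ are the fields at $\mathbf x=\mathbf r(t)$ of the potentials $\phi_0+\phi_1\cdot(\mathbf x-\mathbf r)$, $\mathbf a_0+\mathbf a_1(\mathbf x-\mathbf r)$. The wave-corpuscle of size $a$ built on these data is $\psi(t,\mathbf x)=e^{\mathrm iS(t,\mathbf y)}\mathring\psi_a(|\mathbf y|)$, $\mathbf y=\mathbf x-\mathbf r(t)$, with $\mathbf v=\partial_t\mathbf r$ and $$\chi S=m\mathbf v\cdot\mathbf y+\tfrac q{\mathrm c}\mathbf y\cdot\mathbf a_0+\int_{T_-}^t\Bigl(\tfrac m2\mathbf v^2+\tfrac q{\mathrm c}\mathbf v\cdot\mathbf a_0-q\phi_0\Bigr)dt'+\tfrac q{2\mathrm c}\mathbf y\cdot\mathbf a_1\mathbf y .$$ **Statement.** Suppose that there is a sequence of asymptotic solutions (for some sequences $a_n,R_n,\varphi_n,\mathbf A_n$, with the limit potentials above) that concentrates at $\mathbf r$. Then there are sequences $a_n,R_n$ with $\hat\Omega_n\subset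 D$, and data $(\phi_0,\phi_1,\mathbf a_0,\mathbf a_1)$ as above with $\phi_0=\varphi(t,\mathbf r)$, $\mathbf a_0=\mathbf A(t,\mathbf r)$, $\mathbf E_W=\mathbf E(t,\mathbf r)$, $\mathbf B_W=\mathbf B(t,\mathbf r)$, such that the wave-corpuscles of sizes $a_n$ built on these data are asymptotic solutions of the NLS equations with potentials $\varphi_n=\varphi$, $\mathbf A_n=\mathbf A$ (and the same limit potentials) that concentrate at $\mathbf r$. If $t\mapsto\nabla\mathbf A(t,\mathbf r(t))$ is $C^2$, one can take $\phi_1=\nabla\varphi(t,\mathbf r)$ and $\mathbf a_1=\nabla\mathbf A(t,\mathbf r)$. -/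

import Mathlib

open Set Filter Topology MeasureTheory

noncomputable section

/-- Three-dimensional Euclidean space. -/
abbrev E3 := EuclideanSpace ℝ (Fin 3)

/-- Space-time: points are pairs `(t, x)`. -/
abbrev SpaceTime := ℝ × E3

/-! ### Vector calculus -/

/-- The cross product of two vectors. -/
def cross (u v : E3) : E3 := WithLp.toLp 2 (crossProduct u.ofLp v.ofLp)

/-- The curl of the linear vector field `y ↦ M y`. -/
def curlLin (M : E3 →L[ℝ] E3) : E3 :=
  !₂[M (EuclideanSpace.single 1 1) 2 - M (EuclideanSpace.single 2 1) 1,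
     M (EuclideanSpace.single 2 1) 0 - M (EuclideanSpace.single 0 1) 2,
     M (EuclideanSpace.single 0 1) 1 - M (EuclideanSpace.single 1 1) 0]

/-- Time derivative `∂_t f` of a function on the space-time region `Ω`
(one-sided at the boundary of `Ω`). -/
def dT {F : Type*} [NormedAddCommGroup F] [NormedSpace ℝ F]
    (Ω : Set SpaceTime) (f : SpaceTime → F) (p : SpaceTime) : F :=
  fderivWithin ℝ f Ω p (1, 0)

/-- Spatial derivative `∂_i f` of a function on the space-time region `Ω`
(one-sided at the boundary of `Ω`). -/
def dX {F : Type*} [NormedAddCommGroup F] [NormedSpace ℝ F]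
    (Ω : Set SpaceTime) (f : SpaceTime → F) (i : Fin 3) (p : SpaceTime) : F :=
  fderivWithin ℝ f Ω p (0, EuclideanSpace.single i 1)

/-- Surface integral of `f` over the sphere of radius `R` centred at `x₀`; the integrand
`f x ν` may depend on the point `x` of the sphere and on the outer unit normal `ν` there. -/
def sphereIntegral {F : Type*} [NormedAddCommGroup F] [NormedSpace ℝ F]
    (x₀ : E3) (R : ℝ) (f : E3 → E3 → F) : F :=
  R ^ 2 • ∫ ω : Metric.sphere (0 : E3) 1, f (x₀ + R • (ω : E3)) (ω : E3)
    ∂((volume : Measure E3).toSphere)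

/-! ### Trajectories and tubular neighbourhoods -/

/-- The velocity `∂_t r`. -/
def vel (Tm Tp : ℝ) (r : ℝ → E3) (t : ℝ) : E3 := derivWithin r (Icc Tm Tp) t

/-- The acceleration `∂_t² r`. -/
def acc (Tm Tp : ℝ) (r : ℝ → E3) (t : ℝ) : E3 := derivWithin (vel Tm Tp r) (Icc Tm Tp) t

/-- A trajectory: a twice continuously differentiable curve with bounded velocity and
acceleration. -/
structure IsTrajectory (Tm Tp : ℝ) (r : ℝ → E3) : Prop where
  contDiffOn : ContDiffOn ℝ 2 r (Icc Tm Tp)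
  bounded : ∃ C : ℝ, ∀ t ∈ Icc Tm Tp, ‖vel Tm Tp r t‖ ≤ C ∧ ‖acc Tm Tp r t‖ ≤ C

/-- The closed tube of radius `R` around the trajectory. -/
def tube (Tm Tp : ℝ) (r : ℝ → E3) (R : ℝ) : Set SpaceTime :=
  {p | p.1 ∈ Icc Tm Tp ∧ ‖p.2 - r p.1‖ ≤ R}

/-! ### The equation -/

/-- Mass `m`, charge `q`, the Planck-type constant `χ` and the speed of light `c`. -/
structure NLSParams where
  m : ℝ
  q : ℝ
  χ : ℝ
  c : ℝ
  m_pos : 0 < m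
  χ_pos : 0 < χ
  c_pos : 0 < c

/-- The regularity condition on the nonlinearity `g₁ = G₁'` and its antiderivative `G₁`. -/
structure RegularNonlinearity (G₁ g₁ : ℝ → ℝ) : Prop where
  zero : G₁ 0 = 0
  continuousOn_deriv : ContinuousOn g₁ (Ioi 0)
  hasDerivAt : ∀ s, 0 < s → HasDerivAt G₁ (g₁ s) s
  continuousOn : ContinuousOn G₁ (Ici 0)
  /-- The differential of `z ↦ G₁ (z* z)` is `g(z) dz* + g(z)* dz`, with `g(z) = G₁'(z* z) z` for
  `z ≠ 0` and `g(0) = 0`, and `g` is continuous. -/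
  complex_regular : ∃ g : ℂ → ℂ, Continuous g ∧ g 0 = 0 ∧
    (∀ z, z ≠ 0 → g z = (g₁ (‖z‖ ^ 2) : ℂ) * z) ∧
    ∀ z, ∃ L : ℂ →L[ℝ] ℝ, HasFDerivAt (fun w : ℂ => G₁ (‖w‖ ^ 2)) L z ∧
      ∀ h : ℂ, ((L h : ℝ) : ℂ) = g z * starRingEnd ℂ h + starRingEnd ℂ (g z) * h

/-- The rescaled antiderivative `G_a(s) = a⁻⁵ G₁(a³ s)`, for which
`G_a'(s) = a⁻² G₁'(a³ s)`. -/
def scaledG (G₁ : ℝ → ℝ) (a s : ℝ) : ℝ := a ^ (-5 : ℤ) * G₁ (a ^ 3 * s)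

/-- Positive radial, twice continuously differentiable, square integrable solutions `ψ₁(|x|)` of
the steady-state equation `-∇²ψ₁ + G₁'(|ψ₁|²) ψ₁ = 0` of a free charge. -/
structure IsFormFactor (g₁ ψ₁ : ℝ → ℝ) : Prop where
  pos : ∀ s, 0 ≤ s → 0 < ψ₁ s
  contDiff : ContDiff ℝ 2 (fun x : E3 => ψ₁ ‖x‖)
  steady : ∀ x : E3,
    -(Laplacian.laplacian (fun y : E3 => ψ₁ ‖y‖) x) + g₁ (ψ₁ ‖x‖ ^ 2) * ψ₁ ‖x‖ = 0
  sq_integrable : Integrable (fun x : E3 => ψ₁ ‖x‖ ^ 2)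

/-- The decay conditions: `θ² |ψ₁(θ)| ≤ C` and `θ³ |ψ₁'(θ)| ≤ C` as `θ → ∞`. -/
structure FormFactorDecay (ψ₁ : ℝ → ℝ) : Prop where
  decay : ∃ C : ℝ, ∀ᶠ θ in atTop, θ ^ 2 * |ψ₁ θ| ≤ C
  decay_deriv : ∃ C : ℝ, ∀ᶠ θ in atTop, θ ^ 3 * |deriv ψ₁ θ| ≤ C

/-! ### Densities -/

/-- The covariant time derivative `∂_t ψ + (i q / χ) φ ψ`. -/
def covT (K : NLSParams) (Ω : Set SpaceTime) (φ : SpaceTime → ℝ) (ψ : SpaceTime → ℂ)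
    (p : SpaceTime) : ℂ :=
  dT Ω ψ p + Complex.I * ((K.q / K.χ * φ p : ℝ) : ℂ) * ψ p

/-- The covariant spatial derivative `∂_i ψ - (i q / (χ c)) A_i ψ`. -/
def covX (K : NLSParams) (Ω : Set SpaceTime) (A : SpaceTime → E3) (ψ : SpaceTime → ℂ)
    (i : Fin 3) (p : SpaceTime) : ℂ :=
  dX Ω ψ i p - Complex.I * ((K.q / (K.χ * K.c) * A p i : ℝ) : ℂ) * ψ p

/-- The charge density `ρ = q |ψ|²`. -/
def chargeDensity (K : NLSParams) (ψ : SpaceTime → ℂ) (p : SpaceTime) : ℝ :=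
  K.q * ‖ψ p‖ ^ 2

/-- The momentum density `P = (i χ / 2) (ψ ∇̃*ψ* - ψ* ∇̃ψ) = χ Im (ψ* ∇̃ψ)`. -/
def momentumDensity (K : NLSParams) (Ω : Set SpaceTime) (A : SpaceTime → E3)
    (ψ : SpaceTime → ℂ) (p : SpaceTime) : E3 :=
  WithLp.toLp 2 fun i => K.χ * (starRingEnd ℂ (ψ p) * covX K Ω A ψ i p).im

/-- The current density `J = -(i q χ / (2 m)) (ψ* ∇̃ψ - ψ ∇̃*ψ*) = (q χ / m) Im (ψ* ∇̃ψ)`. -/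
def currentDensity (K : NLSParams) (Ω : Set SpaceTime) (A : SpaceTime → E3)
    (ψ : SpaceTime → ℂ) (p : SpaceTime) : E3 :=
  WithLp.toLp 2 fun i => K.q * K.χ / K.m * (starRingEnd ℂ (ψ p) * covX K Ω A ψ i p).im

/-- The electric field `E = -∇φ - c⁻¹ ∂_t A`. -/
def electricField (K : NLSParams) (Ω : Set SpaceTime) (φ : SpaceTime → ℝ)
    (A : SpaceTime → E3) (p : SpaceTime) : E3 :=
  WithLp.toLp 2 fun i => -dX Ω φ i p - K.c⁻¹ * dT Ω A p i

/-- The magnetic field `B = ∇ × A`. -/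
def magneticField (Ω : Set SpaceTime) (A : SpaceTime → E3) (p : SpaceTime) : E3 :=
  !₂[dX Ω A 1 p 2 - dX Ω A 2 p 1, dX Ω A 2 p 0 - dX Ω A 0 p 2, dX Ω A 0 p 1 - dX Ω A 1 p 0]

/-- The Lorentz force density `f = ρ E + c⁻¹ J × B`. -/
def lorentzDensity (K : NLSParams) (Ω : Set SpaceTime) (φ : SpaceTime → ℝ)
    (A : SpaceTime → E3) (ψ : SpaceTime → ℂ) (p : SpaceTime) : E3 :=
  chargeDensity K ψ p • electricField K Ω φ A p +
    K.c⁻¹ • cross (currentDensity K Ω A ψ p) (magneticField Ω A p)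

/-- The energy density `u = (χ² / (2 m)) (|∇̃ψ|² + G(|ψ|²))`. -/
def energyDensity (K : NLSParams) (Ω : Set SpaceTime) (G : ℝ → ℝ) (A : SpaceTime → E3)
    (ψ : SpaceTime → ℂ) (p : SpaceTime) : ℝ :=
  K.χ ^ 2 / (2 * K.m) * (∑ i, ‖covX K Ω A ψ i p‖ ^ 2 + G (‖ψ p‖ ^ 2))

/-- The spatial entries `T^{ij}` of the energy-momentum tensor
`T^{μν} = (∂L/∂ψ_{;μ}) ψ^{;ν} + (∂L/∂ψ*_{;μ}) ψ^{;ν*} - g^{μν} L` of the Lagrangian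
`L = (i χ / 2) (ψ* ∂̃_t ψ - ψ ∂̃_t*ψ*) - (χ² / (2 m)) (|∇̃ψ|² + G(|ψ|²))`. The overall sign is the
one for which solutions of the equation satisfy `∂_t P^j + ∂_i T^{ij} = f^j`. -/
def stress (K : NLSParams) (Ω : Set SpaceTime) (G : ℝ → ℝ) (φ : SpaceTime → ℝ)
    (A : SpaceTime → E3) (ψ : SpaceTime → ℂ) (i j : Fin 3) (p : SpaceTime) : ℝ :=
  K.χ ^ 2 / K.m * (covX K Ω A ψ i p * starRingEnd ℂ (covX K Ω A ψ j p)).re -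
    if i = j then
      energyDensity K Ω G A ψ p + K.χ * (starRingEnd ℂ (ψ p) * covT K Ω φ ψ p).im
    else 0

/-! ### Potentials that are linear around the trajectory -/

/-- Coefficients of potentials of the form `φ₀(t) + (x - r(t)) · φ₁(t)` and
`A₀(t) + A₁(t) (x - r(t))`. -/
structure LinearPotentials where
  φ₀ : ℝ → ℝ
  φ₁ : ℝ → E3
  A₀ : ℝ → E3
  A₁ : ℝ → E3 →L[ℝ] E3

/-- The linear scalar potential. -/
def LinearPotentials.phi (L : LinearPotentials) (r : ℝ → E3) (p : SpaceTime) : ℝ :=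
  L.φ₀ p.1 + inner ℝ (L.φ₁ p.1) (p.2 - r p.1)

/-- The linear vector potential. -/
def LinearPotentials.vec (L : LinearPotentials) (r : ℝ → E3) (p : SpaceTime) : E3 :=
  L.A₀ p.1 + L.A₁ p.1 (p.2 - r p.1)

/-- The electric field of the linear potentials on the trajectory; the time derivative is taken at
the fixed point `x = r(t)`. -/
def LinearPotentials.elec (L : LinearPotentials) (K : NLSParams) (Tm Tp : ℝ) (r : ℝ → E3)
    (t : ℝ) : E3 :=
  -L.φ₁ t - K.c⁻¹ • derivWithin (fun s => L.vec r (s, r t)) (Icc Tm Tp) t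

/-- The magnetic field of the linear potentials on the trajectory. -/
def LinearPotentials.magn (L : LinearPotentials) (t : ℝ) : E3 := curlLin (L.A₁ t)

/-- The linear part of the potentials `φ, A` at the trajectory. -/
def linearPart (φ : SpaceTime → ℝ) (A : SpaceTime → E3) (r : ℝ → E3) : LinearPotentials where
  φ₀ t := φ (t, r t)
  φ₁ t := WithLp.toLp 2 fun i => fderiv ℝ φ (t, r t) (0, EuclideanSpace.single i 1)
  A₀ t := A (t, r t)
  A₁ t := (fderiv ℝ A (t, r t)).comp (ContinuousLinearMap.inr ℝ ℝ E3)

/-! ### Localized equations -/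

/-- The equations with size parameters `a n` and potentials `φ n`, `A n` are localized in the tubes
of radius `R n`, with limit potentials `L`. -/
structure LocalizedNLS (Tm Tp : ℝ) (r : ℝ → E3) (a R : ℕ → ℝ)
    (φ : ℕ → SpaceTime → ℝ) (A : ℕ → SpaceTime → E3) (L : LinearPotentials) : Prop where
  a_pos : ∀ n, 0 < a n
  R_pos : ∀ n, 0 < R n
  a_tendsto : Tendsto a atTop (𝓝 0)
  R_tendsto : Tendsto R atTop (𝓝 0)
  ratio_tendsto : Tendsto (fun n => R n / a n) atTop atTop
  limit_diff : DifferentiableOn ℝ L.φ₀ (Icc Tm Tp) ∧ DifferentiableOn ℝ L.φ₁ (Icc Tm Tp) ∧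
    DifferentiableOn ℝ L.A₀ (Icc Tm Tp) ∧ DifferentiableOn ℝ L.A₁ (Icc Tm Tp)
  limit_bounded : ∃ C : ℝ, ∀ t ∈ Icc Tm Tp,
    |L.φ₀ t| ≤ C ∧ |derivWithin L.φ₀ (Icc Tm Tp) t| ≤ C ∧ ‖L.φ₁ t‖ ≤ C ∧
    ‖L.A₀ t‖ ≤ C ∧ ‖derivWithin L.A₀ (Icc Tm Tp) t‖ ≤ C ∧ ‖L.A₁ t‖ ≤ C
  φ_contDiffOn : ∀ n, ContDiffOn ℝ 2 (φ n) (tube Tm Tp r (R n))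
  A_contDiffOn : ∀ n, ContDiffOn ℝ 2 (A n) (tube Tm Tp r (R n))
  φ_tendsto : ∀ ε > 0, ∀ᶠ n in atTop, ∀ p ∈ tube Tm Tp r (R n),
    |φ n p - L.phi r p| + ‖fderivWithin ℝ (φ n) (tube Tm Tp r (R n)) p -
      fderivWithin ℝ (L.phi r) (tube Tm Tp r (R n)) p‖ < ε
  A_tendsto : ∀ ε > 0, ∀ᶠ n in atTop, ∀ p ∈ tube Tm Tp r (R n),
    ‖A n p - L.vec r p‖ + ‖fderivWithin ℝ (A n) (tube Tm Tp r (R n)) p -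
      fderivWithin ℝ (L.vec r) (tube Tm Tp r (R n)) p‖ < ε
  φ_bounded : ∃ C : ℝ, ∀ n, ∀ p ∈ tube Tm Tp r (R n),
    |φ n p| ≤ C ∧ ‖fderivWithin ℝ (φ n) (tube Tm Tp r (R n)) p‖ ≤ C
  A_bounded : ∃ C : ℝ, ∀ n, ∀ p ∈ tube Tm Tp r (R n),
    ‖A n p‖ ≤ C ∧ ‖fderivWithin ℝ (A n) (tube Tm Tp r (R n)) p‖ ≤ C

/-! ### Concentration of asymptotic solutions -/

/-- The integral over the ball `Ω(r(t), R)` at time `t`. -/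
def ballIntegral {F : Type*} [NormedAddCommGroup F] [NormedSpace ℝ F]
    (r : ℝ → E3) (R : ℝ) (f : SpaceTime → F) (t : ℝ) : F :=
  ∫ x in Metric.closedBall (r t) R, f (t, x)

/-- The surface integral over the sphere `∂Ω(r(t), R)` at time `t`; the integrand is a function of
the space-time point and of the outer unit normal. -/
def boundaryIntegral {F : Type*} [NormedAddCommGroup F] [NormedSpace ℝ F]
    (r : ℝ → E3) (R : ℝ) (f : SpaceTime → E3 → F) (t : ℝ) : F :=
  sphereIntegral (r t) R fun x ν => f (t, x) ν

/-- The adjacent charge value: the charge in the ball `Ω(r(t), R)`. -/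
def localCharge (K : NLSParams) (r : ℝ → E3) (R : ℝ) (ψ : SpaceTime → ℂ) (t : ℝ) : ℝ :=
  ballIntegral r R (chargeDensity K ψ) t

/-- The adjacent charge center. -/
def chargeCenter (K : NLSParams) (r : ℝ → E3) (R : ℝ) (ψ : SpaceTime → ℂ) (t : ℝ) : E3 :=
  (localCharge K r R ψ t)⁻¹ • ballIntegral r R (fun p => chargeDensity K ψ p • p.2) t

/-- Uniform convergence to zero on the time interval. -/
def UnifToZero {F : Type*} [NormedAddCommGroup F] (Tm Tp : ℝ) (Q : ℕ → ℝ → F) : Prop :=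
  TendstoUniformlyOn Q (fun _ => 0) atTop (Icc Tm Tp)

/-- The perturbation terms `ρ', J', P', T'^{ij}, f'` in the conservation laws. -/
structure Perturbation where
  ρ : SpaceTime → ℝ
  J : SpaceTime → E3
  P : SpaceTime → E3
  T : Fin 3 → Fin 3 → SpaceTime → ℝ
  f : SpaceTime → E3

/-- The perturbation is regular on `Ω`, and `ψ` satisfies on `Ω` the perturbed continuity and
momentum equations
`∂_t ρ + ∂_t ρ' + ∇·J + ∇·J' = 0`, `∂_t P + ∂_t P' + ∂_i T^{ij} + ∂_i T'^{ij} = f + f'`. -/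
structure PerturbedLaws (K : NLSParams) (Ω : Set SpaceTime) (G : ℝ → ℝ) (φ : SpaceTime → ℝ)
    (A : SpaceTime → E3) (ψ : SpaceTime → ℂ) (U : Perturbation) : Prop where
  ρ_contDiffOn : ContDiffOn ℝ 1 U.ρ Ω
  J_contDiffOn : ContDiffOn ℝ 1 U.J Ω
  P_contDiffOn : ContDiffOn ℝ 1 U.P Ω
  T_contDiffOn : ∀ i j, ContDiffOn ℝ 1 (U.T i j) Ω
  f_continuousOn : ContinuousOn U.f Ω
  continuity : ∀ p ∈ Ω,
    dT Ω (chargeDensity K ψ) p + dT Ω U.ρ p +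
      ∑ i, dX Ω (currentDensity K Ω A ψ) i p i + ∑ i, dX Ω U.J i p i = 0
  momentum : ∀ p ∈ Ω, ∀ j : Fin 3,
    dT Ω (momentumDensity K Ω A ψ) p j + dT Ω U.P p j +
      ∑ i, dX Ω (stress K Ω G φ A ψ i j) i p + ∑ i, dX Ω (U.T i j) i p =
      lorentzDensity K Ω φ A ψ p j + U.f p j

/-- The asymptotic solutions `ψ n` of the equations with size parameters `a n`, potentials `φ n`,
`A n` and nonlinearity `G_{a n}'` concentrate at the trajectory `r`, in the tubes of radius `R n`,
with limit potentials `L`. -/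
structure ConcentratesAsymptotically (K : NLSParams) (G₁ : ℝ → ℝ) (Tm Tp : ℝ) (r : ℝ → E3)
    (a R : ℕ → ℝ) (φ : ℕ → SpaceTime → ℝ) (A : ℕ → SpaceTime → E3) (ψ : ℕ → SpaceTime → ℂ)
    (L : LinearPotentials) : Prop where
  localized : LocalizedNLS Tm Tp r a R φ A L
  contDiffOn : ∀ n, ContDiffOn ℝ 2 (ψ n) (tube Tm Tp r (R n))
  momentum_bounded : ∃ C : ℝ, ∀ n, ∀ t ∈ Icc Tm Tp,
    ‖ballIntegral r (R n) (momentumDensity K (tube Tm Tp r (R n)) (A n) (ψ n)) t‖ ≤ C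
  charge_bounded : ∃ C c₀ : ℝ, 0 < c₀ ∧ ∃ n₀ : ℕ, ∀ n ≥ n₀, ∀ t ∈ Icc Tm Tp,
    c₀ ≤ localCharge K r (R n) (ψ n) t ∧ localCharge K r (R n) (ψ n) t ≤ C
  asymptotic : ∃ t₀ ∈ Icc Tm Tp,
    (∃ ρinf : ℝ, Tendsto (fun n => localCharge K r (R n) (ψ n) t₀) atTop (𝓝 ρinf)) ∧
    -- the boundary integrals `Q₀`, `Q₀₁`, `Q₂₀`, `Q₂₂`, `Q₂₃`
    UnifToZero Tm Tp (fun n t => ∫ s in t₀..t,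
      boundaryIntegral r (R n) (fun p ν => (WithLp.toLp 2 fun j => ∑ i, ν i *
        stress K (tube Tm Tp r (R n)) (scaledG G₁ (a n)) (φ n) (A n) (ψ n) i j p : E3)) s) ∧
    UnifToZero Tm Tp (fun n t => ∫ s in t₀..t,
      boundaryIntegral r (R n) (fun p ν => inner ℝ (vel Tm Tp r p.1) ν •
        momentumDensity K (tube Tm Tp r (R n)) (A n) (ψ n) p) s) ∧
    UnifToZero Tm Tp (fun n t =>
      -boundaryIntegral r (R n) (fun p ν =>
        (inner ℝ (vel Tm Tp r p.1) ν * chargeDensity K (ψ n) p) •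
          (p.2 - chargeCenter K r (R n) (ψ n) p.1)) t) ∧
    UnifToZero Tm Tp (fun n t =>
      boundaryIntegral r (R n) (fun p ν =>
        inner ℝ ν (currentDensity K (tube Tm Tp r (R n)) (A n) (ψ n) p) •
          (p.2 - chargeCenter K r (R n) (ψ n) p.1)) t) ∧
    UnifToZero Tm Tp (fun n t =>
      (∫ s in t₀..t, boundaryIntegral r (R n) (fun p ν =>
        inner ℝ (vel Tm Tp r p.1) ν * chargeDensity K (ψ n) p) s) -
      ∫ s in t₀..t, boundaryIntegral r (R n) (fun p ν =>
        inner ℝ ν (currentDensity K (tube Tm Tp r (R n)) (A n) (ψ n) p)) s) ∧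
    -- the volume integrals `Q₃₀ + Q₃₁`
    UnifToZero Tm Tp (fun n t => ∫ s in t₀..t,
      (ballIntegral r (R n) (fun p => chargeDensity K (ψ n) p •
          (electricField K (tube Tm Tp r (R n)) (φ n) (A n) p - L.elec K Tm Tp r p.1)) s +
        ballIntegral r (R n) (fun p => K.c⁻¹ •
          cross (currentDensity K (tube Tm Tp r (R n)) (A n) (ψ n) p)
            (magneticField (tube Tm Tp r (R n)) (A n) p - L.magn p.1)) s)) ∧
    -- the conservation laws hold up to perturbations with vanishing `Q₀'`, `Q₂'`, `Q₃'`
    ∃ U : ℕ → Perturbation,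
      (∀ n, PerturbedLaws K (tube Tm Tp r (R n)) (scaledG G₁ (a n)) (φ n) (A n) (ψ n) (U n)) ∧
      UnifToZero Tm Tp (fun n t =>
        ballIntegral r (R n) (U n).P t - ballIntegral r (R n) (U n).P t₀ -
        (∫ s in t₀..t, boundaryIntegral r (R n) (fun p ν =>
          inner ℝ (vel Tm Tp r p.1) ν • (U n).P p) s) +
        (∫ s in t₀..t, ballIntegral r (R n) (fun p =>
          (WithLp.toLp 2 fun j => ∑ i, dX (tube Tm Tp r (R n)) ((U n).T i j) i p : E3)) s) -
        ∫ s in t₀..t, ballIntegral r (R n) (U n).f s) ∧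
      UnifToZero Tm Tp (fun n t =>
        ballIntegral r (R n) (dT (tube Tm Tp r (R n)) (fun p =>
          (U n).ρ p • (p.2 - chargeCenter K r (R n) (ψ n) p.1))) t +
        ballIntegral r (R n) (U n).ρ t •
          derivWithin (chargeCenter K r (R n) (ψ n)) (Icc Tm Tp) t +
        boundaryIntegral r (R n) (fun p ν =>
          inner ℝ ν ((U n).J p) • (p.2 - chargeCenter K r (R n) (ψ n) p.1)) t -
        ballIntegral r (R n) (U n).J t) ∧
      UnifToZero Tm Tp (fun n t =>
        ballIntegral r (R n) (U n).ρ t - ballIntegral r (R n) (U n).ρ t₀ -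
        (∫ s in t₀..t, boundaryIntegral r (R n) (fun p ν =>
          inner ℝ (vel Tm Tp r p.1) ν * (U n).ρ p) s) +
        ∫ s in t₀..t, boundaryIntegral r (R n) (fun p ν => inner ℝ ν ((U n).J p)) s)

/-! ### Wave-corpuscles -/

/-- The potentials from which a wave-corpuscle with center `r` is built: their linear part `W` has
continuously differentiable coefficients, and `r` satisfies Newton's law with the Lorentz force,
`m ∂_t² r = q E + (q / c) ∂_t r × B`. (The wave-corpuscle is then an exact solution of the
equation with vector potential `A₀ + A₁ y`, `y = x - r`, and scalar potential
`φ₀ + y · φ₁ + φ₂`, where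
`φ₂ = -(q / (2 m c²)) |½ (A₁ - A₁ᵀ) y|² - (1 / (2 c)) y · (∂_t A₁) y`.) -/
structure WaveCorpusclePotentials (K : NLSParams) (Tm Tp : ℝ) (r : ℝ → E3)
    (W : LinearPotentials) : Prop where
  φ₀_contDiffOn : ContDiffOn ℝ 1 W.φ₀ (Icc Tm Tp)
  φ₁_contDiffOn : ContDiffOn ℝ 1 W.φ₁ (Icc Tm Tp)
  A₀_contDiffOn : ContDiffOn ℝ 1 W.A₀ (Icc Tm Tp)
  A₁_contDiffOn : ContDiffOn ℝ 1 W.A₁ (Icc Tm Tp)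
  newton : ∀ t ∈ Icc Tm Tp, K.m • acc Tm Tp r t =
    K.q • W.elec K Tm Tp r t + (K.q / K.c) • cross (vel Tm Tp r t) (W.magn t)

/-- The phase `S(t, y)` of the wave-corpuscle:
`χ S = m v·y + (q/c) y·A₀ + ∫ (m v²/2 + (q/c) v·A₀ - q φ₀) dt + (q/(2c)) y·A₁ y`. -/
def wavePhase (K : NLSParams) (Tm Tp : ℝ) (r : ℝ → E3) (W : LinearPotentials)
    (t : ℝ) (y : E3) : ℝ :=
  K.χ⁻¹ * (K.m * inner ℝ (vel Tm Tp r t) y + K.q / K.c * inner ℝ y (W.A₀ t) +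
    (∫ s in Tm..t, (K.m / 2 * ‖vel Tm Tp r s‖ ^ 2 +
      K.q / K.c * inner ℝ (vel Tm Tp r s) (W.A₀ s) - K.q * W.φ₀ s)) +
    K.q / (2 * K.c) * inner ℝ y (W.A₁ t y))

/-- The wave-corpuscle `ψ(t, x) = e^{iS} a^{-3/2} ψ₁(a⁻¹ |x - r(t)|)`. -/
def waveCorpuscle (K : NLSParams) (Tm Tp : ℝ) (r : ℝ → E3) (W : LinearPotentials)
    (ψ₁ : ℝ → ℝ) (a : ℝ) (p : SpaceTime) : ℂ :=
  Complex.exp (Complex.I * (wavePhase K Tm Tp r W p.1 (p.2 - r p.1) : ℂ)) *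
    ((a ^ (-(3 / 2) : ℝ) * ψ₁ (a⁻¹ * ‖p.2 - r p.1‖) : ℝ) : ℂ)

end

/-!
Write `v = ∂_t r`, and let `E`, `B` be the fields of the linear parts of `φ`, `A` on the
trajectory. The given asymptotic solutions enter only through Newton's law for `r` and the sign of
`q`; the wave-corpuscles are then shown to concentrate by a direct computation.

Newton's law. The transport theorem for the moving balls (`hasDerivAt_ballIntegral`) rests on a
divergence theorem for functions that are differentiable in the open ball and continuous up to the
sphere. Applied to the perturbed conservation laws it gives balances of the charge
(`localCharge_sub_eq`), of the charge center (`localCharge_smul_derivWithin_chargeCenter`) and of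
the momentum (`momentum_sub_eq`), in which all boundary and perturbation terms tend to zero. So
the charge tends to a constant, the charge center, which lies in a shrinking ball, tends to `r`,
and the primitives of the total momenta tend to a multiple of the displacement of `r`. The momenta
themselves need not be known to converge: the magnetic term is integrated by parts
(`unifToZero_integral_cross`), and `limit_equation_of_motion` passes to the limit. This proves
`newton_of_concentratesAsymptotically`.

Regularity. Since `E` and `B` are `C¹`, Newton's law makes `r` of class `C³`
(`contDiffOn_two_vel`), so that the phase of the wave-corpuscle is `C²` as soon as the quadratic
form of `A₁` is (`contDiffOn_corpusclePhase`). If `∇A` is not `C²` along the trajectory, it is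
replaced by its antisymmetric part `y ↦ ½ B × y`, whose quadratic form is zero, and `φ₁` is
adjusted so that the electric field remains the same (`antisymmetrized`).

Concentration. Take sizes `a = R⁵`. In the polar form `ψ = u e^{iσ}` the momentum density is
`u² k`, where the kinetic momentum `k = χ ∇σ - (q/c) A` is continuous, does not depend on the size,
and equals `m v` on the trajectory (`kineticMomentum_center`). As `u²` concentrates, total
momentum, current and force tend to those of a point particle with the mass and charge of the form
factor. On the boundary sphere, at the scaled distance `R / a = R⁻⁴`, the decay of the form factor
makes `u²` and `|∇u|²` at most of order `R⁻¹`, so that their integrals over the sphere are `O(R)`;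
the nonlinear part of the stress need not be small, but it is constant on the sphere and exerts no
total force (`boundaryIntegral_stress`).

Since `u²` is carried along rigidly with velocity `v`, the conservation laws hold with `ρ' = 0`,
`P' = 0`, `T' = 0`, the current `J' = ρ v - J`, and `f'` equal to the defect of the momentum
equation (`transportPerturbation`). The integral of `J'` tends to zero because `k` tends to `m v`.
The integral of `f'` is, by the momentum balance, the change of the momentum minus the Lorentz
force up to boundary terms, and it tends to zero by Newton's law
(`unifToZero_force_balance_corpuscles`).
-/

noncomputable section

/-! ### Polar coordinates and the divergence theorem on a ball -/

/-- Integration in polar coordinates. -/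
theorem integral_eq_integral_sphere {f : E3 → ℝ} (hf : Integrable f) :
    ∫ x, f x = ∫ s in Ioi (0 : ℝ), s ^ 2 *
      ∫ ω : Metric.sphere (0 : E3) 1, f (s • (ω : E3)) ∂((volume : Measure E3).toSphere) := by
  have hfin : Module.finrank ℝ E3 - 1 = 2 := by simp
  have hmp := (volume : Measure E3).measurePreserving_homeomorphUnitSphereProd
  rw [hfin] at hmp
  have hemb := (homeomorphUnitSphereProd E3).measurableEmbedding
  set e := homeomorphUnitSphereProd E3 with he
  have hsymm : ∀ x : ({0}ᶜ : Set E3), f x = f ((e x).2.1 • ((e x).1 : E3)) := by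
    intro x
    have h1 : e.symm (e x) = x := e.symm_apply_apply x
    have h2 : ((e.symm (e x) : ({0}ᶜ : Set E3)) : E3) = (e x).2.1 • ((e x).1 : E3) := by
      rw [he, homeomorphUnitSphereProd_symm_apply_coe]
    rw [← h2, h1]
  have h1 : ∫ x, f x = ∫ x : ({0}ᶜ : Set E3), f x ∂((volume : Measure E3).comap (↑)) := by
    rw [integral_subtype_comap (measurableSet_singleton _).compl f,
      restrict_compl_singleton]
  have hint : Integrable (fun x : ({0}ᶜ : Set E3) => f x)
      ((volume : Measure E3).comap (↑)) := by
    have := hf.integrableOn (s := ({0}ᶜ : Set E3))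
    rwa [integrableOn_iff_comap_subtypeVal (measurableSet_singleton _).compl] at this
  have hint2 : Integrable (fun z : Metric.sphere (0 : E3) 1 × Ioi (0 : ℝ) =>
      f (z.2.1 • (z.1 : E3)))
      ((volume : Measure E3).toSphere.prod (Measure.volumeIoiPow 2)) := by
    rw [← hmp.integrable_comp_emb hemb]
    refine hint.congr (Eventually.of_forall fun x => ?_)
    exact hsymm x
  rw [h1, integral_congr_ae (Eventually.of_forall hsymm),
    hmp.integral_comp hemb (fun z : Metric.sphere (0 : E3) 1 × Ioi (0 : ℝ) =>
      f (z.2.1 • (z.1 : E3))), integral_prod_symm _ hint2]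
  simp only [Measure.volumeIoiPow, ENNReal.ofReal]
  rw [integral_withDensity_eq_integral_smul,
    integral_subtype_comap measurableSet_Ioi fun a ↦ Real.toNNReal (a ^ 2) •
      ∫ ω : Metric.sphere (0 : E3) 1, f (a • (ω : E3)) ∂((volume : Measure E3).toSphere),
    setIntegral_congr_fun measurableSet_Ioi fun x hx ↦ ?_]
  · rw [NNReal.smul_def, Real.coe_toNNReal _ (pow_nonneg (le_of_lt hx) _), smul_eq_mul]
  · exact (measurable_subtype_coe.pow_const _).real_toNNReal

/-- Integrals over a compact set depend continuously on parameters. -/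
theorem continuousOn_setIntegral_of_continuousOn {X Y F : Type*} [TopologicalSpace X]
    [FirstCountableTopology X] [TopologicalSpace Y] [MeasurableSpace Y] [OpensMeasurableSpace Y]
    [TopologicalSpace.PseudoMetrizableSpace Y]
    [NormedAddCommGroup F] [NormedSpace ℝ F] {μ : Measure Y}
    {S : Set X} {k : Set Y} (hS : IsCompact S) (hk : IsCompact k) (hkm : MeasurableSet k)
    (hμ : μ k ≠ ⊤) {f : X → Y → F}
    (hf : ContinuousOn (fun z : X × Y => f z.1 z.2) (S ×ˢ k)) :
    ContinuousOn (fun x => ∫ y in k, f x y ∂μ) S := by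
  obtain ⟨C, hC⟩ := (hS.prod hk).exists_bound_of_continuousOn hf
  have hfy : ∀ x ∈ S, ContinuousOn (f x) k := fun x hx =>
    hf.comp (continuousOn_const.prodMk continuousOn_id) fun y hy => ⟨hx, hy⟩
  intro x hx
  have : IsFiniteMeasure (μ.restrict k) := ⟨by simpa using hμ.lt_top⟩
  refine continuousWithinAt_of_dominated (bound := fun _ => C) ?_ ?_ (integrable_const C) ?_
  · filter_upwards [self_mem_nhdsWithin] with x' hx'
    exact (hfy x' hx').aestronglyMeasurable_of_isCompact hk hkm
  · filter_upwards [self_mem_nhdsWithin] with x' hx'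
    filter_upwards [ae_restrict_mem hkm] with y hy
    exact hC (x', y) ⟨hx', hy⟩
  · filter_upwards [ae_restrict_mem hkm] with y hy
    exact ContinuousWithinAt.comp (t := S ×ˢ k) (f := fun x' => (x', y)) (hf (x, y) ⟨hx, hy⟩)
      (continuousWithinAt_id.prodMk continuousWithinAt_const) fun x' hx' => ⟨hx', hy⟩

/-- The weak form of `h' = k`, `h 0 = 0` on an interval, tested against functions of `s ^ 2` that
vanish from some `ρ < R` on, forces `h` to be the primitive of `k`: after an integration by parts, a
test function proportional to `h - ∫ k` turns the identity into the vanishing of the integral of a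
square. -/
theorem eq_integral_of_weak {h k : ℝ → ℝ} (hh : Continuous h) (hk : Continuous k) {R : ℝ}
    (hR : 0 < R)
    (hw : ∀ ρ ∈ Ioo 0 R, ∀ Y : ℝ → ℝ, Continuous Y → (∀ w, ρ ^ 2 ≤ w → Y w = 0) →
      ∫ s in 0..ρ, 2 * s * Y (s ^ 2) * h s =
        -∫ s in 0..ρ, (∫ w in (ρ ^ 2)..(s ^ 2), Y w) * k s) :
    h R = ∫ s in 0..R, k s := by
  set K : ℝ → ℝ := fun s => ∫ u in 0..s, k u with hK
  have hKd : ∀ s, HasDerivAt K (k s) s := fun s =>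
    intervalIntegral.integral_hasDerivAt_right (hk.intervalIntegrable _ _)
      (hk.stronglyMeasurableAtFilter _ _) hk.continuousAt
  have hKc : Continuous K := continuous_iff_continuousAt.2 fun s => (hKd s).continuousAt
  have key : EqOn h K (Ioo 0 R) := by
    intro s₀ hs₀
    by_contra hne
    -- test with the defect `h - K`, cut off at a `ρ` beyond `s₀`
    obtain ⟨ρ, hρ1, hρ2⟩ := exists_between hs₀.2
    have hρ0 : 0 < ρ := hs₀.1.trans hρ1
    set Y : ℝ → ℝ := fun w => max 0 (ρ ^ 2 - w) * (h √w - K √w) with hY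
    have hYc : Continuous Y := by fun_prop
    have hY0 : ∀ w, ρ ^ 2 ≤ w → Y w = 0 := fun w hw' => by
      simp [hY, max_eq_left (sub_nonpos.2 hw')]
    have h1 := hw ρ ⟨hρ0, hρ2⟩ Y hYc hY0
    set X : ℝ → ℝ := fun s => ∫ w in (ρ ^ 2)..(s ^ 2), Y w with hX
    have hXd : ∀ s, HasDerivAt X (2 * s * Y (s ^ 2)) s := fun s => by
      have a1 : HasDerivAt (fun w => ∫ w in (ρ ^ 2)..w, Y w) (Y (s ^ 2)) (s ^ 2) :=
        intervalIntegral.integral_hasDerivAt_right (hYc.intervalIntegrable _ _)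
          (hYc.stronglyMeasurableAtFilter _ _) hYc.continuousAt
      have a2 : HasDerivAt (fun s : ℝ => s ^ 2) (2 * s) s := by simpa using hasDerivAt_pow 2 s
      have := HasDerivAt.comp (h := fun s : ℝ => s ^ 2) s a1 a2
      rw [mul_comm]; exact this
    have h2 : ∫ s in 0..ρ, X s * k s = X ρ * K ρ - X 0 * K 0 -
        ∫ s in 0..ρ, (2 * s * Y (s ^ 2)) * K s :=
      intervalIntegral.integral_mul_deriv_eq_deriv_mul (fun s _ => hXd s) (fun s _ => hKd s)
        (Continuous.intervalIntegrable (by fun_prop) _ _) (hk.intervalIntegrable _ _)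
    have hXρ : X ρ = 0 := by simp [hX]
    have hK0 : K 0 = 0 := by simp [hK]
    rw [h2, hXρ, hK0] at h1
    have h3 : ∫ s in 0..ρ, 2 * s * Y (s ^ 2) * (h s - K s) = 0 := by
      have e : (fun s => 2 * s * Y (s ^ 2) * (h s - K s)) = fun s =>
        2 * s * Y (s ^ 2) * h s - 2 * s * Y (s ^ 2) * K s := by ext; ring
      rw [e, intervalIntegral.integral_sub (Continuous.intervalIntegrable (by fun_prop) _ _)
        (Continuous.intervalIntegrable (by fun_prop) _ _), h1]
      ring
    have h4 : ∀ s, 0 ≤ s → 2 * s * Y (s ^ 2) * (h s - K s) =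
        2 * s * max 0 (ρ ^ 2 - s ^ 2) * (h s - K s) ^ 2 := fun s hs => by
      simp only [hY, Real.sqrt_sq hs]; ring
    have h5 : 0 < ∫ s in 0..ρ, 2 * s * Y (s ^ 2) * (h s - K s) := by
      refine intervalIntegral.integral_pos hρ0 (by fun_prop) ?_ ⟨s₀, ⟨hs₀.1.le, hρ1.le⟩, ?_⟩
      · intro s hs
        rw [h4 s hs.1.le]
        have := hs.1
        positivity
      · rw [h4 s₀ hs₀.1.le]
        have a1 : 0 < ρ ^ 2 - s₀ ^ 2 := by have := hs₀.1; nlinarith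
        have a2 : 0 < max 0 (ρ ^ 2 - s₀ ^ 2) := lt_max_of_lt_right a1
        have a3 : h s₀ - K s₀ ≠ 0 := sub_ne_zero.2 hne
        have := hs₀.1
        positivity
    linarith
  have := key.closure hh hKc
  rw [closure_Ioo hR.ne] at this
  exact this ⟨hR.le, le_rfl⟩

/-- The divergence theorem on a ball for a function that is differentiable only in the open ball.
Integration by parts against radial cutoffs `X(‖x‖²)`, followed by polar coordinates, reduces it to
the one-dimensional weak identity of `eq_integral_of_weak`. -/
theorem integral_closedBall_lineDeriv_real {f f' : E3 → ℝ} {R : ℝ} (hR : 0 < R) {v : E3}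
    (hf : ContinuousOn f (Metric.closedBall 0 R)) (hf' : ContinuousOn f' (Metric.closedBall 0 R))
    (hd : ∀ x ∈ Metric.ball (0 : E3) R, HasLineDerivAt ℝ f (f' x) x v) :
    ∫ x in Metric.closedBall (0 : E3) R, f' x =
      R ^ 2 * ∫ ω : Metric.sphere (0 : E3) 1, inner ℝ (ω : E3) v * f (R • (ω : E3))
        ∂((volume : Measure E3).toSphere) := by
  set σ := (volume : Measure E3).toSphere with hσ
  have hmaps : ∀ s ∈ Icc 0 R, ∀ ω : Metric.sphere (0 : E3) 1,
      s • (ω : E3) ∈ Metric.closedBall (0 : E3) R := fun s hs ω => by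
    have : ‖(ω : E3)‖ = 1 := by simp
    simpa [norm_smul, this, abs_of_nonneg hs.1] using hs.2
  have hcs : ∀ g : E3 → ℝ, ContinuousOn g (Metric.closedBall 0 R) →
      ∀ l : E3 → ℝ, Continuous l →
      ContinuousOn (fun s : ℝ => s ^ 2 * ∫ ω : Metric.sphere (0 : E3) 1,
        l ω * g (s • (ω : E3)) ∂σ) (Icc 0 R) := by
    intro g hg l hl
    refine ContinuousOn.mul (by fun_prop) ?_
    have := continuousOn_setIntegral_of_continuousOn (μ := σ) (S := Icc 0 R)
      (k := (univ : Set (Metric.sphere (0 : E3) 1)))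
      (f := fun s ω => l ω * g (s • (ω : E3)))
      isCompact_Icc isCompact_univ MeasurableSet.univ (measure_ne_top _ _) ?_
    · simpa using this
    · refine ContinuousOn.mul (by fun_prop) (hg.comp (by fun_prop) ?_)
      rintro ⟨s, ω⟩ ⟨hs, -⟩
      exact hmaps s hs ω
  set h₀ : ℝ → ℝ := fun s => s ^ 2 * ∫ ω : Metric.sphere (0 : E3) 1,
    inner ℝ (ω : E3) v * f (s • (ω : E3)) ∂σ with hh₀
  set k₀ : ℝ → ℝ := fun s => s ^ 2 * ∫ ω : Metric.sphere (0 : E3) 1,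
    1 * f' (s • (ω : E3)) ∂σ with hk₀
  have hh₀c : ContinuousOn h₀ (Icc 0 R) := hcs f hf (fun x => inner ℝ x v) (by fun_prop)
  have hk₀c : ContinuousOn k₀ (Icc 0 R) := hcs f' hf' (fun _ => 1) continuous_const
  set h : ℝ → ℝ := IccExtend hR.le ((Icc 0 R).domRestrict h₀) with hh
  set k : ℝ → ℝ := IccExtend hR.le ((Icc 0 R).domRestrict k₀) with hk
  have hhc : Continuous h := hh₀c.domRestrict.Icc_extend'
  have hkc : Continuous k := hk₀c.domRestrict.Icc_extend'
  have hhe : ∀ s ∈ Icc 0 R, h s = h₀ s := fun s hs => by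
    rw [hh, IccExtend_of_mem _ _ hs]; rfl
  have hke : ∀ s ∈ Icc 0 R, k s = k₀ s := fun s hs => by
    rw [hk, IccExtend_of_mem _ _ hs]; rfl
  -- polar coordinates for the product of a function on a ball with a radial function
  have hpolar : ∀ ρ ∈ Ioc 0 R, ∀ g : E3 → ℝ, ContinuousOn g (Metric.closedBall 0 R) →
      ∀ (l : E3 → ℝ), Continuous l → ∀ Z : ℝ → ℝ, Continuous Z →
      (∫ x in Metric.closedBall (0 : E3) ρ, Z ‖x‖ * (l x * g x)) =
        ∫ s in 0..ρ, Z s * (s ^ 2 * ∫ ω : Metric.sphere (0 : E3) 1,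
          l (s • (ω : E3)) * g (s • (ω : E3)) ∂σ) := by
    intro ρ hρ g hg l hl Z hZ
    have hsub : Metric.closedBall (0 : E3) ρ ⊆ Metric.closedBall 0 R :=
      Metric.closedBall_subset_closedBall hρ.2
    have hint : IntegrableOn (fun x => Z ‖x‖ * (l x * g x)) (Metric.closedBall (0 : E3) ρ) := by
      refine ContinuousOn.integrableOn_compact (isCompact_closedBall _ _) ?_
      exact ContinuousOn.mul (by fun_prop) (ContinuousOn.mul (by fun_prop) (hg.mono hsub))
    rw [← integral_indicator measurableSet_closedBall, integral_eq_integral_sphere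
      (hint.integrable_indicator measurableSet_closedBall), intervalIntegral.integral_of_le hρ.1.le,
      ← integral_indicator measurableSet_Ioi, ← integral_indicator measurableSet_Ioc]
    refine integral_congr_ae (Eventually.of_forall fun s => ?_)
    simp only [indicator, mem_Ioi, mem_Ioc]
    by_cases hs : 0 < s
    · have hn : ∀ ω : Metric.sphere (0 : E3) 1, ‖s • (ω : E3)‖ = s := fun ω => by
        have : ‖(ω : E3)‖ = 1 := by simp
        simp [norm_smul, this, abs_of_pos hs]
      simp only [hs, true_and, if_true, mem_closedBall_zero_iff, hn]
      by_cases hsρ : s ≤ ρ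
      · simp only [hsρ, if_true]
        rw [integral_const_mul]; ring
      · simp [hsρ]
    · simp [hs]
  have hmain := eq_integral_of_weak hhc hkc hR ?_
  · rw [hhe R ⟨hR.le, le_rfl⟩] at hmain
    have h1 := hpolar R ⟨hR, le_rfl⟩ f' hf' (fun _ => 1) continuous_const (fun _ => 1)
      continuous_const
    simp only [one_mul] at h1
    rw [h1]
    have h2 : ∫ s in 0..R, k s = ∫ s in 0..R, k₀ s :=
      intervalIntegral.integral_congr fun s hs => hke s (by rwa [uIcc_of_le hR.le] at hs)
    rw [h2] at hmain
    simpa [hh₀, hk₀] using hmain.symm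
  · intro ρ hρ Y hY hY0
    set X : ℝ → ℝ := fun w => ∫ u in (ρ ^ 2)..w, Y u with hX
    have hXd : ∀ w, HasDerivAt X (Y w) w := fun w =>
      intervalIntegral.integral_hasDerivAt_right (hY.intervalIntegrable _ _)
        (hY.stronglyMeasurableAtFilter _ _) hY.continuousAt
    have hXc : Continuous X := continuous_iff_continuousAt.2 fun s => (hXd s).continuousAt
    have hX0 : ∀ w, ρ ^ 2 ≤ w → X w = 0 := fun w hw => by
      rw [hX]
      refine intervalIntegral.integral_zero_ae (Eventually.of_forall fun u hu => hY0 u ?_)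
      rw [uIoc_of_le hw] at hu
      exact hu.1.le
    have hsub : Metric.closedBall (0 : E3) ρ ⊆ Metric.closedBall 0 R :=
      Metric.closedBall_subset_closedBall hρ.2.le
    have hout : ∀ x : E3, x ∉ Metric.closedBall (0 : E3) ρ → ρ ^ 2 ≤ ‖x‖ ^ 2 := fun x hx => by
      have : ρ < ‖x‖ := by simpa using hx
      have := hρ.1
      gcongr
    set η : E3 → ℝ := fun x => X (‖x‖ ^ 2) with hη
    set η' : E3 → ℝ := fun x => Y (‖x‖ ^ 2) * (2 * inner ℝ x v) with hη'
    have hη0 : ∀ x, x ∉ Metric.closedBall (0 : E3) ρ → η x = 0 := fun x hx => hX0 _ (hout x hx)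
    have hη'0 : ∀ x, x ∉ Metric.closedBall (0 : E3) ρ → η' x = 0 := fun x hx => by
      simp [hη', hY0 _ (hout x hx)]
    have hηd : ∀ x, HasLineDerivAt ℝ η (η' x) x v := fun x => by
      have h1 : HasFDerivAt (fun x : E3 => ‖x‖ ^ 2) (2 • (innerSL ℝ x)) x :=
        (hasStrictFDerivAt_norm_sq x).hasFDerivAt
      have h2 := (hXd (‖x‖ ^ 2)).comp_hasFDerivAt x h1
      have h3 := h2.hasLineDerivAt v
      convert! h3 using 1
      simp [hη']
    have hcη : Continuous η := by fun_prop
    have hcη' : Continuous η' := by fun_prop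
    have hts : tsupport η ⊆ Metric.closedBall (0 : E3) ρ := by
      refine closure_minimal (fun x hx => ?_) Metric.isClosed_closedBall
      by_contra hx'
      exact hx (hη0 x hx')
    have hintg : ∀ g e : E3 → ℝ, ContinuousOn g (Metric.closedBall 0 R) → Continuous e →
        (∀ x, x ∉ Metric.closedBall (0 : E3) ρ → e x = 0) →
        Integrable (fun x => g x * e x) ∧
          ∫ x, g x * e x = ∫ x in Metric.closedBall (0 : E3) ρ, g x * e x := by
      intro g e hg he h0
      have h1 : IntegrableOn (fun x => g x * e x) (Metric.closedBall (0 : E3) ρ) :=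
        ((hg.mono hsub).mul he.continuousOn).integrableOn_compact (isCompact_closedBall _ _)
      refine ⟨?_, (setIntegral_eq_integral_of_forall_compl_eq_zero fun x hx => ?_).symm⟩
      · refine (integrableOn_iff_integrable_of_support_subset fun x hx => ?_).1 h1
        by_contra hx'
        exact hx (by simp [h0 x hx'])
      · simp [h0 x hx]
    have hibp := integral_bilinear_hasLineDerivAt_right_eq_neg_left_of_integrable
      (μ := (volume : Measure E3)) (B := ContinuousLinearMap.mul ℝ ℝ) (f := f) (f' := f')
      (g := η) (g' := η') (v := v) (hintg f' η hf' hcη hη0).1 (hintg f η' hf hcη' hη'0).1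
      (hintg f η hf hcη hη0).1
      (fun x hx => hd x (by
        have := hts hx
        rw [mem_closedBall_zero_iff] at this
        rw [mem_ball_zero_iff]; exact this.trans_lt hρ.2))
      (fun x _ => hηd x)
    simp only [ContinuousLinearMap.mul_apply'] at hibp
    rw [(hintg f' η hf' hcη hη0).2, (hintg f η' hf hcη' hη'0).2] at hibp
    have e1 := hpolar ρ ⟨hρ.1, hρ.2.le⟩ f hf (fun x => inner ℝ x v) (by fun_prop)
      (fun s => 2 * Y (s ^ 2)) (by fun_prop)
    have e2 := hpolar ρ ⟨hρ.1, hρ.2.le⟩ f' hf' (fun x => 1) (by fun_prop)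
      (fun s => X (s ^ 2)) (by fun_prop)
    have e3 : ∀ s ∈ uIcc 0 ρ, s ∈ Icc 0 R := fun s hs => by
      rw [uIcc_of_le hρ.1.le] at hs
      exact ⟨hs.1, hs.2.trans hρ.2.le⟩
    calc ∫ s in 0..ρ, 2 * s * Y (s ^ 2) * h s
        = ∫ s in 0..ρ, 2 * Y (s ^ 2) * (s ^ 2 * ∫ ω : Metric.sphere (0 : E3) 1,
          inner ℝ (s • (ω : E3)) v * f (s • (ω : E3)) ∂σ) := by
          refine intervalIntegral.integral_congr fun s hs => ?_
          simp only [hhe s (e3 s hs), hh₀, inner_smul_left, mul_assoc, integral_const_mul]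
          simp only [conj_trivial]; ring
      _ = ∫ x in Metric.closedBall (0 : E3) ρ, f x * η' x := by
          rw [← e1]
          refine integral_congr_ae (Eventually.of_forall fun x => ?_)
          simp only [hη']; ring
      _ = -∫ x in Metric.closedBall (0 : E3) ρ, f' x * η x := hibp
      _ = -∫ s in 0..ρ, X (s ^ 2) * k s := by
          congr 1
          rw [intervalIntegral.integral_congr (g := fun s => X (s ^ 2) * k₀ s)
            fun s hs => by simp only [hke s (e3 s hs)]]
          rw [← e2]
          refine integral_congr_ae (Eventually.of_forall fun x => ?_)
          simp only [hη]; ring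

/-- The divergence theorem on a closed ball, one partial derivative at a time. -/
theorem integral_closedBall_lineDeriv {F : Type*} [NormedAddCommGroup F] [NormedSpace ℝ F]
    [CompleteSpace F] {f f' : E3 → F} {x₀ : E3} {R : ℝ} (hR : 0 < R) {v : E3}
    (hf : ContinuousOn f (Metric.closedBall x₀ R))
    (hf' : ContinuousOn f' (Metric.closedBall x₀ R))
    (hd : ∀ x ∈ Metric.ball x₀ R, HasLineDerivAt ℝ f (f' x) x v) :
    ∫ x in Metric.closedBall x₀ R, f' x =
      sphereIntegral x₀ R fun x ν => inner ℝ ν v • f x := by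
  have hpre : (fun y : E3 => x₀ + y) ⁻¹' Metric.closedBall x₀ R = Metric.closedBall 0 R := by
    ext y; simp
  have hm : MapsTo (fun y : E3 => x₀ + y) (Metric.closedBall 0 R) (Metric.closedBall x₀ R) :=
    fun y hy => by simpa using hy
  have htr : ∫ x in Metric.closedBall x₀ R, f' x =
      ∫ y in Metric.closedBall (0 : E3) R, f' (x₀ + y) := by
    rw [← hpre]
    exact ((measurePreserving_add_left volume x₀).setIntegral_preimage_emb
      (measurableEmbedding_addLeft x₀) f' _).symm
  have hg' : ContinuousOn (fun y => f' (x₀ + y)) (Metric.closedBall 0 R) :=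
    hf'.comp (by fun_prop) hm
  have hg : ContinuousOn (fun y => f (x₀ + y)) (Metric.closedBall 0 R) :=
    hf.comp (by fun_prop) hm
  have hi1 : Integrable (fun y => f' (x₀ + y)) (volume.restrict (Metric.closedBall (0 : E3) R)) :=
    hg'.integrableOn_compact (isCompact_closedBall _ _)
  have hi2 : Integrable (fun ω : Metric.sphere (0 : E3) 1 =>
      (inner ℝ (ω : E3) v) • f (x₀ + R • (ω : E3))) (volume : Measure E3).toSphere := by
    refine Continuous.integrable_of_hasCompactSupport ?_ (HasCompactSupport.of_compactSpace _)
    refine Continuous.smul (by fun_prop) ?_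
    refine hg.comp_continuous (f := fun ω : Metric.sphere (0 : E3) 1 => R • (ω : E3))
      (by fun_prop) fun ω => ?_
    have : ‖(ω : E3)‖ = 1 := by simp
    simp [norm_smul, this, abs_of_pos hR]
  rw [htr, sphereIntegral]
  refine (SeparatingDual.eq_iff_forall_dual_eq (R := ℝ)).2 fun ℓ => ?_
  rw [map_smul, ← ℓ.integral_comp_comm hi1, ← ℓ.integral_comp_comm hi2]
  have key := integral_closedBall_lineDeriv_real hR (f := fun y => ℓ (f (x₀ + y)))
    (f' := fun y => ℓ (f' (x₀ + y))) (v := v)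
    (ℓ.continuous.comp_continuousOn hg) (ℓ.continuous.comp_continuousOn hg') fun y hy => by
      have h1 := hd (x₀ + y) (by simpa using hy)
      have h2 : HasDerivAt (fun t : ℝ => f (x₀ + y + t • v)) (f' (x₀ + y)) 0 := h1
      have h3 := ℓ.hasFDerivAt.comp_hasDerivAt 0 h2
      simpa [HasLineDerivAt, add_assoc, Function.comp_def] using h3
  simp only [map_smul, smul_eq_mul]
  exact key

/-! ### Tubes around a trajectory and the transport theorem -/

section Tube

variable {Tm Tp R : ℝ} {r : ℝ → E3} {F : Type*} [NormedAddCommGroup F] [NormedSpace ℝ F]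

/-- The tube is the image of a cylinder under `(t, y) ↦ (t, r t + y)`. -/
theorem tube_eq_image (Tm Tp : ℝ) (r : ℝ → E3) (R : ℝ) :
    tube Tm Tp r R =
      (fun z : ℝ × E3 => (z.1, r z.1 + z.2)) '' (Icc Tm Tp ×ˢ Metric.closedBall 0 R) := by
  ext ⟨t, x⟩
  constructor
  · rintro ⟨ht, hx⟩
    exact ⟨(t, x - r t), ⟨ht, by simpa using hx⟩, by simp⟩
  · rintro ⟨⟨s, y⟩, ⟨hs, hy⟩, h⟩
    simp only [Prod.mk.injEq] at h
    obtain ⟨rfl, rfl⟩ := h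
    exact ⟨hs, by simpa using hy⟩

theorem mk_mem_tube {t : ℝ} (ht : t ∈ Icc Tm Tp) {y : E3} (hy : ‖y‖ ≤ R) :
    (t, r t + y) ∈ tube Tm Tp r R := ⟨ht, by simpa using hy⟩

theorem center_mem_tube (hR : 0 < R) {t : ℝ} (ht : t ∈ Icc Tm Tp) :
    (t, r t) ∈ tube Tm Tp r R := ⟨ht, by simpa using hR.le⟩

theorem tube_mono {R R' : ℝ} (h : R ≤ R') : tube Tm Tp r R ⊆ tube Tm Tp r R' :=
  fun _ hp => ⟨hp.1, hp.2.trans h⟩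

theorem continuousOn_straighten (hr : ContinuousOn r (Icc Tm Tp)) (R : ℝ) :
    ContinuousOn (fun z : ℝ × E3 => (z.1, r z.1 + z.2)) (Icc Tm Tp ×ˢ Metric.closedBall 0 R) :=
  continuousOn_fst.prodMk
    ((hr.comp continuousOn_fst fun _ hz => hz.1).add continuousOn_snd)

theorem isCompact_tube (hr : ContinuousOn r (Icc Tm Tp)) : IsCompact (tube Tm Tp r R) := by
  rw [tube_eq_image]
  exact (isCompact_Icc.prod (isCompact_closedBall _ _)).image_of_continuousOn
    (continuousOn_straighten hr R)

/-- The derivative of `(t, y) ↦ (t, r t + y)` is onto, so that unique differentiability passes from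
the cylinder to the tube. -/
theorem uniqueDiffOn_tube (hT : Tm < Tp) (hr : ContDiffOn ℝ 2 r (Icc Tm Tp)) (hR : 0 < R) :
    UniqueDiffOn ℝ (tube Tm Tp r R) := by
  rw [tube_eq_image]
  have hd : DifferentiableOn ℝ r (Icc Tm Tp) := hr.differentiableOn (by norm_num)
  have hu : UniqueDiffOn ℝ (Icc Tm Tp ×ˢ Metric.closedBall (0 : E3) R) := by
    refine (uniqueDiffOn_Icc hT).prod (uniqueDiffOn_convex (convex_closedBall _ _) ?_)
    exact ⟨0, interior_mono Metric.ball_subset_closedBall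
      (by rw [Metric.isOpen_ball.interior_eq]; simpa using hR)⟩
  refine hu.image (f' := fun z => (ContinuousLinearMap.fst ℝ ℝ E3).prod
    ((fderivWithin ℝ r (Icc Tm Tp) z.1).comp (ContinuousLinearMap.fst ℝ ℝ E3) +
      ContinuousLinearMap.snd ℝ ℝ E3)) ?_ ?_
  · intro z hz
    refine hasFDerivWithinAt_fst.prodMk (HasFDerivWithinAt.add ?_ hasFDerivWithinAt_snd)
    exact ((hd z.1 hz.1).hasFDerivWithinAt).comp z hasFDerivWithinAt_fst fun _ h => h.1
  · intro z hz
    refine Function.Surjective.denseRange fun w =>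
      ⟨(w.1, w.2 - fderivWithin ℝ r (Icc Tm Tp) z.1 w.1), ?_⟩
    simp

theorem tube_mem_nhds (hr : ContinuousOn r (Icc Tm Tp)) {t : ℝ} (ht : t ∈ Ioo Tm Tp) {x : E3}
    (hx : x ∈ Metric.ball (r t) R) : tube Tm Tp r R ∈ 𝓝 (t, x) := by
  have hrt : ContinuousAt r t := hr.continuousAt (Icc_mem_nhds ht.1 ht.2)
  have h1 : ContinuousAt (fun p : SpaceTime => ‖p.2 - r p.1‖) (t, x) :=
    (continuousAt_snd.sub (ContinuousAt.comp (f := Prod.fst) hrt continuousAt_fst)).norm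
  have h2 : ∀ᶠ p : SpaceTime in 𝓝 (t, x), ‖p.2 - r p.1‖ < R :=
    h1.eventually_lt continuousAt_const (by simpa [dist_eq_norm] using hx)
  have h3 : ∀ᶠ p : SpaceTime in 𝓝 (t, x), p.1 ∈ Icc Tm Tp :=
    continuousAt_fst.eventually (Icc_mem_nhds ht.1 ht.2)
  filter_upwards [h2, h3] with p hp1 hp2 using ⟨hp2, hp1.le⟩

theorem contDiffOn_dT {Ω : Set SpaceTime} (hΩ : UniqueDiffOn ℝ Ω) {f : SpaceTime → F}
    {m n : WithTop ℕ∞} (hf : ContDiffOn ℝ n f Ω) (hmn : m + 1 ≤ n) :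
    ContDiffOn ℝ m (dT Ω f) Ω :=
  (hf.fderivWithin hΩ hmn).clm_apply contDiffOn_const

theorem contDiffOn_dX {Ω : Set SpaceTime} (hΩ : UniqueDiffOn ℝ Ω) {f : SpaceTime → F}
    {m n : WithTop ℕ∞} (hf : ContDiffOn ℝ n f Ω) (hmn : m + 1 ≤ n) (i : Fin 3) :
    ContDiffOn ℝ m (dX Ω f i) Ω :=
  (hf.fderivWithin hΩ hmn).clm_apply contDiffOn_const

theorem continuousOn_dT {Ω : Set SpaceTime} (hΩ : UniqueDiffOn ℝ Ω) {f : SpaceTime → F}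
    (hf : ContDiffOn ℝ 1 f Ω) : ContinuousOn (dT Ω f) Ω :=
  (contDiffOn_dT (m := 0) hΩ hf (by norm_num)).continuousOn

theorem continuousOn_dX {Ω : Set SpaceTime} (hΩ : UniqueDiffOn ℝ Ω) {f : SpaceTime → F}
    (hf : ContDiffOn ℝ 1 f Ω) (i : Fin 3) : ContinuousOn (dX Ω f i) Ω :=
  (contDiffOn_dX (m := 0) hΩ hf (by norm_num) i).continuousOn

/-- Derivatives relative to a tube and to a narrower one agree on the narrower one. -/
theorem fderivWithin_tube_eq (hT : Tm < Tp) (hr : ContDiffOn ℝ 2 r (Icc Tm Tp)) (hR : 0 < R)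
    {R' : ℝ} (hRR : R ≤ R') {f : SpaceTime → F}
    (hf : DifferentiableOn ℝ f (tube Tm Tp r R')) {p : SpaceTime} (hp : p ∈ tube Tm Tp r R) :
    fderivWithin ℝ f (tube Tm Tp r R) p = fderivWithin ℝ f (tube Tm Tp r R') p :=
  fderivWithin_subset (tube_mono hRR) (uniqueDiffOn_tube hT hr hR p hp) (hf p (tube_mono hRR hp))

theorem ballIntegral_eq (r : ℝ → E3) (R : ℝ) (f : SpaceTime → F) (t : ℝ) :
    ballIntegral r R f t = ∫ y in Metric.closedBall (0 : E3) R, f (t, r t + y) := by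
  have hpre : (fun y : E3 => r t + y) ⁻¹' Metric.closedBall (r t) R = Metric.closedBall 0 R := by
    ext y; simp
  rw [ballIntegral, ← hpre]
  exact ((measurePreserving_add_left volume (r t)).setIntegral_preimage_emb
    (measurableEmbedding_addLeft (r t)) (fun x => f (t, x)) _).symm

theorem continuousOn_straightened {F : Type*} [NormedAddCommGroup F]
    (hr : ContinuousOn r (Icc Tm Tp)) {f : SpaceTime → F}
    (hf : ContinuousOn f (tube Tm Tp r R)) :
    ContinuousOn (fun z : ℝ × E3 => f (z.1, r z.1 + z.2))
      (Icc Tm Tp ×ˢ Metric.closedBall 0 R) :=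
  hf.comp (continuousOn_straighten hr R) fun z hz => mk_mem_tube hz.1 (by simpa using hz.2)

theorem continuousOn_ball_slice {F : Type*} [NormedAddCommGroup F]
    {f : SpaceTime → F} (hf : ContinuousOn f (tube Tm Tp r R))
    {t : ℝ} (ht : t ∈ Icc Tm Tp) :
    ContinuousOn (fun x => f (t, x)) (Metric.closedBall (r t) R) :=
  hf.comp (by fun_prop) fun x hx => ⟨ht, by simpa [dist_eq_norm] using hx⟩

theorem integrableOn_ball_slice {F : Type*} [NormedAddCommGroup F]
    {f : SpaceTime → F} (hf : ContinuousOn f (tube Tm Tp r R))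
    {t : ℝ} (ht : t ∈ Icc Tm Tp) :
    IntegrableOn (fun x => f (t, x)) (Metric.closedBall (r t) R) :=
  (continuousOn_ball_slice hf ht).integrableOn_compact (isCompact_closedBall _ _)

theorem continuousOn_ballIntegral (hr : ContinuousOn r (Icc Tm Tp)) {f : SpaceTime → F}
    (hf : ContinuousOn f (tube Tm Tp r R)) :
    ContinuousOn (ballIntegral r R f) (Icc Tm Tp) := by
  have := continuousOn_setIntegral_of_continuousOn (μ := (volume : Measure E3))
    (f := fun (t : ℝ) y => f (t, r t + y)) isCompact_Icc (isCompact_closedBall (0 : E3) R)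
    measurableSet_closedBall (isCompact_closedBall _ _).measure_ne_top
    (continuousOn_straightened hr hf)
  exact this.congr fun t _ => ballIntegral_eq r R f t

theorem sphere_mem_tube (hR : 0 < R) {t : ℝ} (ht : t ∈ Icc Tm Tp)
    (ω : Metric.sphere (0 : E3) 1) : (t, r t + R • (ω : E3)) ∈ tube Tm Tp r R := by
  refine mk_mem_tube ht ?_
  have : ‖(ω : E3)‖ = 1 := by simp
  simp [norm_smul, this, abs_of_pos hR]

theorem continuousOn_sphere_slice {F : Type*} [NormedAddCommGroup F]
    (hr : ContinuousOn r (Icc Tm Tp)) (hR : 0 < R)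
    {f : SpaceTime → E3 → F}
    (hf : ContinuousOn (fun z : SpaceTime × E3 => f z.1 z.2) (tube Tm Tp r R ×ˢ univ)) :
    ContinuousOn (fun z : ℝ × Metric.sphere (0 : E3) 1 => f (z.1, r z.1 + R • (z.2 : E3)) z.2)
      (Icc Tm Tp ×ˢ univ) := by
  refine ContinuousOn.comp (f := fun z : ℝ × Metric.sphere (0 : E3) 1 =>
    (((z.1, r z.1 + R • (z.2 : E3)) : SpaceTime), (z.2 : E3))) hf ?_ ?_
  · refine ContinuousOn.prodMk (continuousOn_fst.prodMk (ContinuousOn.add ?_ (by fun_prop)))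
      (by fun_prop)
    exact hr.comp continuousOn_fst fun z hz => hz.1
  · rintro ⟨t, ω⟩ ⟨ht, -⟩
    exact ⟨sphere_mem_tube hR ht ω, mem_univ _⟩

theorem continuousOn_boundaryIntegral (hr : ContinuousOn r (Icc Tm Tp)) (hR : 0 < R)
    {f : SpaceTime → E3 → F}
    (hf : ContinuousOn (fun z : SpaceTime × E3 => f z.1 z.2) (tube Tm Tp r R ×ˢ univ)) :
    ContinuousOn (boundaryIntegral r R f) (Icc Tm Tp) := by
  have := continuousOn_setIntegral_of_continuousOn (μ := (volume : Measure E3).toSphere)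
    (f := fun (t : ℝ) (ω : Metric.sphere (0 : E3) 1) => f (t, r t + R • (ω : E3)) ω)
    isCompact_Icc isCompact_univ MeasurableSet.univ (measure_ne_top _ _)
    (continuousOn_sphere_slice hr hR hf)
  simp only [Measure.restrict_univ] at this
  exact continuousOn_const.smul this

theorem integrable_sphere_slice {F : Type*} [NormedAddCommGroup F]
    (hr : ContinuousOn r (Icc Tm Tp)) (hR : 0 < R)
    {f : SpaceTime → E3 → F}
    (hf : ContinuousOn (fun z : SpaceTime × E3 => f z.1 z.2) (tube Tm Tp r R ×ˢ univ))
    {t : ℝ} (ht : t ∈ Icc Tm Tp) :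
    Integrable (fun ω : Metric.sphere (0 : E3) 1 => f (t, r t + R • (ω : E3)) ω)
      (volume : Measure E3).toSphere := by
  refine Continuous.integrable_of_hasCompactSupport ?_ (HasCompactSupport.of_compactSpace _)
  exact (continuousOn_sphere_slice hr hR hf).comp_continuous
    (f := fun ω : Metric.sphere (0 : E3) 1 => (t, ω)) (by fun_prop) fun ω => ⟨ht, mem_univ _⟩

theorem boundaryIntegral_add (hr : ContinuousOn r (Icc Tm Tp)) (hR : 0 < R)
    {f g : SpaceTime → E3 → F}
    (hf : ContinuousOn (fun z : SpaceTime × E3 => f z.1 z.2) (tube Tm Tp r R ×ˢ univ))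
    (hg : ContinuousOn (fun z : SpaceTime × E3 => g z.1 z.2) (tube Tm Tp r R ×ˢ univ))
    {t : ℝ} (ht : t ∈ Icc Tm Tp) :
    boundaryIntegral r R (fun p ν => f p ν + g p ν) t =
      boundaryIntegral r R f t + boundaryIntegral r R g t := by
  simp only [boundaryIntegral, sphereIntegral]
  rw [integral_add (integrable_sphere_slice hr hR hf ht) (integrable_sphere_slice hr hR hg ht),
    smul_add]

theorem boundaryIntegral_sum (hr : ContinuousOn r (Icc Tm Tp)) (hR : 0 < R)
    {f : Fin 3 → SpaceTime → E3 → F}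
    (hf : ∀ i, ContinuousOn (fun z : SpaceTime × E3 => f i z.1 z.2) (tube Tm Tp r R ×ˢ univ))
    {t : ℝ} (ht : t ∈ Icc Tm Tp) :
    boundaryIntegral r R (fun p ν => ∑ i, f i p ν) t =
      ∑ i, boundaryIntegral r R (f i) t := by
  simp only [boundaryIntegral, sphereIntegral]
  rw [integral_finsetSum _ fun i _ => integrable_sphere_slice hr hR (hf i) ht, Finset.smul_sum]

theorem boundaryIntegral_congr (hR : 0 < R) {f g : SpaceTime → E3 → F} {t : ℝ}
    (ht : t ∈ Icc Tm Tp) (h : ∀ p ∈ tube Tm Tp r R, ∀ ν, f p ν = g p ν) :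
    boundaryIntegral r R f t = boundaryIntegral r R g t := by
  simp only [boundaryIntegral, sphereIntegral]
  congr 1
  exact integral_congr_ae (Eventually.of_forall fun ω => h _ (sphere_mem_tube hR ht ω) _)

theorem ballIntegral_add {f g : SpaceTime → F} (hf : ContinuousOn f (tube Tm Tp r R))
    (hg : ContinuousOn g (tube Tm Tp r R)) {t : ℝ} (ht : t ∈ Icc Tm Tp) :
    ballIntegral r R (fun p => f p + g p) t = ballIntegral r R f t + ballIntegral r R g t :=
  integral_add (integrableOn_ball_slice hf ht) (integrableOn_ball_slice hg ht)

theorem ballIntegral_sub {f g : SpaceTime → F} (hf : ContinuousOn f (tube Tm Tp r R))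
    (hg : ContinuousOn g (tube Tm Tp r R)) {t : ℝ} (ht : t ∈ Icc Tm Tp) :
    ballIntegral r R (fun p => f p - g p) t = ballIntegral r R f t - ballIntegral r R g t :=
  integral_sub (integrableOn_ball_slice hf ht) (integrableOn_ball_slice hg ht)

theorem ballIntegral_sum {f : Fin 3 → SpaceTime → F}
    (hf : ∀ i, ContinuousOn (f i) (tube Tm Tp r R)) {t : ℝ} (ht : t ∈ Icc Tm Tp) :
    ballIntegral r R (fun p => ∑ i, f i p) t = ∑ i, ballIntegral r R (f i) t :=
  integral_finsetSum _ fun i _ => integrableOn_ball_slice (hf i) ht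

theorem ballIntegral_congr {f g : SpaceTime → F} {t : ℝ} (ht : t ∈ Icc Tm Tp)
    (h : ∀ p ∈ tube Tm Tp r R, f p = g p) : ballIntegral r R f t = ballIntegral r R g t :=
  setIntegral_congr_fun measurableSet_closedBall fun x hx =>
    h (t, x) ⟨ht, by simpa [dist_eq_norm] using hx⟩

theorem hasFDerivAt_of_mem_tube (hr : ContinuousOn r (Icc Tm Tp)) {f : SpaceTime → F}
    (hf : ContDiffOn ℝ 1 f (tube Tm Tp r R)) {t : ℝ} (ht : t ∈ Ioo Tm Tp) {x : E3}
    (hx : x ∈ Metric.ball (r t) R) :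
    HasFDerivAt f (fderivWithin ℝ f (tube Tm Tp r R) (t, x)) (t, x) := by
  have hn := tube_mem_nhds hr ht hx
  have hd := hf.differentiableOn (by norm_num) (t, x) (mem_of_mem_nhds hn)
  exact hd.hasFDerivWithinAt.hasFDerivAt hn

/-- The divergence theorem on a time slice of the tube. -/
theorem ballIntegral_dX [CompleteSpace F] (hT : Tm < Tp) (hr : ContDiffOn ℝ 2 r (Icc Tm Tp))
    (hR : 0 < R) {f : SpaceTime → F} (hf : ContDiffOn ℝ 1 f (tube Tm Tp r R)) (i : Fin 3) {t : ℝ}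
    (ht : t ∈ Ioo Tm Tp) :
    ballIntegral r R (dX (tube Tm Tp r R) f i) t =
      boundaryIntegral r R (fun p ν => ν i • f p) t := by
  have htI := Ioo_subset_Icc_self ht
  have hΩ := uniqueDiffOn_tube hT hr hR
  have := integral_closedBall_lineDeriv hR (v := EuclideanSpace.single i 1)
    (continuousOn_ball_slice hf.continuousOn htI)
    (continuousOn_ball_slice (continuousOn_dX hΩ hf i) htI) fun x hx => by
      have h1 := hasFDerivAt_of_mem_tube hr.continuousOn hf ht hx
      have h2 : HasFDerivAt (fun x : E3 => f (t, x))
        ((fderivWithin ℝ f (tube Tm Tp r R) (t, x)).comp (ContinuousLinearMap.inr ℝ ℝ E3)) x :=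
        h1.comp x (hasFDerivAt_prodMk_right t x)
      exact h2.hasLineDerivAt (EuclideanSpace.single i 1)
  simpa [ballIntegral, boundaryIntegral, EuclideanSpace.inner_single_right] using this

theorem hasDerivAt_trajectory (hr : ContDiffOn ℝ 2 r (Icc Tm Tp)) {t : ℝ} (ht : t ∈ Ioo Tm Tp) :
    HasDerivAt r (vel Tm Tp r t) t :=
  ((hr.differentiableOn (by norm_num) t (Ioo_subset_Icc_self ht)).hasDerivWithinAt).hasDerivAt
    (Icc_mem_nhds ht.1 ht.2)

theorem continuousOn_vel (hT : Tm < Tp) (hr : ContDiffOn ℝ 2 r (Icc Tm Tp)) :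
    ContinuousOn (vel Tm Tp r) (Icc Tm Tp) :=
  hr.continuousOn_derivWithin (uniqueDiffOn_Icc hT) (by norm_num)

/-- The convective derivative `∂_t + v · ∇`. -/
theorem fderivWithin_one_prod_eq (Ω : Set SpaceTime) (f : SpaceTime → F) (v : E3) (p : SpaceTime) :
    fderivWithin ℝ f Ω p (1, v) = dT Ω f p + ∑ i, v i • dX Ω f i p := by
  have hv : ((1, v) : SpaceTime) =
      (1, 0) + ∑ i, v i • ((0, EuclideanSpace.single i 1) : SpaceTime) := by
    ext j
    · simp [Prod.fst_sum]
    · simp [Prod.snd_sum, Finset.sum_apply, Pi.single_apply]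
  rw [hv, map_add, map_sum]
  simp only [map_smul]
  rfl

theorem continuousOn_velocity_flux (hT : Tm < Tp) (hr : ContDiffOn ℝ 2 r (Icc Tm Tp))
    {g : SpaceTime → F} (hg : ContinuousOn g (tube Tm Tp r R)) :
    ContinuousOn (fun z : SpaceTime × E3 => inner ℝ (vel Tm Tp r z.1.1) z.2 • g z.1)
      (tube Tm Tp r R ×ˢ univ) := by
  refine ContinuousOn.smul (ContinuousOn.inner (𝕜 := ℝ) ?_ continuousOn_snd) ?_
  · exact (continuousOn_vel hT hr).comp (by fun_prop) fun z hz => hz.1.1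
  · exact hg.comp continuousOn_fst fun z hz => hz.1

theorem continuousOn_flux {j : Fin 3 → SpaceTime → F}
    (hj : ∀ i, ContinuousOn (j i) (tube Tm Tp r R)) :
    ContinuousOn (fun z : SpaceTime × E3 => ∑ i, z.2 i • j i z.1) (tube Tm Tp r R ×ˢ univ) := by
  refine continuousOn_finsetSum _ fun i _ => ContinuousOn.smul (by fun_prop) ?_
  exact (hj i).comp continuousOn_fst fun z hz => hz.1

theorem ae_mem_ball_of_closedBall (R : ℝ) :
    ∀ᵐ y ∂((volume : Measure E3).restrict (Metric.closedBall (0 : E3) R)),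
      y ∈ Metric.ball (0 : E3) R := by
  rw [← Measure.restrict_congr_set (ae_eq_of_subset_of_measure_ge Metric.ball_subset_closedBall
        (Measure.addHaar_closedBall_eq_addHaar_ball volume (0 : E3) R).le
        measurableSet_ball.nullMeasurableSet measure_closedBall_lt_top.ne)]
  exact ae_restrict_mem measurableSet_ball

/-- The integral of the derivative of `g` along the motion of the ball, split by the divergence
theorem into the time derivative and the flux through the moving boundary. -/
theorem integral_convective_derivative [CompleteSpace F] (hT : Tm < Tp)
    (hr : ContDiffOn ℝ 2 r (Icc Tm Tp)) (hR : 0 < R) {g : SpaceTime → F}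
    (hg : ContDiffOn ℝ 1 g (tube Tm Tp r R)) {t : ℝ} (ht : t ∈ Ioo Tm Tp) :
    ∫ y in Metric.closedBall (0 : E3) R,
        fderivWithin ℝ g (tube Tm Tp r R) (t, r t + y) (1, vel Tm Tp r t) =
      ballIntegral r R (dT (tube Tm Tp r R) g) t +
        boundaryIntegral r R (fun p ν => inner ℝ (vel Tm Tp r p.1) ν • g p) t := by
  have hΩ := uniqueDiffOn_tube hT hr hR
  have hrc := hr.continuousOn
  have htI := Ioo_subset_Icc_self ht
  set Ω := tube Tm Tp r R with hΩdef
  set D : SpaceTime → F := fun p => fderivWithin ℝ g Ω p (1, vel Tm Tp r p.1) with hD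
  change ∫ y in Metric.closedBall (0 : E3) R, D (t, r t + y) = _
  rw [← ballIntegral_eq r R D t]
  have e1 : ballIntegral r R D t =
      ballIntegral r R (fun p => dT Ω g p + ∑ i, vel Tm Tp r t i • dX Ω g i p) t :=
    setIntegral_congr_fun measurableSet_closedBall fun x _ => fderivWithin_one_prod_eq Ω g _ _
  have hdX : ∀ i, ContinuousOn (fun p => vel Tm Tp r t i • dX Ω g i p) Ω := fun i =>
    continuousOn_const.smul (continuousOn_dX hΩ hg i)
  rw [e1, ballIntegral_add (continuousOn_dT hΩ hg)
    (continuousOn_finsetSum _ fun i _ => hdX i) htI, ballIntegral_sum hdX htI]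
  congr 1
  have e2 : ∀ i, ballIntegral r R (fun p => vel Tm Tp r t i • dX Ω g i p) t =
      vel Tm Tp r t i • boundaryIntegral r R (fun p ν => ν i • g p) t := fun i => by
    rw [← ballIntegral_dX hT hr hR hg i ht, ballIntegral, ballIntegral, integral_smul]
  have e3 : ∀ i, vel Tm Tp r t i • boundaryIntegral r R (fun p ν => ν i • g p) t =
      boundaryIntegral r R (fun p ν => vel Tm Tp r t i • ν i • g p) t := fun i => by
    simp only [boundaryIntegral, sphereIntegral]
    rw [smul_comm, integral_smul]
  simp only [e2, e3]
  rw [← boundaryIntegral_sum hrc hR (f := fun i p ν => vel Tm Tp r t i • ν i • g p) ?_ htI]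
  · simp only [boundaryIntegral, sphereIntegral]
    congr 2
    ext1 ω
    simp only [smul_smul, ← Finset.sum_smul]
    congr 1
    simp [PiLp.inner_apply, mul_comm]
  · intro i
    refine continuousOn_const.smul (ContinuousOn.smul (by fun_prop) ?_)
    exact hg.continuousOn.comp continuousOn_fst fun z hz => hz.1

/-- The Reynolds transport theorem for the ball that moves with the trajectory. -/
theorem hasDerivAt_ballIntegral [CompleteSpace F] (hT : Tm < Tp)
    (hr : ContDiffOn ℝ 2 r (Icc Tm Tp)) (hR : 0 < R) {g : SpaceTime → F}
    (hg : ContDiffOn ℝ 1 g (tube Tm Tp r R)) {t : ℝ} (ht : t ∈ Ioo Tm Tp) :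
    HasDerivAt (ballIntegral r R g)
      (ballIntegral r R (dT (tube Tm Tp r R) g) t +
        boundaryIntegral r R (fun p ν => inner ℝ (vel Tm Tp r p.1) ν • g p) t) t := by
  have hΩ := uniqueDiffOn_tube hT hr hR
  have hrc := hr.continuousOn
  have htI := Ioo_subset_Icc_self ht
  set Ω := tube Tm Tp r R with hΩdef
  set D : SpaceTime → F := fun p => fderivWithin ℝ g Ω p (1, vel Tm Tp r p.1) with hD
  have hD1 : ContinuousOn (fun p : SpaceTime => ((1, vel Tm Tp r p.1) : SpaceTime)) Ω :=
    continuousOn_const.prodMk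
      (ContinuousOn.comp (continuousOn_vel hT hr) continuousOn_fst fun p hp => hp.1)
  have hD2 : ContinuousOn (fderivWithin ℝ g Ω) Ω := hg.continuousOn_fderivWithin hΩ (by norm_num)
  have hDc : ContinuousOn D Ω := hD2.clm_apply hD1
  obtain ⟨C, hC⟩ := (isCompact_tube (R := R) hrc).exists_bound_of_continuousOn hDc
  have hslice : ∀ {f : SpaceTime → F}, ContinuousOn f Ω → ∀ s ∈ Icc Tm Tp,
      ContinuousOn (fun y : E3 => f (s, r s + y)) (Metric.closedBall 0 R) := fun {f} hf s hs =>
    ContinuousOn.comp (g := fun z : ℝ × E3 => f (z.1, r z.1 + z.2)) (f := fun y : E3 => (s, y))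
      (t := Icc Tm Tp ×ˢ Metric.closedBall (0 : E3) R) (continuousOn_straightened hrc hf)
      (by fun_prop) fun y hy => ⟨hs, hy⟩
  have hball := ae_mem_ball_of_closedBall R
  have hm1 : ∀ᶠ s in 𝓝 t, AEStronglyMeasurable (fun y => g (s, r s + y))
      (volume.restrict (Metric.closedBall (0 : E3) R)) := by
    refine Filter.Eventually.mono (Ioo_mem_nhds ht.1 ht.2) fun s hs => ?_
    exact (hslice hg.continuousOn s (Ioo_subset_Icc_self hs)).aestronglyMeasurable_of_isCompact
      (isCompact_closedBall _ _) measurableSet_closedBall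
  have hm2 : IntegrableOn (fun y => g (t, r t + y)) (Metric.closedBall (0 : E3) R) :=
    (hslice hg.continuousOn t htI).integrableOn_compact (isCompact_closedBall _ _)
  have hm3 : AEStronglyMeasurable (fun y => D (t, r t + y))
      (volume.restrict (Metric.closedBall (0 : E3) R)) :=
    (hslice hDc t htI).aestronglyMeasurable_of_isCompact
      (isCompact_closedBall _ _) measurableSet_closedBall
  have hm4 : ∀ᵐ y ∂(volume.restrict (Metric.closedBall (0 : E3) R)), ∀ s ∈ Ioo Tm Tp,
      ‖D (s, r s + y)‖ ≤ C := by
    refine (ae_restrict_mem measurableSet_closedBall).mono fun y hy s hs => ?_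
    exact hC _ (mk_mem_tube (Ioo_subset_Icc_self hs) (by simpa using hy))
  have hm5 : ∀ᵐ y ∂(volume.restrict (Metric.closedBall (0 : E3) R)), ∀ s ∈ Ioo Tm Tp,
      HasDerivAt (fun u => g (u, r u + y)) (D (s, r s + y)) s := by
    refine hball.mono fun y hy s hs => ?_
    have h1 := hasFDerivAt_of_mem_tube hrc hg hs (x := r s + y) (by simpa using hy)
    have h2 : HasDerivAt (fun u => ((u, r u + y) : SpaceTime)) (1, vel Tm Tp r s) s :=
      (hasDerivAt_id s).prodMk ((hasDerivAt_trajectory hr hs).add_const y)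
    exact h1.comp_hasDerivAt s h2
  have hC' : Integrable (fun _ : E3 => C) (volume.restrict (Metric.closedBall (0 : E3) R)) :=
    integrableOn_const (isCompact_closedBall _ _).measure_ne_top
  have hmain := (hasDerivAt_integral_of_dominated_loc_of_deriv_le
    (F := fun s y => g (s, r s + y)) (F' := fun s y => D (s, r s + y))
    (Ioo_mem_nhds ht.1 ht.2) hm1 hm2 hm3 hm4 hC' hm5).2
  have heq : ballIntegral r R g = fun s => ∫ y in Metric.closedBall (0 : E3) R, g (s, r s + y) :=
    funext fun s => ballIntegral_eq r R g s
  rw [heq, ← integral_convective_derivative hT hr hR hg ht]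
  exact hmain

/-- Integrated balance law in the moving ball. -/
theorem ballIntegral_sub_eq_of_balance [CompleteSpace F] (hT : Tm < Tp)
    (hr : ContDiffOn ℝ 2 r (Icc Tm Tp)) (hR : 0 < R) {g s : SpaceTime → F}
    {j : Fin 3 → SpaceTime → F}
    (hg : ContDiffOn ℝ 1 g (tube Tm Tp r R)) (hj : ∀ i, ContDiffOn ℝ 1 (j i) (tube Tm Tp r R))
    (hs : ContinuousOn s (tube Tm Tp r R))
    (hlaw : ∀ p ∈ tube Tm Tp r R,
      dT (tube Tm Tp r R) g p + ∑ i, dX (tube Tm Tp r R) (j i) i p = s p)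
    {t₀ t : ℝ} (ht₀ : t₀ ∈ Icc Tm Tp) (ht : t ∈ Icc Tm Tp) :
    ballIntegral r R g t - ballIntegral r R g t₀ =
      (∫ u in t₀..t, boundaryIntegral r R (fun p ν => inner ℝ (vel Tm Tp r p.1) ν • g p) u) -
        (∫ u in t₀..t, boundaryIntegral r R (fun p ν => ∑ i, ν i • j i p) u) +
        ∫ u in t₀..t, ballIntegral r R s u := by
  have hΩ := uniqueDiffOn_tube hT hr hR
  have hrc := hr.continuousOn
  have hsub : uIcc t₀ t ⊆ Icc Tm Tp := uIcc_subset_Icc ht₀ ht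
  have hc1 := (continuousOn_boundaryIntegral hrc hR
    (f := fun p ν => inner ℝ (vel Tm Tp r p.1) ν • g p)
    (continuousOn_velocity_flux hT hr hg.continuousOn)).mono hsub
  have hc2 := (continuousOn_boundaryIntegral hrc hR
    (f := fun p ν => ∑ i, ν i • j i p) (continuousOn_flux fun i => (hj i).continuousOn)).mono hsub
  have hc3 := (continuousOn_ballIntegral hrc hs).mono hsub
  rw [← intervalIntegral.integral_sub hc1.intervalIntegrable hc2.intervalIntegrable,
    ← intervalIntegral.integral_add (hc1.intervalIntegrable.sub hc2.intervalIntegrable)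
      hc3.intervalIntegrable]
  symm
  refine intervalIntegral.integral_eq_sub_of_hasDeriv_right
    ((continuousOn_ballIntegral hrc hg.continuousOn).mono hsub) (fun u hu => ?_)
    ((hc1.sub hc2).add hc3).intervalIntegrable
  have huo : u ∈ Ioo Tm Tp :=
    ⟨(le_min ht₀.1 ht.1).trans_lt hu.1, hu.2.trans_le (max_le ht₀.2 ht.2)⟩
  have huI := Ioo_subset_Icc_self huo
  refine ((hasDerivAt_ballIntegral hT hr hR hg huo).congr_deriv ?_).hasDerivWithinAt
  have e1 : ballIntegral r R s u = ballIntegral r R (dT (tube Tm Tp r R) g) u +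
      boundaryIntegral r R (fun p ν => ∑ i, ν i • j i p) u := by
    rw [← ballIntegral_congr huI hlaw, ballIntegral_add (continuousOn_dT hΩ hg)
      (continuousOn_finsetSum _ fun i _ => continuousOn_dX hΩ (hj i) i) huI,
      ballIntegral_sum (fun i => continuousOn_dX hΩ (hj i) i) huI,
      boundaryIntegral_sum hrc hR (f := fun i p ν => ν i • j i p) ?_ huI]
    · simp only [ballIntegral_dX hT hr hR (hj _) _ huo]
    · intro i
      exact ContinuousOn.smul (by fun_prop)
        ((hj i).continuousOn.comp continuousOn_fst fun z hz => hz.1)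
  rw [e1]
  abel

end Tube

/-! ### Regularity of the densities -/

/-- The cross product as a continuous bilinear map. -/
def crossL : E3 →L[ℝ] E3 →L[ℝ] E3 :=
  (LinearMap.mk₂ ℝ cross
    (fun u u' v => by ext i; simp [cross])
    (fun c u v => by ext i; simp [cross])
    (fun u v v' => by ext i; simp [cross])
    (fun c u v => by ext i; simp [cross])).toContinuousBilinearMap

theorem crossL_apply (u v : E3) : crossL u v = cross u v := rfl

theorem norm_cross_le (u v : E3) : ‖cross u v‖ ≤ ‖crossL‖ * ‖u‖ * ‖v‖ :=
  crossL.le_opNorm₂ u v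

theorem ContDiffOn.cross {X : Type*} [NormedAddCommGroup X] [NormedSpace ℝ X] {n : WithTop ℕ∞}
    {s : Set X} {f g : X → E3} (hf : ContDiffOn ℝ n f s) (hg : ContDiffOn ℝ n g s) :
    ContDiffOn ℝ n (fun x => _root_.cross (f x) (g x)) s :=
  (crossL.contDiff.comp_contDiffOn hf).clm_apply hg

theorem ContinuousOn.cross {X : Type*} [TopologicalSpace X] {s : Set X} {f g : X → E3}
    (hf : ContinuousOn f s) (hg : ContinuousOn g s) :
    ContinuousOn (fun x => _root_.cross (f x) (g x)) s :=
  (crossL.continuous.comp_continuousOn hf).clm_apply hg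

theorem ContDiffOn.coord {X : Type*} [NormedAddCommGroup X] [NormedSpace ℝ X] {n : WithTop ℕ∞}
    {s : Set X} {f : X → E3} (hf : ContDiffOn ℝ n f s) (i : Fin 3) :
    ContDiffOn ℝ n (fun x => f x i) s :=
  contDiffOn_euclidean.1 hf i

theorem ContDiffOn.ofReal_complex {X : Type*} [NormedAddCommGroup X] [NormedSpace ℝ X]
    {n : WithTop ℕ∞} {s : Set X} {f : X → ℝ} (hf : ContDiffOn ℝ n f s) :
    ContDiffOn ℝ n (fun x => (f x : ℂ)) s :=
  Complex.ofRealCLM.contDiff.comp_contDiffOn hf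

theorem ContDiffOn.conj_complex {X : Type*} [NormedAddCommGroup X] [NormedSpace ℝ X]
    {n : WithTop ℕ∞} {s : Set X} {f : X → ℂ} (hf : ContDiffOn ℝ n f s) :
    ContDiffOn ℝ n (fun x => starRingEnd ℂ (f x)) s :=
  Complex.conjCLE.contDiff.comp_contDiffOn hf

theorem ContDiffOn.im_complex {X : Type*} [NormedAddCommGroup X] [NormedSpace ℝ X]
    {n : WithTop ℕ∞} {s : Set X} {f : X → ℂ} (hf : ContDiffOn ℝ n f s) :
    ContDiffOn ℝ n (fun x => (f x).im) s :=
  Complex.imCLM.contDiff.comp_contDiffOn hf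

theorem ContDiffOn.re_complex {X : Type*} [NormedAddCommGroup X] [NormedSpace ℝ X]
    {n : WithTop ℕ∞} {s : Set X} {f : X → ℂ} (hf : ContDiffOn ℝ n f s) :
    ContDiffOn ℝ n (fun x => (f x).re) s :=
  Complex.reCLM.contDiff.comp_contDiffOn hf

/-- The nonlinear potential `z ↦ G₁(|z|²)` is continuously differentiable, although `G₁` itself
need not be so at the origin. -/
theorem RegularNonlinearity.contDiff_comp_norm_sq {G₁ g₁ : ℝ → ℝ}
    (hG : RegularNonlinearity G₁ g₁) : ContDiff ℝ 1 (fun z : ℂ => G₁ (‖z‖ ^ 2)) := by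
  obtain ⟨g, hg, -, -, h⟩ := hG.complex_regular
  choose L hL hLg using h
  have hLeq : L = fun z => (2 * (g z).re) • Complex.reCLM + (2 * (g z).im) • Complex.imCLM := by
    ext z h
    have := congrArg Complex.re (hLg z h)
    simp at this
    simp [this]; ring
  rw [contDiff_one_iff_hasFDerivAt]
  refine ⟨L, ?_, hL⟩
  rw [hLeq]
  fun_prop

theorem contDiffOn_scaledG {G₁ g₁ : ℝ → ℝ} (hG : RegularNonlinearity G₁ g₁) {a : ℝ} (ha : 0 < a)
    {Ω : Set SpaceTime} {ψ : SpaceTime → ℂ} (hψ : ContDiffOn ℝ 1 ψ Ω) :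
    ContDiffOn ℝ 1 (fun p => scaledG G₁ a (‖ψ p‖ ^ 2)) Ω := by
  have h1 : ContDiffOn ℝ 1 (fun p => ((√(a ^ 3) : ℝ) : ℂ) * ψ p) Ω := contDiffOn_const.mul hψ
  have h2 := hG.contDiff_comp_norm_sq.comp_contDiffOn h1
  refine (contDiffOn_const (c := a ^ (-5 : ℤ))).mul (h2.congr fun p _ => ?_)
  have h3 : ‖((√(a ^ 3) : ℝ) : ℂ) * ψ p‖ ^ 2 = a ^ 3 * ‖ψ p‖ ^ 2 := by
    rw [norm_mul, mul_pow, Complex.norm_real, Real.norm_eq_abs, sq_abs,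
      Real.sq_sqrt (by positivity)]
  simp only [Function.comp_apply, h3]

section Densities

variable {K : NLSParams} {Ω : Set SpaceTime} {φ : SpaceTime → ℝ} {A : SpaceTime → E3}
  {ψ : SpaceTime → ℂ}

theorem contDiffOn_covX (hΩ : UniqueDiffOn ℝ Ω) (hA : ContDiffOn ℝ 2 A Ω)
    (hψ : ContDiffOn ℝ 2 ψ Ω) (i : Fin 3) : ContDiffOn ℝ 1 (covX K Ω A ψ i) Ω := by
  have hψ1 : ContDiffOn ℝ 1 ψ Ω := hψ.of_le (by norm_num)
  have hA1 : ContDiffOn ℝ 1 A Ω := hA.of_le (by norm_num)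
  exact (contDiffOn_dX hΩ hψ (by norm_num) i).sub
    ((contDiffOn_const.mul (contDiffOn_const.mul (hA1.coord i)).ofReal_complex).mul hψ1)

theorem contDiffOn_covT (hΩ : UniqueDiffOn ℝ Ω) (hφ : ContDiffOn ℝ 2 φ Ω)
    (hψ : ContDiffOn ℝ 2 ψ Ω) : ContDiffOn ℝ 1 (covT K Ω φ ψ) Ω := by
  have hψ1 : ContDiffOn ℝ 1 ψ Ω := hψ.of_le (by norm_num)
  have hφ1 : ContDiffOn ℝ 1 φ Ω := hφ.of_le (by norm_num)
  exact (contDiffOn_dT hΩ hψ (by norm_num)).add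
    ((contDiffOn_const.mul (contDiffOn_const.mul hφ1).ofReal_complex).mul hψ1)

theorem contDiffOn_chargeDensity {n : WithTop ℕ∞} (hψ : ContDiffOn ℝ n ψ Ω) :
    ContDiffOn ℝ n (chargeDensity K ψ) Ω :=
  contDiffOn_const.mul (hψ.norm_sq ℝ)

theorem contDiffOn_momentumDensity (hΩ : UniqueDiffOn ℝ Ω) (hA : ContDiffOn ℝ 2 A Ω)
    (hψ : ContDiffOn ℝ 2 ψ Ω) : ContDiffOn ℝ 1 (momentumDensity K Ω A ψ) Ω := by
  have hψ1 : ContDiffOn ℝ 1 ψ Ω := hψ.of_le (by norm_num)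
  refine contDiffOn_euclidean.2 fun i => ?_
  exact contDiffOn_const.mul (hψ1.conj_complex.mul (contDiffOn_covX hΩ hA hψ i)).im_complex

theorem currentDensity_eq_smul (K : NLSParams) (Ω : Set SpaceTime) (A : SpaceTime → E3)
    (ψ : SpaceTime → ℂ) (p : SpaceTime) :
    currentDensity K Ω A ψ p = (K.q / K.m) • momentumDensity K Ω A ψ p := by
  ext i
  simp [currentDensity, momentumDensity]
  ring

theorem contDiffOn_currentDensity (hΩ : UniqueDiffOn ℝ Ω) (hA : ContDiffOn ℝ 2 A Ω)
    (hψ : ContDiffOn ℝ 2 ψ Ω) : ContDiffOn ℝ 1 (currentDensity K Ω A ψ) Ω :=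
  ((contDiffOn_const (c := K.q / K.m)).smul
    (contDiffOn_momentumDensity (K := K) hΩ hA hψ)).congr fun p _ =>
      currentDensity_eq_smul K Ω A ψ p

theorem contDiffOn_stress {G₁ g₁ : ℝ → ℝ} (hG : RegularNonlinearity G₁ g₁) {a : ℝ} (ha : 0 < a)
    (hΩ : UniqueDiffOn ℝ Ω) (hφ : ContDiffOn ℝ 2 φ Ω) (hA : ContDiffOn ℝ 2 A Ω)
    (hψ : ContDiffOn ℝ 2 ψ Ω) (i j : Fin 3) :
    ContDiffOn ℝ 1 (stress K Ω (scaledG G₁ a) φ A ψ i j) Ω := by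
  have hψ1 : ContDiffOn ℝ 1 ψ Ω := hψ.of_le (by norm_num)
  have hX := contDiffOn_covX (K := K) hΩ hA hψ
  refine ContDiffOn.sub
    (contDiffOn_const.mul ((hX i).mul (hX j).conj_complex).re_complex) ?_
  by_cases hij : i = j
  · simp only [hij, if_true]
    refine ContDiffOn.add (contDiffOn_const.mul (ContDiffOn.add ?_ (contDiffOn_scaledG hG ha hψ1)))
      (contDiffOn_const.mul (hψ1.conj_complex.mul (contDiffOn_covT hΩ hφ hψ)).im_complex)
    exact ContDiffOn.sum fun k _ => (hX k).norm_sq ℝ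
  · simp only [hij, if_false]
    exact contDiffOn_const

theorem continuousOn_electricField (hΩ : UniqueDiffOn ℝ Ω) (hφ : ContDiffOn ℝ 1 φ Ω)
    (hA : ContDiffOn ℝ 1 A Ω) : ContinuousOn (electricField K Ω φ A) Ω := by
  rw [← contDiffOn_zero (𝕜 := ℝ)]
  refine contDiffOn_euclidean.2 fun i => ?_
  exact (contDiffOn_dX hΩ hφ (by norm_num) i).neg.sub
    (contDiffOn_const.mul ((contDiffOn_dT hΩ hA (by norm_num)).coord i))

theorem continuousOn_magneticField (hΩ : UniqueDiffOn ℝ Ω) (hA : ContDiffOn ℝ 1 A Ω) :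
    ContinuousOn (magneticField Ω A) Ω := by
  rw [← contDiffOn_zero (𝕜 := ℝ)]
  have h : ∀ i k, ContDiffOn ℝ 0 (fun p => dX Ω A i p k) Ω := fun i k =>
    (contDiffOn_dX hΩ hA (by norm_num) i).coord k
  refine contDiffOn_euclidean.2 fun i => ?_
  fin_cases i
  · exact (h 1 2).sub (h 2 1)
  · exact (h 2 0).sub (h 0 2)
  · exact (h 0 1).sub (h 1 0)

theorem continuousOn_lorentzDensity (hΩ : UniqueDiffOn ℝ Ω) (hφ : ContDiffOn ℝ 2 φ Ω)
    (hA : ContDiffOn ℝ 2 A Ω) (hψ : ContDiffOn ℝ 2 ψ Ω) :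
    ContinuousOn (lorentzDensity K Ω φ A ψ) Ω := by
  have h1 : ContDiffOn ℝ 1 φ Ω := hφ.of_le (by norm_num)
  have h2 : ContDiffOn ℝ 1 A Ω := hA.of_le (by norm_num)
  have h3 := (contDiffOn_currentDensity (K := K) hΩ hA hψ).continuousOn
  have h4 := (contDiffOn_chargeDensity (K := K) hψ).continuousOn
  exact (h4.smul (continuousOn_electricField hΩ h1 h2)).add
    ((continuousOn_const (c := K.c⁻¹)).smul (h3.cross (continuousOn_magneticField hΩ h2)))

/-- The `i`-th row of the stress tensor as a vector. -/
def stressRow (K : NLSParams) (Ω : Set SpaceTime) (G : ℝ → ℝ) (φ : SpaceTime → ℝ)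
    (A : SpaceTime → E3) (ψ : SpaceTime → ℂ) (i : Fin 3) (p : SpaceTime) : E3 :=
  WithLp.toLp 2 fun j => stress K Ω G φ A ψ i j p

theorem contDiffOn_stressRow {G₁ g₁ : ℝ → ℝ} (hG : RegularNonlinearity G₁ g₁) {a : ℝ} (ha : 0 < a)
    (hΩ : UniqueDiffOn ℝ Ω) (hφ : ContDiffOn ℝ 2 φ Ω) (hA : ContDiffOn ℝ 2 A Ω)
    (hψ : ContDiffOn ℝ 2 ψ Ω) (i : Fin 3) :
    ContDiffOn ℝ 1 (stressRow K Ω (scaledG G₁ a) φ A ψ i) Ω :=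
  contDiffOn_euclidean.2 fun j => contDiffOn_stress hG ha hΩ hφ hA hψ i j

theorem sum_smul_stressRow (G : ℝ → ℝ) (p : SpaceTime) (ν : E3) :
    ∑ i, ν i • stressRow K Ω G φ A ψ i p =
      WithLp.toLp 2 fun j => ∑ i, ν i * stress K Ω G φ A ψ i j p := by
  ext j
  simp [stressRow, Finset.sum_apply]

theorem dX_coord (hΩ : UniqueDiffOn ℝ Ω) {f : SpaceTime → E3} (hf : ContDiffOn ℝ 1 f Ω)
    (i j : Fin 3) {p : SpaceTime} (hp : p ∈ Ω) :
    dX Ω (fun p => f p j) i p = dX Ω f i p j := by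
  have h := (hf.differentiableOn (by norm_num) p hp).hasFDerivWithinAt
  have h2 := ((EuclideanSpace.proj j : E3 →L[ℝ] ℝ).hasFDerivAt.comp_hasFDerivWithinAt p
    h).fderivWithin (hΩ p hp)
  have h3 : (fun p => f p j) = (EuclideanSpace.proj j : E3 →L[ℝ] ℝ) ∘ f := rfl
  rw [dX, h3, h2]
  rfl

theorem dX_add {F : Type*} [NormedAddCommGroup F] [NormedSpace ℝ F] (hΩ : UniqueDiffOn ℝ Ω)
    {f g : SpaceTime → F} (hf : ContDiffOn ℝ 1 f Ω) (hg : ContDiffOn ℝ 1 g Ω) (i : Fin 3)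
    {p : SpaceTime} (hp : p ∈ Ω) : dX Ω (fun p => f p + g p) i p = dX Ω f i p + dX Ω g i p := by
  have h1 := hf.differentiableOn (by norm_num) p hp
  have h2 := hg.differentiableOn (by norm_num) p hp
  simp only [dX]
  rw [fderivWithin_fun_add (hΩ p hp) h1 h2]
  rfl

end Densities

/-! ### Uniform convergence to zero and primitives on the time interval -/

section Unif

variable {Tm Tp : ℝ} {F : Type*} [NormedAddCommGroup F]

theorem unifToZero_iff {Q : ℕ → ℝ → F} :
    UnifToZero Tm Tp Q ↔ ∀ ε > 0, ∀ᶠ n in atTop, ∀ t ∈ Icc Tm Tp, ‖Q n t‖ < ε := by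
  simp [UnifToZero, Metric.tendstoUniformlyOn_iff]

theorem UnifToZero.congr {Q Q' : ℕ → ℝ → F} (h : UnifToZero Tm Tp Q)
    (hQ : ∀ᶠ n in atTop, ∀ t ∈ Icc Tm Tp, Q' n t = Q n t) : UnifToZero Tm Tp Q' := by
  rw [unifToZero_iff] at h ⊢
  intro ε hε
  filter_upwards [h ε hε, hQ] with n hn hn' t ht
  rw [hn' t ht]
  exact hn t ht

theorem UnifToZero.add {Q Q' : ℕ → ℝ → F} (h : UnifToZero Tm Tp Q) (h' : UnifToZero Tm Tp Q') :
    UnifToZero Tm Tp (fun n t => Q n t + Q' n t) := by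
  rw [unifToZero_iff] at *
  intro ε hε
  filter_upwards [h (ε / 2) (by positivity), h' (ε / 2) (by positivity)] with n hn hn' t ht
  have := norm_add_le (Q n t) (Q' n t)
  linarith [hn t ht, hn' t ht]

/-- Domination by a multiple of a sequence that converges to zero. -/
theorem UnifToZero.of_bound {F' : Type*} [NormedAddCommGroup F'] {Q : ℕ → ℝ → F}
    {Q' : ℕ → ℝ → F'} (h : UnifToZero Tm Tp Q) (C : ℝ)
    (hb : ∀ᶠ n in atTop, ∀ t ∈ Icc Tm Tp, ‖Q' n t‖ ≤ C * ‖Q n t‖) : UnifToZero Tm Tp Q' := by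
  rw [unifToZero_iff] at *
  intro ε hε
  filter_upwards [h (ε / (|C| + 1)) (by positivity), hb] with n hn hn' t ht
  have h1 := hn t ht
  rw [lt_div_iff₀ (by positivity)] at h1
  have h2 : C * ‖Q n t‖ ≤ ‖Q n t‖ * (|C| + 1) := by
    have := mul_le_mul_of_nonneg_right (le_abs_self C) (norm_nonneg (Q n t))
    have := norm_nonneg (Q n t)
    linarith
  exact (hn' t ht).trans_lt (h2.trans_lt h1)

theorem UnifToZero.neg {Q : ℕ → ℝ → F} (h : UnifToZero Tm Tp Q) :
    UnifToZero Tm Tp (fun n t => -Q n t) :=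
  h.of_bound 1 (Eventually.of_forall fun n t _ => by simp)

theorem UnifToZero.sub {Q Q' : ℕ → ℝ → F} (h : UnifToZero Tm Tp Q) (h' : UnifToZero Tm Tp Q') :
    UnifToZero Tm Tp (fun n t => Q n t - Q' n t) := by
  simpa [sub_eq_add_neg] using h.add h'.neg

theorem UnifToZero.const_smul [NormedSpace ℝ F] {Q : ℕ → ℝ → F} (h : UnifToZero Tm Tp Q)
    (c : ℝ) : UnifToZero Tm Tp (fun n t => c • Q n t) :=
  h.of_bound |c| (Eventually.of_forall fun n t _ => by rw [norm_smul, Real.norm_eq_abs])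

theorem UnifToZero.tendsto {Q : ℕ → ℝ → F} (h : UnifToZero Tm Tp Q) {t : ℝ}
    (ht : t ∈ Icc Tm Tp) : Tendsto (fun n => Q n t) atTop (𝓝 0) :=
  h.tendsto_at ht

theorem UnifToZero.of_tendsto {Q : ℕ → F} (h : Tendsto Q atTop (𝓝 0)) :
    UnifToZero Tm Tp (fun n _ => Q n) := by
  rw [unifToZero_iff]
  intro ε hε
  filter_upwards [(tendsto_zero_iff_norm_tendsto_zero.1 h).eventually (gt_mem_nhds hε)]
    with n hn t _
  exact hn

theorem UnifToZero.integral [NormedSpace ℝ F] {Q : ℕ → ℝ → F} (h : UnifToZero Tm Tp Q) {t₀ : ℝ}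
    (ht₀ : t₀ ∈ Icc Tm Tp) : UnifToZero Tm Tp (fun n t => ∫ s in t₀..t, Q n s) := by
  rw [unifToZero_iff] at *
  intro ε hε
  have hle : Tm ≤ Tp := ht₀.1.trans ht₀.2
  filter_upwards [h (ε / (Tp - Tm + 1)) (by apply div_pos hε; linarith)] with n hn t ht
  have h1 : ‖∫ s in t₀..t, Q n s‖ ≤ ε / (Tp - Tm + 1) * |t - t₀| :=
    intervalIntegral.norm_integral_le_of_norm_le_const fun s hs =>
      (hn s (uIcc_subset_Icc ht₀ ht (uIoc_subset_uIcc hs))).le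
  have h2 : |t - t₀| ≤ Tp - Tm := abs_le.2 ⟨by linarith [ht.1, ht₀.2], by linarith [ht.2, ht₀.1]⟩
  refine h1.trans_lt ?_
  rw [div_mul_eq_mul_div, div_lt_iff₀ (by linarith)]
  nlinarith

end Unif

section Primitive

variable {Tm Tp : ℝ} {F : Type*} [NormedAddCommGroup F] [NormedSpace ℝ F] [CompleteSpace F]

theorem intervalIntegrable_of_continuousOn {F : Type*} [NormedAddCommGroup F] {f : ℝ → F}
    (hf : ContinuousOn f (Icc Tm Tp)) {a b : ℝ} (ha : a ∈ Icc Tm Tp) (hb : b ∈ Icc Tm Tp) :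
    IntervalIntegrable f volume a b :=
  (hf.mono (uIcc_subset_Icc ha hb)).intervalIntegrable

/-- The fundamental theorem of calculus on `[Tm, Tp]`, with one-sided derivatives at the ends. -/
theorem hasDerivWithinAt_primitive {f : ℝ → F} (hf : ContinuousOn f (Icc Tm Tp)) {t₀ t : ℝ}
    (ht₀ : t₀ ∈ Icc Tm Tp) (ht : t ∈ Icc Tm Tp) :
    HasDerivWithinAt (fun t => ∫ s in t₀..t, f s) (f t) (Icc Tm Tp) t := by
  have hle : Tm ≤ Tp := ht.1.trans ht.2
  set g : ℝ → F := IccExtend hle ((Icc Tm Tp).domRestrict f) with hg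
  have hgc : Continuous g := hf.domRestrict.Icc_extend'
  have hge : ∀ s ∈ Icc Tm Tp, g s = f s := fun s hs => by
    rw [hg, IccExtend_of_mem _ _ hs]; rfl
  have h1 : HasDerivAt (fun t => ∫ s in t₀..t, g s) (g t) t :=
    intervalIntegral.integral_hasDerivAt_right (hgc.intervalIntegrable _ _)
      (hgc.stronglyMeasurableAtFilter _ _) hgc.continuousAt
  rw [← hge t ht]
  refine h1.hasDerivWithinAt.congr (fun u hu => ?_) ?_
  · exact intervalIntegral.integral_congr fun s hs => (hge s (uIcc_subset_Icc ht₀ hu hs)).symm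
  · exact intervalIntegral.integral_congr fun s hs => (hge s (uIcc_subset_Icc ht₀ ht hs)).symm

theorem continuousOn_primitive {f : ℝ → F} (hf : ContinuousOn f (Icc Tm Tp)) {t₀ : ℝ}
    (ht₀ : t₀ ∈ Icc Tm Tp) : ContinuousOn (fun t => ∫ s in t₀..t, f s) (Icc Tm Tp) := fun _ ht =>
  (hasDerivWithinAt_primitive hf ht₀ ht).continuousWithinAt

theorem contDiffOn_primitive (hT : Tm < Tp) {n : ℕ} {f : ℝ → F}
    (hf : ContDiffOn ℝ n f (Icc Tm Tp)) {t₀ : ℝ} (ht₀ : t₀ ∈ Icc Tm Tp) :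
    ContDiffOn ℝ (n + 1 : ℕ) (fun t => ∫ s in t₀..t, f s) (Icc Tm Tp) := by
  push_cast
  rw [contDiffOn_succ_iff_derivWithin (uniqueDiffOn_Icc hT)]
  have hd := fun t ht => hasDerivWithinAt_primitive hf.continuousOn ht₀ (t := t) ht
  refine ⟨fun t ht => (hd t ht).differentiableWithinAt, by simp, ?_⟩
  exact hf.congr fun t ht => (hd t ht).derivWithin (uniqueDiffOn_Icc hT t ht)

end Primitive

section Limit

variable {Tm Tp : ℝ} {r : ℝ → E3}

theorem integral_eq_sub_of_hasDerivWithinAt {F : Type*} [NormedAddCommGroup F] [NormedSpace ℝ F]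
    [CompleteSpace F] {f f' : ℝ → F}
    (hd : ∀ t ∈ Icc Tm Tp, HasDerivWithinAt f (f' t) (Icc Tm Tp) t)
    (hc : ContinuousOn f' (Icc Tm Tp)) {a b : ℝ} (ha : a ∈ Icc Tm Tp) (hb : b ∈ Icc Tm Tp) :
    ∫ s in a..b, f' s = f b - f a := by
  have hsub := uIcc_subset_Icc ha hb
  refine intervalIntegral.integral_eq_sub_of_hasDeriv_right
    (fun t ht => ((hd t (hsub ht)).continuousWithinAt).mono hsub) (fun u hu => ?_)
    (intervalIntegrable_of_continuousOn hc ha hb)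
  have huo : u ∈ Ioo Tm Tp :=
    ⟨(le_min ha.1 hb.1).trans_lt hu.1, hu.2.trans_le (max_le ha.2 hb.2)⟩
  exact ((hd u (Ioo_subset_Icc_self huo)).hasDerivAt (Icc_mem_nhds huo.1 huo.2)).hasDerivWithinAt

/-- If the primitives of `d n` converge to zero uniformly, then so do those of `d n × B`, for `B`
continuously differentiable: weak convergence suffices for the magnetic term. -/
theorem unifToZero_integral_cross (hT : Tm < Tp) {d : ℕ → ℝ → E3} {B : ℝ → E3} {t₀ : ℝ}
    (ht₀ : t₀ ∈ Icc Tm Tp) (hd : ∀ n, ContinuousOn (d n) (Icc Tm Tp))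
    (hB : ContDiffOn ℝ 1 B (Icc Tm Tp))
    (h : UnifToZero Tm Tp (fun n t => ∫ s in t₀..t, d n s)) :
    UnifToZero Tm Tp (fun n t => ∫ s in t₀..t, cross (d n s) (B s)) := by
  set B' := derivWithin B (Icc Tm Tp) with hB'
  have hB'c : ContinuousOn B' (Icc Tm Tp) :=
    hB.continuousOn_derivWithin (uniqueDiffOn_Icc hT) (by norm_num)
  obtain ⟨C, hC⟩ := isCompact_Icc.exists_bound_of_continuousOn hB.continuousOn
  obtain ⟨C', hC'⟩ := isCompact_Icc.exists_bound_of_continuousOn hB'c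
  set D : ℕ → ℝ → E3 := fun n t => ∫ s in t₀..t, d n s with hD
  -- integration by parts moves the derivative to `B`
  have e : ∀ n, ∀ t ∈ Icc Tm Tp, ∫ s in t₀..t, cross (d n s) (B s) =
      cross (D n t) (B t) - ∫ s in t₀..t, cross (D n s) (B' s) := by
    intro n t ht
    have hDc : ContinuousOn (D n) (Icc Tm Tp) := continuousOn_primitive (hd n) ht₀
    have hc1 := (hd n).cross hB.continuousOn
    have hc2 := hDc.cross hB'c
    have h1 : ∀ u ∈ Icc Tm Tp, HasDerivWithinAt (fun s => cross (D n s) (B s))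
        (cross (d n u) (B u) + cross (D n u) (B' u)) (Icc Tm Tp) u := by
      intro u hu
      have a1 := hasDerivWithinAt_primitive (hd n) ht₀ hu
      have a2 : HasDerivWithinAt B (B' u) (Icc Tm Tp) u :=
        (hB.differentiableOn (by norm_num) u hu).hasDerivWithinAt
      have := crossL.hasDerivWithinAt_of_bilinear a1 a2
      simp only [crossL_apply] at this
      rw [add_comm]
      exact this
    have h2 := integral_eq_sub_of_hasDerivWithinAt h1 (hc1.add hc2) ht₀ ht
    rw [intervalIntegral.integral_add (intervalIntegrable_of_continuousOn hc1 ht₀ ht)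
      (intervalIntegrable_of_continuousOn hc2 ht₀ ht)] at h2
    have h3 : cross (D n t₀) (B t₀) = 0 := by
      simp only [hD, intervalIntegral.integral_same]
      rw [← crossL_apply]; simp
    rw [h3, sub_zero] at h2
    rw [← h2]; abel
  have u1 : UnifToZero Tm Tp (fun n t => cross (D n t) (B t)) := by
    refine h.of_bound (‖crossL‖ * C) (Eventually.of_forall fun n t ht =>
      (norm_cross_le _ _).trans ?_)
    have := mul_le_mul_of_nonneg_left (hC t ht)
      (mul_nonneg (norm_nonneg crossL) (norm_nonneg (D n t)))
    linarith
  have u2 : UnifToZero Tm Tp (fun n t => cross (D n t) (B' t)) := by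
    refine h.of_bound (‖crossL‖ * C') (Eventually.of_forall fun n t ht =>
      (norm_cross_le _ _).trans ?_)
    have := mul_le_mul_of_nonneg_left (hC' t ht)
      (mul_nonneg (norm_nonneg crossL) (norm_nonneg (D n t)))
    linarith
  exact (u1.sub (u2.integral ht₀)).congr (Eventually.of_forall fun n t ht => e n t ht)

/-- The limit equation of motion: if the primitives of the momenta `p n` converge to a multiple of
the displacement of `r`, and the momenta satisfy the equation of motion up to a vanishing error,
then `r` satisfies the limit equation. -/
theorem limit_equation_of_motion (hT : Tm < Tp) (hr : ContDiffOn ℝ 2 r (Icc Tm Tp))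
    {p : ℕ → ℝ → E3} {N : ℕ → ℝ → ℝ} {E B : ℝ → E3} {ρ κ b t₀ : ℝ} (ht₀ : t₀ ∈ Icc Tm Tp)
    (hp : ∀ n, ContinuousOn (p n) (Icc Tm Tp)) (hN : ∀ n, ContinuousOn (N n) (Icc Tm Tp))
    (hE : ContinuousOn E (Icc Tm Tp)) (hB : ContDiffOn ℝ 1 B (Icc Tm Tp))
    (hNlim : UnifToZero Tm Tp (fun n t => N n t - ρ))
    (hq : UnifToZero Tm Tp (fun n t => (∫ s in t₀..t, p n s) - κ • (r t - r t₀)))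
    (hmot : UnifToZero Tm Tp (fun n t => p n t - p n t₀ -
      ∫ s in t₀..t, (N n s • E s + b • cross (p n s) (B s)))) :
    ∀ t ∈ Icc Tm Tp, κ • acc Tm Tp r t = ρ • E t + (b * κ) • cross (vel Tm Tp r t) (B t) := by
  have hv := continuousOn_vel hT hr
  have hrd : ∀ t ∈ Icc Tm Tp, HasDerivWithinAt r (vel Tm Tp r t) (Icc Tm Tp) t := fun t ht =>
    (hr.differentiableOn (by norm_num) t ht).hasDerivWithinAt
  set f : ℝ → E3 := fun s => ρ • E s + (b * κ) • cross (vel Tm Tp r s) (B s) with hf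
  have hBc := hB.continuousOn
  have hfc : ContinuousOn f (Icc Tm Tp) := (hE.const_smul ρ).add ((hv.cross hBc).const_smul (b * κ))
  set Φ : ℝ → E3 := fun t => ∫ s in t₀..t, f s with hΦ
  have hΦd : ∀ t ∈ Icc Tm Tp, HasDerivWithinAt Φ (f t) (Icc Tm Tp) t := fun t ht =>
    hasDerivWithinAt_primitive hfc ht₀ ht
  have hΦc : ContinuousOn Φ (Icc Tm Tp) := continuousOn_primitive hfc ht₀
  -- the force integrals converge
  have hforce : UnifToZero Tm Tp (fun n t =>
      (∫ s in t₀..t, (N n s • E s + b • cross (p n s) (B s))) - Φ t) := by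
    obtain ⟨C, hC⟩ := isCompact_Icc.exists_bound_of_continuousOn hE
    have u1 : UnifToZero Tm Tp (fun n t => (N n t - ρ) • E t) := by
      refine hNlim.of_bound C (Eventually.of_forall fun n t ht => ?_)
      rw [norm_smul, mul_comm]
      exact mul_le_mul_of_nonneg_right (hC t ht) (norm_nonneg _)
    set d : ℕ → ℝ → E3 := fun n s => p n s - κ • vel Tm Tp r s with hd
    have hdc : ∀ n, ContinuousOn (d n) (Icc Tm Tp) := fun n => (hp n).sub (hv.const_smul κ)
    have u2 : UnifToZero Tm Tp (fun n t => ∫ s in t₀..t, d n s) := by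
      refine hq.congr (Eventually.of_forall fun n t ht => ?_)
      have hκv : ContinuousOn (fun s => κ • vel Tm Tp r s) (Icc Tm Tp) := hv.const_smul κ
      simp only [hd]
      rw [intervalIntegral.integral_sub (intervalIntegrable_of_continuousOn (hp n) ht₀ ht)
        (intervalIntegrable_of_continuousOn hκv ht₀ ht),
        intervalIntegral.integral_smul, integral_eq_sub_of_hasDerivWithinAt hrd hv ht₀ ht]
    have u3 := (unifToZero_integral_cross hT ht₀ hdc hB u2).const_smul b
    refine ((u1.integral ht₀).add u3).congr (Eventually.of_forall fun n t ht => ?_)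
    have c1 : ContinuousOn (fun s => (N n s - ρ) • E s) (Icc Tm Tp) :=
      ((hN n).sub continuousOn_const).smul hE
    have c2 : ContinuousOn (fun s => b • cross (d n s) (B s)) (Icc Tm Tp) :=
      ((hdc n).cross hBc).const_smul b
    have c3 : ContinuousOn (fun s => N n s • E s + b • cross (p n s) (B s)) (Icc Tm Tp) :=
      ((hN n).smul hE).add (((hp n).cross hBc).const_smul b)
    rw [hΦ, ← intervalIntegral.integral_smul,
      ← intervalIntegral.integral_sub (intervalIntegrable_of_continuousOn c3 ht₀ ht)
      (intervalIntegrable_of_continuousOn hfc ht₀ ht),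
      ← intervalIntegral.integral_add (intervalIntegrable_of_continuousOn c1 ht₀ ht)
      (intervalIntegrable_of_continuousOn c2 ht₀ ht)]
    refine intervalIntegral.integral_congr fun s _ => ?_
    simp only [hf, hd, ← crossL_apply, map_sub, map_smul, sub_apply, smul_apply]
    module
  have hp1 : UnifToZero Tm Tp (fun n t => p n t - p n t₀ - Φ t) :=
    (hmot.add hforce).congr (Eventually.of_forall fun n t _ => by abel)
  -- hence the displacement is determined by the initial momenta
  set Ψ : ℝ → E3 := fun t => ∫ s in t₀..t, Φ s with hΨ
  have hp2 : UnifToZero Tm Tp (fun n t =>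
      κ • (r t - r t₀) - Ψ t - (t - t₀) • p n t₀) := by
    refine ((hp1.integral ht₀).sub hq).congr (Eventually.of_forall fun n t ht => ?_)
    have i1 := intervalIntegrable_of_continuousOn (hp n) ht₀ ht
    have i2 := intervalIntegrable_of_continuousOn hΦc ht₀ ht
    have i3 := intervalIntegrable_of_continuousOn (continuousOn_const (c := p n t₀)) ht₀ ht
    rw [intervalIntegral.integral_sub (i1.sub i3) i2, intervalIntegral.integral_sub i1 i3,
      intervalIntegral.integral_const]
    abel
  -- at a second time `t₁ ≠ t₀` this determines the limit of the initial momenta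
  obtain ⟨p₀, hp₀⟩ : ∃ p₀, Tendsto (fun n => p n t₀) atTop (𝓝 p₀) := by
    obtain ⟨t₁, ht₁, hne⟩ : ∃ t₁ ∈ Icc Tm Tp, t₁ ≠ t₀ := by
      by_cases h : t₀ = Tm
      · exact ⟨Tp, ⟨hT.le, le_rfl⟩, by rw [h]; exact hT.ne'⟩
      · exact ⟨Tm, ⟨le_rfl, hT.le⟩, Ne.symm h⟩
    have hne' : t₁ - t₀ ≠ 0 := sub_ne_zero.2 hne
    have h1 := (hp2.tendsto ht₁).const_smul (t₁ - t₀)⁻¹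
    refine ⟨(t₁ - t₀)⁻¹ • (κ • (r t₁ - r t₀) - Ψ t₁) - (t₁ - t₀)⁻¹ • (0 : E3), ?_⟩
    refine (tendsto_const_nhds.sub h1).congr fun n => ?_
    rw [← smul_sub, sub_sub_cancel, smul_smul, inv_mul_cancel₀ hne', one_smul]
  have hlim : ∀ t ∈ Icc Tm Tp, κ • r t = κ • r t₀ + (t - t₀) • p₀ + Ψ t := by
    intro t ht
    have h1 := hp2.tendsto ht
    have h2 : Tendsto (fun n => κ • (r t - r t₀) - Ψ t - (t - t₀) • p n t₀) atTop
        (𝓝 (κ • (r t - r t₀) - Ψ t - (t - t₀) • p₀)) :=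
      tendsto_const_nhds.sub (hp₀.const_smul (t - t₀))
    have h3 := tendsto_nhds_unique h2 h1
    rw [smul_sub] at h3
    have : κ • r t = κ • r t₀ + (t - t₀) • p₀ + Ψ t +
      (κ • r t - κ • r t₀ - Ψ t - (t - t₀) • p₀) := by abel
    rw [this, h3, add_zero]
  have hU := uniqueDiffOn_Icc hT
  have hvel : ∀ t ∈ Icc Tm Tp, κ • vel Tm Tp r t = p₀ + Φ t := by
    intro t ht
    have a1 := (hrd t ht).const_smul κ
    have a2 : HasDerivWithinAt (fun t => κ • r t₀ + (t - t₀) • p₀ + Ψ t) (p₀ + Φ t)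
        (Icc Tm Tp) t := by
      refine HasDerivWithinAt.add ?_ (hasDerivWithinAt_primitive hΦc ht₀ ht)
      have := (((hasDerivWithinAt_id t (Icc Tm Tp)).sub_const t₀).smul_const p₀).const_add
        (κ • r t₀)
      simpa using this
    have a3 := a2.congr (f₁ := fun t => κ • r t) hlim (hlim t ht)
    exact (hU t ht).eq_deriv _ a1 a3
  intro t ht
  have hvd : HasDerivWithinAt (vel Tm Tp r) (acc Tm Tp r t) (Icc Tm Tp) t := by
    have : ContDiffOn ℝ 1 (vel Tm Tp r) (Icc Tm Tp) := hr.derivWithin hU (by norm_num)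
    exact (this.differentiableOn (by norm_num) t ht).hasDerivWithinAt
  have a1 := hvd.const_smul κ
  have a2 := ((hΦd t ht).const_add p₀).congr (f₁ := fun t => κ • vel Tm Tp r t) hvel (hvel t ht)
  exact (hU t ht).eq_deriv _ a1 a2

end Limit

/-! ### Balance laws for charge, momentum and the charge center -/

section Balance

variable {Tm Tp R : ℝ} {r : ℝ → E3} {F : Type*} [NormedAddCommGroup F] [NormedSpace ℝ F]

theorem integral_ballIntegral_add (hr : ContinuousOn r (Icc Tm Tp)) {f g : SpaceTime → F}
    (hf : ContinuousOn f (tube Tm Tp r R)) (hg : ContinuousOn g (tube Tm Tp r R)) {a b : ℝ}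
    (ha : a ∈ Icc Tm Tp) (hb : b ∈ Icc Tm Tp) :
    ∫ s in a..b, ballIntegral r R (fun p => f p + g p) s =
      (∫ s in a..b, ballIntegral r R f s) + ∫ s in a..b, ballIntegral r R g s := by
  rw [← intervalIntegral.integral_add
    (intervalIntegrable_of_continuousOn (continuousOn_ballIntegral hr hf) ha hb)
    (intervalIntegrable_of_continuousOn (continuousOn_ballIntegral hr hg) ha hb)]
  exact intervalIntegral.integral_congr fun s hs =>
    ballIntegral_add hf hg (uIcc_subset_Icc ha hb hs)

theorem integral_ballIntegral_congr {f g : SpaceTime → F} {a b : ℝ}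
    (ha : a ∈ Icc Tm Tp) (hb : b ∈ Icc Tm Tp) (h : ∀ p ∈ tube Tm Tp r R, f p = g p) :
    ∫ s in a..b, ballIntegral r R f s = ∫ s in a..b, ballIntegral r R g s :=
  intervalIntegral.integral_congr fun _ hs => ballIntegral_congr (uIcc_subset_Icc ha hb hs) h

/-- The transport theorem in integrated form. -/
theorem integral_ballIntegral_dT [CompleteSpace F] (hT : Tm < Tp)
    (hr : ContDiffOn ℝ 2 r (Icc Tm Tp)) (hR : 0 < R) {g : SpaceTime → F}
    (hg : ContDiffOn ℝ 1 g (tube Tm Tp r R)) {t₀ t : ℝ} (ht₀ : t₀ ∈ Icc Tm Tp)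
    (ht : t ∈ Icc Tm Tp) :
    ∫ s in t₀..t, ballIntegral r R (dT (tube Tm Tp r R) g) s =
      ballIntegral r R g t - ballIntegral r R g t₀ -
        ∫ s in t₀..t, boundaryIntegral r R (fun p ν => inner ℝ (vel Tm Tp r p.1) ν • g p) s := by
  have hΩ := uniqueDiffOn_tube hT hr hR
  have hz : ∀ i p, dX (tube Tm Tp r R) (fun _ => (0 : F)) i p = 0 := fun i p => by simp [dX]
  have := ballIntegral_sub_eq_of_balance hT hr hR (j := fun _ _ => 0) hg
    (fun _ => contDiffOn_const) (continuousOn_dT hΩ hg) (fun p _ => by simp [hz]) ht₀ ht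
  rw [this]
  simp [boundaryIntegral, sphereIntegral]

/-- The divergence theorem in integrated form. -/
theorem integral_ballIntegral_div [CompleteSpace F] (hT : Tm < Tp)
    (hr : ContDiffOn ℝ 2 r (Icc Tm Tp)) (hR : 0 < R) {j : Fin 3 → SpaceTime → F}
    (hj : ∀ i, ContDiffOn ℝ 1 (j i) (tube Tm Tp r R)) {t₀ t : ℝ} (ht₀ : t₀ ∈ Icc Tm Tp)
    (ht : t ∈ Icc Tm Tp) :
    ∫ s in t₀..t, ballIntegral r R (fun p => ∑ i, dX (tube Tm Tp r R) (j i) i p) s =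
      ∫ s in t₀..t, boundaryIntegral r R (fun p ν => ∑ i, ν i • j i p) s := by
  have hΩ := uniqueDiffOn_tube hT hr hR
  have hz : ∀ p, dT (tube Tm Tp r R) (fun _ => (0 : F)) p = 0 := fun p => by simp [dT]
  have := ballIntegral_sub_eq_of_balance hT hr hR (g := fun _ => (0 : F)) contDiffOn_const hj
    (continuousOn_finsetSum Finset.univ fun i _ => continuousOn_dX hΩ (hj i) i)
    (fun p _ => by simp [hz]) ht₀ ht
  simp [ballIntegral, boundaryIntegral, sphereIntegral] at this ⊢
  exact (eq_of_sub_eq_zero (by rw [sub_eq_neg_add]; exact this.symm))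

/-- The first moment of a divergence about a fixed point `c`. -/
theorem ballIntegral_div_smul (hT : Tm < Tp) (hr : ContDiffOn ℝ 2 r (Icc Tm Tp)) (hR : 0 < R)
    {J : SpaceTime → E3} (hJ : ContDiffOn ℝ 1 J (tube Tm Tp r R)) (c : E3) {t : ℝ}
    (ht : t ∈ Ioo Tm Tp) :
    ballIntegral r R (fun p => (∑ i, dX (tube Tm Tp r R) J i p i) • (p.2 - c)) t =
      boundaryIntegral r R (fun p ν => inner ℝ ν (J p) • (p.2 - c)) t - ballIntegral r R J t := by
  have hΩ := uniqueDiffOn_tube hT hr hR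
  set Ω := tube Tm Tp r R with hΩd
  have htI := Ioo_subset_Icc_self ht
  have hlin : ContDiffOn ℝ 1 (fun p : SpaceTime => p.2 - c) Ω := by fun_prop
  have hj : ∀ i, ContDiffOn ℝ 1 (fun p => J p i • (p.2 - c)) Ω := fun i =>
    (hJ.coord i).smul hlin
  have hd : ∀ p ∈ Ω, ∑ i, dX Ω (fun p => J p i • (p.2 - c)) i p =
      (∑ i, dX Ω J i p i) • (p.2 - c) + J p := by
    intro p hp
    have h1 : ∀ i, dX Ω (fun p => J p i • (p.2 - c)) i p =
        dX Ω J i p i • (p.2 - c) + J p i • EuclideanSpace.single i 1 := by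
      intro i
      have a1 : DifferentiableWithinAt ℝ (fun p => J p i) Ω p :=
        (hJ.coord i).differentiableOn (by norm_num) p hp
      have a2 : HasFDerivWithinAt (fun p : SpaceTime => p.2 - c)
        (ContinuousLinearMap.snd ℝ ℝ E3) Ω p := hasFDerivWithinAt_snd.sub_const c
      have a3 := (a1.hasFDerivWithinAt.smul a2).fderivWithin (hΩ p hp)
      have a4 : dX Ω (fun p => J p i) i p = dX Ω J i p i := dX_coord hΩ hJ i i hp
      rw [← a4]
      simp only [dX]
      erw [a3]
      simp [add_comm]
    simp only [h1, Finset.sum_add_distrib, Finset.sum_smul]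
    congr 1
    ext k
    simp [Finset.sum_apply, Pi.single_apply]
  have hc1 : ContinuousOn (fun p => (∑ i, dX Ω J i p i) • (p.2 - c)) Ω := by
    refine ContinuousOn.fun_smul (continuousOn_finsetSum Finset.univ fun i _ => ?_)
      hlin.continuousOn
    exact ((contDiffOn_dX (m := 0) hΩ hJ (by norm_num) i).coord i).continuousOn
  have hdiv : ∀ i, ballIntegral r R (dX Ω (fun p => J p i • (p.2 - c)) i) t =
      boundaryIntegral r R (fun p ν => ν i • (J p i • (p.2 - c))) t := fun i =>
    ballIntegral_dX hT hr hR (hj i) i ht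
  rw [eq_sub_iff_add_eq, ← ballIntegral_add hc1 hJ.continuousOn htI, ← ballIntegral_congr htI hd,
    ballIntegral_sum (fun i => continuousOn_dX hΩ (hj i) i) htI]
  simp only [hdiv]
  rw [← boundaryIntegral_sum hr.continuousOn hR
    (f := fun i p ν => ν i • (J p i • (p.2 - c))) ?_ htI]
  · refine boundaryIntegral_congr hR htI fun p _ ν => ?_
    simp only [smul_smul, ← Finset.sum_smul]
    congr 1
    simp [PiLp.inner_apply, mul_comm]
  · intro i
    refine ContinuousOn.fun_smul (by fun_prop) ?_
    exact (hj i).continuousOn.comp continuousOn_fst fun z hz => hz.1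

theorem dT_smul_sub_const (hΩ : UniqueDiffOn ℝ (tube Tm Tp r R)) {f : SpaceTime → ℝ}
    (hf : ContDiffOn ℝ 1 f (tube Tm Tp r R)) {c : ℝ → E3} {c' : E3} {p : SpaceTime}
    (hp : p ∈ tube Tm Tp r R) (hc : HasDerivWithinAt c c' (Icc Tm Tp) p.1) :
    dT (tube Tm Tp r R) (fun p => f p • (p.2 - c p.1)) p =
      dT (tube Tm Tp r R) f p • (p.2 - c p.1) - f p • c' := by
  have a1 : DifferentiableWithinAt ℝ f (tube Tm Tp r R) p := hf.differentiableOn (by norm_num) p hp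
  have a0 : HasFDerivWithinAt (fun p : SpaceTime => c p.1)
      ((ContinuousLinearMap.toSpanSingleton ℝ c').comp (ContinuousLinearMap.fst ℝ ℝ E3))
      (tube Tm Tp r R) p :=
    hc.hasFDerivWithinAt.comp p hasFDerivWithinAt_fst fun q hq => hq.1
  have a2 : HasFDerivWithinAt (fun p : SpaceTime => p.2 - c p.1)
      (ContinuousLinearMap.snd ℝ ℝ E3 - (ContinuousLinearMap.toSpanSingleton ℝ c').comp
        (ContinuousLinearMap.fst ℝ ℝ E3)) (tube Tm Tp r R) p := hasFDerivWithinAt_snd.sub a0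
  have a3 := (a1.hasFDerivWithinAt.smul a2).fderivWithin (hΩ p hp)
  simp only [dT]
  erw [a3]
  simp
  abel

/-- The charge center moves with velocity `J̄ / ρ̄`, up to the boundary and perturbation terms,
where bars denote integrals over the moving ball. This is the first moment of the continuity
equation about the charge center. -/
theorem localCharge_smul_derivWithin_chargeCenter {K : NLSParams} {G φ A ψ} {U : Perturbation}
    (hT : Tm < Tp) (hr : ContDiffOn ℝ 2 r (Icc Tm Tp)) (hR : 0 < R)
    (hA : ContDiffOn ℝ 2 A (tube Tm Tp r R)) (hψ : ContDiffOn ℝ 2 ψ (tube Tm Tp r R))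
    (hU : PerturbedLaws K (tube Tm Tp r R) G φ A ψ U)
    (hpos : ∀ t ∈ Icc Tm Tp, localCharge K r R ψ t ≠ 0) {t : ℝ} (ht : t ∈ Ioo Tm Tp) :
    HasDerivAt (chargeCenter K r R ψ) (derivWithin (chargeCenter K r R ψ) (Icc Tm Tp) t) t ∧
    localCharge K r R ψ t • derivWithin (chargeCenter K r R ψ) (Icc Tm Tp) t =
      ballIntegral r R (currentDensity K (tube Tm Tp r R) A ψ) t -
      -boundaryIntegral r R (fun p ν => (inner ℝ (vel Tm Tp r p.1) ν * chargeDensity K ψ p) •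
        (p.2 - chargeCenter K r R ψ p.1)) t -
      boundaryIntegral r R (fun p ν => inner ℝ ν (currentDensity K (tube Tm Tp r R) A ψ p) •
        (p.2 - chargeCenter K r R ψ p.1)) t -
      (ballIntegral r R (dT (tube Tm Tp r R) (fun p =>
          U.ρ p • (p.2 - chargeCenter K r R ψ p.1))) t +
        ballIntegral r R U.ρ t • derivWithin (chargeCenter K r R ψ) (Icc Tm Tp) t +
        boundaryIntegral r R (fun p ν => inner ℝ ν (U.J p) •
          (p.2 - chargeCenter K r R ψ p.1)) t -
        ballIntegral r R U.J t) := by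
  have hΩ := uniqueDiffOn_tube hT hr hR
  have hrc := hr.continuousOn
  have htI := Ioo_subset_Icc_self ht
  have hρ : ContDiffOn ℝ 1 (chargeDensity K ψ) (tube Tm Tp r R) :=
    contDiffOn_chargeDensity (hψ.of_le (by norm_num))
  have hJ := contDiffOn_currentDensity (K := K) hΩ hA hψ
  set ρ := chargeDensity K ψ with hρd
  set J := currentDensity K (tube Tm Tp r R) A ψ with hJd
  set N := localCharge K r R ψ with hN
  set X := chargeCenter K r R ψ with hX
  have hmom : ContDiffOn ℝ 1 (fun p : SpaceTime => ρ p • p.2) (tube Tm Tp r R) :=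
    hρ.smul (by fun_prop)
  have hNd := hasDerivAt_ballIntegral hT hr hR hρ ht
  have hMd := hasDerivAt_ballIntegral hT hr hR hmom ht
  have hXeq : X = fun s => (ballIntegral r R ρ s)⁻¹ • ballIntegral r R (fun p => ρ p • p.2) s := rfl
  obtain ⟨X', hXd⟩ : ∃ X', HasDerivAt X X' t := by
    rw [hXeq]
    exact ⟨_, (hNd.fun_inv (hpos t htI)).fun_smul hMd⟩
  have hX' : derivWithin X (Icc Tm Tp) t = X' :=
    hXd.hasDerivWithinAt.derivWithin (uniqueDiffOn_Icc hT t htI)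
  rw [hX']
  refine ⟨hXd, ?_⟩
  -- the moment about the fixed point `c = X t`
  set c := X t with hc
  have hlin : ContDiffOn ℝ 1 (fun p : SpaceTime => p.2 - c) (tube Tm Tp r R) := by fun_prop
  have hg : ContDiffOn ℝ 1 (fun p : SpaceTime => ρ p • (p.2 - c)) (tube Tm Tp r R) :=
    hρ.smul hlin
  have hgd := hasDerivAt_ballIntegral hT hr hR hg ht
  have hgX : ∀ s ∈ Icc Tm Tp, ballIntegral r R (fun p => ρ p • (p.2 - c)) s = N s • (X s - c) := by
    intro s hs
    have e1 : ballIntegral r R (fun p => ρ p • (p.2 - c)) s =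
        ballIntegral r R (fun p => ρ p • p.2) s - ballIntegral r R (fun p => ρ p • c) s := by
      rw [← ballIntegral_sub hmom.continuousOn (g := fun p => ρ p • c)
        (hρ.continuousOn.smul continuousOn_const) hs]
      simp only [smul_sub]
    have e2 : ballIntegral r R (fun p => ρ p • c) s = N s • c :=
      integral_smul_const (fun x => ρ (s, x)) c
    have e3 : N s • X s = ballIntegral r R (fun p => ρ p • p.2) s := by
      rw [hX, chargeCenter, smul_smul, mul_inv_cancel₀ (hpos s hs), one_smul]
    rw [e1, e2, smul_sub, e3]
  have hNX : HasDerivAt (fun s => N s • (X s - c)) (N t • X') t := by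
    refine (hNd.fun_smul (hXd.sub_const c)).congr_deriv ?_
    simp only [hc, sub_self, smul_zero, add_zero]
    rfl
  have hmem : ∀ᶠ s in 𝓝 t, s ∈ Icc Tm Tp := Icc_mem_nhds ht.1 ht.2
  have key := hgd.unique (hNX.congr_of_eventuallyEq (hmem.mono fun s hs => hgX s hs))
  rw [← key]
  have f1 : ballIntegral r R (dT (tube Tm Tp r R) fun p => ρ p • (p.2 - c)) t =
      ballIntegral r R (fun p => dT (tube Tm Tp r R) ρ p • (p.2 - c)) t :=
    ballIntegral_congr htI fun p hp => by
      rw [dT_smul_sub_const hΩ hρ (c := fun _ => c) hp (hasDerivWithinAt_const _ _ _)]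
      simp
  have f2 : ballIntegral r R (dT (tube Tm Tp r R) fun p => U.ρ p • (p.2 - X p.1)) t =
      ballIntegral r R (fun p => dT (tube Tm Tp r R) U.ρ p • (p.2 - c)) t -
        ballIntegral r R U.ρ t • X' := by
    have e2 : ballIntegral r R (fun p => U.ρ p • X') t = ballIntegral r R U.ρ t • X' :=
      integral_smul_const (fun x => U.ρ (t, x)) X'
    rw [← e2, ← ballIntegral_sub
      ((continuousOn_dT hΩ hU.ρ_contDiffOn).fun_smul hlin.continuousOn)
      (hU.ρ_contDiffOn.continuousOn.fun_smul continuousOn_const) htI]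
    refine setIntegral_congr_fun measurableSet_closedBall fun x hx => ?_
    exact dT_smul_sub_const hΩ hU.ρ_contDiffOn (c := X) (p := (t, x))
      ⟨htI, by simpa [dist_eq_norm] using hx⟩ hXd.hasDerivWithinAt
  have hdivc : ∀ {V : SpaceTime → E3}, ContDiffOn ℝ 1 V (tube Tm Tp r R) →
      ContinuousOn (fun p => (∑ i, dX (tube Tm Tp r R) V i p i) • (p.2 - c))
        (tube Tm Tp r R) := fun {V} hV => by
    refine ContinuousOn.fun_smul (continuousOn_finsetSum Finset.univ fun i _ => ?_)
      hlin.continuousOn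
    exact ((contDiffOn_dX (m := 0) hΩ hV (by norm_num) i).coord i).continuousOn
  have hdTc : ∀ {f : SpaceTime → ℝ}, ContDiffOn ℝ 1 f (tube Tm Tp r R) →
      ContinuousOn (fun p => dT (tube Tm Tp r R) f p • (p.2 - c)) (tube Tm Tp r R) := fun hf =>
    (continuousOn_dT hΩ hf).fun_smul hlin.continuousOn
  have f3 : ballIntegral r R (fun p => dT (tube Tm Tp r R) ρ p • (p.2 - c)) t +
      ballIntegral r R (fun p => dT (tube Tm Tp r R) U.ρ p • (p.2 - c)) t +
      ballIntegral r R (fun p => (∑ i, dX (tube Tm Tp r R) J i p i) • (p.2 - c)) t +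
      ballIntegral r R (fun p => (∑ i, dX (tube Tm Tp r R) U.J i p i) • (p.2 - c)) t = 0 := by
    have hc12 := (hdTc hρ).fun_add (hdTc hU.ρ_contDiffOn)
    have hc123 := hc12.fun_add (hdivc hJ)
    rw [← ballIntegral_add (hdTc hρ) (hdTc hU.ρ_contDiffOn) htI,
      ← ballIntegral_add hc12 (hdivc hJ) htI, ← ballIntegral_add hc123 (hdivc hU.J_contDiffOn) htI]
    rw [ballIntegral_congr (g := fun _ => (0 : E3)) htI fun p hp => ?_]
    · simp [ballIntegral]
    · simp only [← add_smul]
      rw [hU.continuity p hp, zero_smul]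
  rw [ballIntegral_div_smul hT hr hR hJ c ht,
    ballIntegral_div_smul hT hr hR hU.J_contDiffOn c ht] at f3
  have f4 : boundaryIntegral r R (fun p ν => (inner ℝ (vel Tm Tp r p.1) ν * ρ p) •
      (p.2 - X p.1)) t =
      boundaryIntegral r R (fun p ν => inner ℝ (vel Tm Tp r p.1) ν • ρ p • (p.2 - c)) t := by
    simp only [boundaryIntegral, sphereIntegral, mul_smul, hc]
  have f5 : boundaryIntegral r R (fun p ν => inner ℝ ν (J p) • (p.2 - X p.1)) t =
      boundaryIntegral r R (fun p ν => inner ℝ ν (J p) • (p.2 - c)) t := by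
    simp only [boundaryIntegral, sphereIntegral, hc]
  have f6 : boundaryIntegral r R (fun p ν => inner ℝ ν (U.J p) • (p.2 - X p.1)) t =
      boundaryIntegral r R (fun p ν => inner ℝ ν (U.J p) • (p.2 - c)) t := by
    simp only [boundaryIntegral, sphereIntegral, hc]
  rw [f1, f2, f4, f5, f6, ← sub_eq_zero, ← f3]
  abel

/-- The charge balance in the moving ball. -/
theorem localCharge_sub_eq {K : NLSParams} {G φ A ψ} {U : Perturbation}
    (hT : Tm < Tp) (hr : ContDiffOn ℝ 2 r (Icc Tm Tp)) (hR : 0 < R)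
    (hA : ContDiffOn ℝ 2 A (tube Tm Tp r R)) (hψ : ContDiffOn ℝ 2 ψ (tube Tm Tp r R))
    (hU : PerturbedLaws K (tube Tm Tp r R) G φ A ψ U) {t₀ t : ℝ} (ht₀ : t₀ ∈ Icc Tm Tp)
    (ht : t ∈ Icc Tm Tp) :
    localCharge K r R ψ t - localCharge K r R ψ t₀ =
      ((∫ s in t₀..t, boundaryIntegral r R (fun p ν =>
        inner ℝ (vel Tm Tp r p.1) ν * chargeDensity K ψ p) s) -
      ∫ s in t₀..t, boundaryIntegral r R (fun p ν =>
        inner ℝ ν (currentDensity K (tube Tm Tp r R) A ψ p)) s) -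
      (ballIntegral r R U.ρ t - ballIntegral r R U.ρ t₀ -
        (∫ s in t₀..t, boundaryIntegral r R (fun p ν =>
          inner ℝ (vel Tm Tp r p.1) ν * U.ρ p) s) +
        ∫ s in t₀..t, boundaryIntegral r R (fun p ν => inner ℝ ν (U.J p)) s) := by
  have hΩ := uniqueDiffOn_tube hT hr hR
  have hρ : ContDiffOn ℝ 1 (chargeDensity K ψ) (tube Tm Tp r R) :=
    contDiffOn_chargeDensity (hψ.of_le (by norm_num))
  have hJ := contDiffOn_currentDensity (K := K) hΩ hA hψ
  have hrc := hr.continuousOn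
  have i1 := integral_ballIntegral_dT hT hr hR hρ ht₀ ht
  have i2 := integral_ballIntegral_dT hT hr hR hU.ρ_contDiffOn ht₀ ht
  have i3 := integral_ballIntegral_div hT hr hR (fun i => hJ.coord i) ht₀ ht
  have i4 := integral_ballIntegral_div hT hr hR (fun i => hU.J_contDiffOn.coord i) ht₀ ht
  have hdivc : ∀ {V : SpaceTime → E3}, ContDiffOn ℝ 1 V (tube Tm Tp r R) →
      ContinuousOn (fun p => ∑ i, dX (tube Tm Tp r R) (fun p => V p i) i p)
        (tube Tm Tp r R) := fun hV =>
    continuousOn_finsetSum _ fun i _ => continuousOn_dX hΩ (hV.coord i) i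
  have c1 := continuousOn_dT hΩ hρ
  have c2 := continuousOn_dT hΩ hU.ρ_contDiffOn
  have c3 := hdivc hJ
  have c4 := hdivc hU.J_contDiffOn
  have c12 := c1.fun_add c2
  have c123 := c12.fun_add c3
  have hsum := integral_ballIntegral_add hrc c123 c4 ht₀ ht
  have hsum2 := integral_ballIntegral_add hrc c12 c3 ht₀ ht
  have hsum3 := integral_ballIntegral_add hrc c1 c2 ht₀ ht
  have hz := integral_ballIntegral_congr (r := r) (R := R) (f := fun p =>
      (dT (tube Tm Tp r R) (chargeDensity K ψ) p + dT (tube Tm Tp r R) U.ρ p +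
      ∑ i, dX (tube Tm Tp r R) (fun p => currentDensity K (tube Tm Tp r R) A ψ p i) i p) +
      ∑ i, dX (tube Tm Tp r R) (fun p => U.J p i) i p) (g := fun _ => (0 : ℝ)) ht₀ ht
    fun p hp => by
      simp only [dX_coord hΩ hJ _ _ hp, dX_coord hΩ hU.J_contDiffOn _ _ hp]
      exact hU.continuity p hp
  have hz0 : ∫ s in t₀..t, ballIntegral r R (fun _ => (0 : ℝ)) s = 0 := by simp [ballIntegral]
  rw [hz0] at hz
  rw [hsum] at hz
  rw [hsum2, hsum3] at hz
  rw [i1, i2, i3, i4] at hz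
  have b1 : ∀ V : SpaceTime → E3, (fun (p : SpaceTime) (ν : E3) => ∑ i, ν i • V p i) =
      fun p ν => inner ℝ ν (V p) := fun V => by
    ext p ν
    simp [PiLp.inner_apply, mul_comm]
  rw [b1, b1] at hz
  simp only [smul_eq_mul] at hz
  simp only [localCharge]
  linarith

/-- The momentum balance in the moving ball. -/
theorem momentum_sub_eq {K : NLSParams} {G₁ g₁ φ A ψ} {a : ℝ} {U : Perturbation}
    (hG : RegularNonlinearity G₁ g₁) (ha : 0 < a)
    (hT : Tm < Tp) (hr : ContDiffOn ℝ 2 r (Icc Tm Tp)) (hR : 0 < R)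
    (hφ : ContDiffOn ℝ 2 φ (tube Tm Tp r R))
    (hA : ContDiffOn ℝ 2 A (tube Tm Tp r R)) (hψ : ContDiffOn ℝ 2 ψ (tube Tm Tp r R))
    (hU : PerturbedLaws K (tube Tm Tp r R) (scaledG G₁ a) φ A ψ U) {t₀ t : ℝ}
    (ht₀ : t₀ ∈ Icc Tm Tp) (ht : t ∈ Icc Tm Tp) :
    ballIntegral r R (momentumDensity K (tube Tm Tp r R) A ψ) t -
      ballIntegral r R (momentumDensity K (tube Tm Tp r R) A ψ) t₀ =
      (∫ s in t₀..t, boundaryIntegral r R (fun p ν => inner ℝ (vel Tm Tp r p.1) ν •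
        momentumDensity K (tube Tm Tp r R) A ψ p) s) -
      (∫ s in t₀..t, boundaryIntegral r R (fun p ν => (WithLp.toLp 2 fun j => ∑ i, ν i *
        stress K (tube Tm Tp r R) (scaledG G₁ a) φ A ψ i j p : E3)) s) +
      (∫ s in t₀..t, ballIntegral r R (lorentzDensity K (tube Tm Tp r R) φ A ψ) s) -
      (ballIntegral r R U.P t - ballIntegral r R U.P t₀ -
        (∫ s in t₀..t, boundaryIntegral r R (fun p ν => inner ℝ (vel Tm Tp r p.1) ν • U.P p) s) +
        (∫ s in t₀..t, ballIntegral r R (fun p => (WithLp.toLp 2 fun j =>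
          ∑ i, dX (tube Tm Tp r R) (U.T i j) i p : E3)) s) -
        ∫ s in t₀..t, ballIntegral r R U.f s) := by
  have hΩ := uniqueDiffOn_tube hT hr hR
  have hrc := hr.continuousOn
  have hP := contDiffOn_momentumDensity (K := K) hΩ hA hψ
  have hS := contDiffOn_stressRow (K := K) hG ha hΩ hφ hA hψ
  have i1 := integral_ballIntegral_dT hT hr hR hP ht₀ ht
  have i2 := integral_ballIntegral_dT hT hr hR hU.P_contDiffOn ht₀ ht
  have i3 := integral_ballIntegral_div hT hr hR hS ht₀ ht
  have c1 := continuousOn_dT hΩ hP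
  have c2 := continuousOn_dT hΩ hU.P_contDiffOn
  have c3 : ContinuousOn (fun p => ∑ i, dX (tube Tm Tp r R)
      (stressRow K (tube Tm Tp r R) (scaledG G₁ a) φ A ψ i) i p) (tube Tm Tp r R) :=
    continuousOn_finsetSum _ fun i _ => continuousOn_dX hΩ (hS i) i
  have c4 : ContinuousOn (fun p => (WithLp.toLp 2 fun j =>
      ∑ i, dX (tube Tm Tp r R) (U.T i j) i p : E3)) (tube Tm Tp r R) := by
    rw [← contDiffOn_zero (𝕜 := ℝ)]
    refine contDiffOn_euclidean.2 fun j => ?_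
    have : ContDiffOn ℝ 0 (fun p => ∑ i, dX (tube Tm Tp r R) (U.T i j) i p) (tube Tm Tp r R) :=
      ContDiffOn.sum fun i _ => contDiffOn_dX hΩ (hU.T_contDiffOn i j) (by norm_num) i
    exact this
  have c5 := continuousOn_lorentzDensity (K := K) hΩ hφ hA hψ
  have c12 := c1.fun_add c2
  have c123 := c12.fun_add c3
  have hsum := integral_ballIntegral_add hrc c123 c4 ht₀ ht
  have hsum2 := integral_ballIntegral_add hrc c12 c3 ht₀ ht
  have hsum3 := integral_ballIntegral_add hrc c1 c2 ht₀ ht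
  have hsum4 := integral_ballIntegral_add hrc c5 hU.f_continuousOn ht₀ ht
  have hz := integral_ballIntegral_congr (r := r) (R := R) (f := fun p =>
      (dT (tube Tm Tp r R) (momentumDensity K (tube Tm Tp r R) A ψ) p +
        dT (tube Tm Tp r R) U.P p +
      ∑ i, dX (tube Tm Tp r R) (stressRow K (tube Tm Tp r R) (scaledG G₁ a) φ A ψ i) i p) +
      (WithLp.toLp 2 fun j => ∑ i, dX (tube Tm Tp r R) (U.T i j) i p : E3))
      (g := fun p => lorentzDensity K (tube Tm Tp r R) φ A ψ p + U.f p) ht₀ ht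
    fun p hp => by
      ext j
      have := hU.momentum p hp j
      simp only [PiLp.add_apply] at this ⊢
      rw [← this]
      have e : ∀ i, dX (tube Tm Tp r R) (stress K (tube Tm Tp r R) (scaledG G₁ a) φ A ψ i j) i p =
          dX (tube Tm Tp r R) (stressRow K (tube Tm Tp r R) (scaledG G₁ a) φ A ψ i) i p j :=
        fun i => dX_coord hΩ (hS i) i j hp
      simp [e, Finset.sum_apply]
  rw [hsum] at hz
  rw [hsum2, hsum3] at hz
  rw [i1, i2, i3, hsum4] at hz
  simp only [sum_smul_stressRow] at hz
  rw [← sub_eq_zero] at hz ⊢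
  rw [← hz]
  abel

end Balance

/-! ### Newton's law for the trajectory of concentration -/

section Newton

variable {Tm Tp R : ℝ} {r : ℝ → E3}

/-- The total Lorentz force, split into the contribution of the deviation of the fields from `E(t)`,
`B(t)` and the force of `E(t)`, `B(t)` on the total charge and momentum. -/
theorem ballIntegral_lorentzDensity {K : NLSParams} {φ A ψ} {E B : ℝ → E3}
    (hΩ : UniqueDiffOn ℝ (tube Tm Tp r R))
    (hφ : ContDiffOn ℝ 2 φ (tube Tm Tp r R)) (hA : ContDiffOn ℝ 2 A (tube Tm Tp r R))
    (hψ : ContDiffOn ℝ 2 ψ (tube Tm Tp r R)) (hE : ContinuousOn E (Icc Tm Tp))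
    (hB : ContinuousOn B (Icc Tm Tp)) {t : ℝ} (ht : t ∈ Icc Tm Tp) :
    ballIntegral r R (lorentzDensity K (tube Tm Tp r R) φ A ψ) t =
      (ballIntegral r R (fun p => chargeDensity K ψ p •
          (electricField K (tube Tm Tp r R) φ A p - E p.1)) t +
        ballIntegral r R (fun p => K.c⁻¹ •
          cross (currentDensity K (tube Tm Tp r R) A ψ p)
            (magneticField (tube Tm Tp r R) A p - B p.1)) t) +
      (localCharge K r R ψ t • E t + (K.c⁻¹ * (K.q / K.m)) •
        cross (ballIntegral r R (momentumDensity K (tube Tm Tp r R) A ψ) t) (B t)) := by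
  have h1 : ContDiffOn ℝ 1 φ (tube Tm Tp r R) := hφ.of_le (by norm_num)
  have h2 : ContDiffOn ℝ 1 A (tube Tm Tp r R) := hA.of_le (by norm_num)
  have hρ := (contDiffOn_chargeDensity (K := K) hψ).continuousOn
  have hP := (contDiffOn_momentumDensity (K := K) hΩ hA hψ).continuousOn
  have hJ := (contDiffOn_currentDensity (K := K) hΩ hA hψ).continuousOn
  have hEf := continuousOn_electricField (K := K) hΩ h1 h2
  have hBf := continuousOn_magneticField hΩ h2
  have hE' : ContinuousOn (fun p : SpaceTime => E p.1) (tube Tm Tp r R) :=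
    ContinuousOn.comp hE continuousOn_fst fun p hp => hp.1
  have hB' : ContinuousOn (fun p : SpaceTime => B p.1) (tube Tm Tp r R) :=
    ContinuousOn.comp hB continuousOn_fst fun p hp => hp.1
  set Ω := tube Tm Tp r R with hΩd
  have c1 : ContinuousOn (fun p => chargeDensity K ψ p • (electricField K Ω φ A p - E p.1)) Ω :=
    hρ.fun_smul (hEf.sub hE')
  have c2 : ContinuousOn (fun p => K.c⁻¹ • cross (currentDensity K Ω A ψ p)
      (magneticField Ω A p - B p.1)) Ω :=
    (hJ.cross (hBf.fun_sub hB')).const_smul K.c⁻¹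
  have c3 : ContinuousOn (fun p => chargeDensity K ψ p • E p.1) Ω := hρ.fun_smul hE'
  have c4 : ContinuousOn (fun p => K.c⁻¹ • cross (currentDensity K Ω A ψ p) (B p.1)) Ω :=
    (hJ.cross hB').const_smul K.c⁻¹
  have e3 : ballIntegral r R (fun p => chargeDensity K ψ p • E p.1) t =
      localCharge K r R ψ t • E t :=
    integral_smul_const (fun x => chargeDensity K ψ (t, x)) (E t)
  have e4 : ballIntegral r R (fun p => K.c⁻¹ • cross (currentDensity K Ω A ψ p) (B p.1)) t =
      (K.c⁻¹ * (K.q / K.m)) • cross (ballIntegral r R (momentumDensity K Ω A ψ) t) (B t) := by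
    have i1 := integrableOn_ball_slice hP ht
    have a1 := (crossL.flip (B t)).integral_comp_comm i1
    have a2 : cross (ballIntegral r R (momentumDensity K Ω A ψ) t) (B t) =
        ∫ x in Metric.closedBall (r t) R, cross (momentumDensity K Ω A ψ (t, x)) (B t) := a1.symm
    rw [a2, ← integral_smul, ballIntegral]
    refine integral_congr_ae (Eventually.of_forall fun x => ?_)
    simp only [currentDensity_eq_smul, ← crossL_apply, map_smul, smul_apply, smul_smul]
  rw [← e3, ← e4, ← ballIntegral_add c1 c2 ht, ← ballIntegral_add c3 c4 ht,
    ← ballIntegral_add (c1.fun_add c2) (c3.fun_add c4) ht]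
  refine ballIntegral_congr ht fun p _ => ?_
  simp only [lorentzDensity, ← crossL_apply, map_sub, smul_sub]
  abel

/-- The mean value inequality on a closed interval, with derivatives in the interior only. -/
theorem norm_sub_le_of_hasDerivAt_Ioo {F : Type*} [NormedAddCommGroup F] [NormedSpace ℝ F]
    (hT : Tm < Tp) {f f' : ℝ → F} {C : ℝ} (hf : ContinuousOn f (Icc Tm Tp))
    (hd : ∀ t ∈ Ioo Tm Tp, HasDerivAt f (f' t) t) (hC : ∀ t ∈ Ioo Tm Tp, ‖f' t‖ ≤ C) {s t : ℝ}
    (hs : s ∈ Icc Tm Tp) (ht : t ∈ Icc Tm Tp) : ‖f t - f s‖ ≤ C * |t - s| := by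
  have hC0 : 0 ≤ C := (norm_nonneg _).trans (hC ((Tm + Tp) / 2) ⟨by linarith, by linarith⟩)
  have h1 : LipschitzOnWith ⟨C, hC0⟩ f (Ioo Tm Tp) :=
    (convex_Ioo Tm Tp).lipschitzOnWith_of_nnnorm_hasDerivWithin_le
      (fun x hx => (hd x hx).hasDerivWithinAt) (fun x hx => hC x hx)
  rw [← closure_Ioo hT.ne] at hf hs ht
  have h2 := (h1.closure hf).dist_le_mul t ht s hs
  rw [dist_eq_norm, Real.dist_eq] at h2
  exact h2

theorem chargeDensity_nonneg {K : NLSParams} (hq : 0 < K.q) (ψ : SpaceTime → ℂ) (p : SpaceTime) :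
    0 ≤ chargeDensity K ψ p := by
  unfold chargeDensity; positivity

/-- The charge center lies in the ball. -/
theorem norm_chargeCenter_sub_le {K : NLSParams} {ψ} (hq : 0 < K.q)
    (hψ : ContinuousOn (chargeDensity K ψ) (tube Tm Tp r R)) {t : ℝ} (ht : t ∈ Icc Tm Tp)
    (hN : 0 < localCharge K r R ψ t) : ‖chargeCenter K r R ψ t - r t‖ ≤ R := by
  set ρ := chargeDensity K ψ with hρ
  have hi := integrableOn_ball_slice hψ ht
  have hi2 : IntegrableOn (fun x => ρ (t, x) • x) (Metric.closedBall (r t) R) :=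
    ((continuousOn_ball_slice hψ ht).smul continuousOn_id).integrableOn_compact
      (isCompact_closedBall _ _)
  have e1 : localCharge K r R ψ t • (chargeCenter K r R ψ t - r t) =
      ∫ x in Metric.closedBall (r t) R, ρ (t, x) • (x - r t) := by
    simp only [smul_sub]
    rw [integral_sub hi2 (hi.smul_const (r t)), integral_smul_const, chargeCenter, smul_smul,
      mul_inv_cancel₀ hN.ne', one_smul]
    rfl
  have e2 : ‖∫ x in Metric.closedBall (r t) R, ρ (t, x) • (x - r t)‖ ≤
      ∫ x in Metric.closedBall (r t) R, ρ (t, x) * R := by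
    refine norm_integral_le_of_norm_le (hi.mul_const R) ?_
    filter_upwards [ae_restrict_mem measurableSet_closedBall] with x hx
    rw [norm_smul, Real.norm_of_nonneg (chargeDensity_nonneg hq ψ _)]
    exact mul_le_mul_of_nonneg_left (by simpa [dist_eq_norm] using hx)
      (chargeDensity_nonneg hq ψ _)
  rw [integral_mul_const, ← e1, norm_smul, Real.norm_of_nonneg hN.le] at e2
  exact le_of_mul_le_mul_left e2 hN

/-- The trajectory of concentration of asymptotic solutions satisfies Newton's law, and the charge
parameter is positive. -/
theorem newton_of_concentratesAsymptotically {K : NLSParams} {G₁ g₁ : ℝ → ℝ}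
    (hG : RegularNonlinearity G₁ g₁) (hT : Tm < Tp) (hr : ContDiffOn ℝ 2 r (Icc Tm Tp))
    {a R : ℕ → ℝ} {φ A ψ} {L : LinearPotentials}
    (h : ConcentratesAsymptotically K G₁ Tm Tp r a R φ A ψ L)
    (hE : ContinuousOn (L.elec K Tm Tp r) (Icc Tm Tp)) (hB : ContDiffOn ℝ 1 L.magn (Icc Tm Tp)) :
    0 < K.q ∧ ∀ t ∈ Icc Tm Tp, K.m • acc Tm Tp r t =
      K.q • L.elec K Tm Tp r t + (K.q / K.c) • cross (vel Tm Tp r t) (L.magn t) := by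
  have hm := K.m_pos
  have hcpos := K.c_pos
  have hrc := hr.continuousOn
  have hRp := h.localized.R_pos
  have hΩ : ∀ n, UniqueDiffOn ℝ (tube Tm Tp r (R n)) := fun n => uniqueDiffOn_tube hT hr (hRp n)
  have hφ := h.localized.φ_contDiffOn
  have hA := h.localized.A_contDiffOn
  have hψ := h.contDiffOn
  obtain ⟨CP, hCP⟩ := h.momentum_bounded
  obtain ⟨CN, c₀, hc₀, n₀, hN⟩ := h.charge_bounded
  obtain ⟨t₀, ht₀, ⟨ρ, hρ⟩, hQ0, hQ01, hQ20, hQ22, hQ23, hQ3, U, hU, hQ0', hQ2', hQ3'⟩ :=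
    h.asymptotic
  -- the charges are bounded below by a positive constant
  have hq : 0 < K.q := by
    by_contra hq
    have h1 := (hN n₀ le_rfl t₀ ht₀).1
    have h2 : localCharge K r (R n₀) (ψ n₀) t₀ ≤ 0 := by
      refine integral_nonpos fun x => ?_
      exact mul_nonpos_of_nonpos_of_nonneg (not_lt.1 hq) (by positivity)
    linarith
  refine ⟨hq, ?_⟩
  set N : ℕ → ℝ → ℝ := fun n => localCharge K r (R n) (ψ n) with hNd
  set p : ℕ → ℝ → E3 := fun n =>
    ballIntegral r (R n) (momentumDensity K (tube Tm Tp r (R n)) (A n) (ψ n)) with hpd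
  set X : ℕ → ℝ → E3 := fun n => chargeCenter K r (R n) (ψ n) with hXd
  have hρc : ∀ n, ContinuousOn (chargeDensity K (ψ n)) (tube Tm Tp r (R n)) := fun n =>
    (contDiffOn_chargeDensity (hψ n)).continuousOn
  have hpc : ∀ n, ContinuousOn (p n) (Icc Tm Tp) := fun n =>
    continuousOn_ballIntegral hrc (contDiffOn_momentumDensity (hΩ n) (hA n) (hψ n)).continuousOn
  have hNc : ∀ n, ContinuousOn (N n) (Icc Tm Tp) := fun n => continuousOn_ballIntegral hrc (hρc n)
  have hNpos : ∀ n ≥ n₀, ∀ t ∈ Icc Tm Tp, 0 < N n t := fun n hn t ht =>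
    hc₀.trans_le (hN n hn t ht).1
  have hρ0 : 0 < ρ := hc₀.trans_le (ge_of_tendsto hρ
    ((eventually_ge_atTop n₀).mono fun n hn => (hN n hn t₀ ht₀).1))
  -- the charge converges to a constant
  have hNlim : UnifToZero Tm Tp (fun n t => N n t - ρ) := by
    have u1 : UnifToZero Tm Tp (fun n _ => N n t₀ - ρ) :=
      UnifToZero.of_tendsto (tendsto_sub_nhds_zero_iff.2 hρ)
    refine ((hQ23.sub hQ3').add u1).congr (Eventually.of_forall fun n t ht => ?_)
    have := localCharge_sub_eq hT hr (hRp n) (hA n) (hψ n) (hU n) ht₀ ht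
    rw [← this]
    simp only [hNd]
    ring
  -- the charge centers converge to the trajectory
  have hXlim : UnifToZero Tm Tp (fun n t => X n t - r t) := by
    rw [unifToZero_iff]
    intro ε hε
    filter_upwards [h.localized.R_tendsto.eventually (gt_mem_nhds hε), eventually_ge_atTop n₀]
      with n hn hn₀ t ht
    exact (norm_chargeCenter_sub_le hq (hρc n) ht (hNpos n hn₀ t ht)).trans_lt hn
  -- the velocities of the charge centers
  obtain ⟨err, herr, hXder⟩ : ∃ err : ℕ → ℝ → E3, UnifToZero Tm Tp err ∧
      ∀ n ≥ n₀, ∀ t ∈ Ioo Tm Tp, ∃ X' : E3, HasDerivAt (X n) X' t ∧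
        N n t • X' = (K.q / K.m) • p n t - err n t := by
    refine ⟨_, (hQ20.add hQ22).add hQ2', fun n hn t ht => ?_⟩
    obtain ⟨h1, h2⟩ := localCharge_smul_derivWithin_chargeCenter hT hr (hRp n) (hA n) (hψ n) (hU n)
      (fun t ht => (hNpos n hn t ht).ne') ht
    refine ⟨_, h1, h2.trans ?_⟩
    have e : ballIntegral r (R n) (currentDensity K (tube Tm Tp r (R n)) (A n) (ψ n)) t =
        (K.q / K.m) • p n t := by
      simp only [hpd, ballIntegral, currentDensity_eq_smul]
      rw [integral_smul]
    rw [e]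
    abel
  set κ : ℝ := K.m / K.q * ρ with hκ
  have hXc : ∀ n ≥ n₀, ContinuousOn (X n) (Icc Tm Tp) := fun n hn => by
    refine ((hNc n).inv₀ fun t ht => (hNpos n hn t ht).ne').smul ?_
    exact continuousOn_ballIntegral hrc ((hρc n).smul continuousOn_snd)
  -- `κ X' - p` is small because `N X' - (q/m) p` and `N - ρ` are, and `X'` is bounded; the mean
  -- value inequality turns this into an estimate of `κ X - ∫ p`
  have hD : UnifToZero Tm Tp (fun n t => (κ • X n t - ∫ s in t₀..t, p n s) -
      (κ • X n t₀ - ∫ s in t₀..t₀, p n s)) := by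
    rw [unifToZero_iff]
    intro ε hε
    have hq' := hq.ne'
    -- a bound for `‖X'‖`, and the accuracies for which `‖κ X' - p‖ ≤ η`
    set M : ℝ := c₀⁻¹ * (K.q / K.m * |CP| + 1) with hM
    have hMpos : 0 < M := by positivity
    set η : ℝ := ε / (Tp - Tm + 1) with hη
    have hlen : 0 < Tp - Tm + 1 := by linarith
    have hηpos : 0 < η := by positivity
    set η1 : ℝ := min 1 (η / (2 * (K.m / K.q))) with hη1
    set η2 : ℝ := η / (2 * (K.m / K.q) * M) with hη2
    have hη1pos : 0 < η1 := by positivity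
    have hη2pos : 0 < η2 := by positivity
    filter_upwards [unifToZero_iff.1 herr η1 hη1pos, unifToZero_iff.1 hNlim η2 hη2pos,
      eventually_ge_atTop n₀] with n hn1 hn2 hn t ht
    have hb : ∀ t ∈ Ioo Tm Tp, ‖κ • deriv (X n) t - p n t‖ ≤ η := by
      intro t ht
      have htI := Ioo_subset_Icc_self ht
      obtain ⟨X', hX', hX'e⟩ := hXder n hn t ht
      rw [hX'.deriv]
      have e1 := (hn1 t htI).le
      have e2 := (hn2 t htI).le
      have e3 : ‖X'‖ ≤ M := by
        have a1 : N n t * ‖X'‖ ≤ K.q / K.m * |CP| + 1 := by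
          rw [← Real.norm_of_nonneg (hNpos n hn t htI).le, ← norm_smul, hX'e]
          refine (norm_sub_le _ _).trans (add_le_add ?_ (e1.trans (min_le_left _ _)))
          rw [norm_smul, Real.norm_of_nonneg (by positivity)]
          exact mul_le_mul_of_nonneg_left ((hCP n t htI).trans (le_abs_self _)) (by positivity)
        have a2 : c₀ * ‖X'‖ ≤ N n t * ‖X'‖ :=
          mul_le_mul_of_nonneg_right (hN n hn t htI).1 (norm_nonneg _)
        rw [hM, inv_mul_eq_div, le_div_iff₀ hc₀]
        linarith
      have e4 : κ • X' - p n t = (K.m / K.q) • ((ρ - N n t) • X' - err n t) := by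
        have a1 : p n t = (K.m / K.q) • (N n t • X' + err n t) := by
          rw [hX'e, sub_add_cancel, smul_smul]
          have : K.m / K.q * (K.q / K.m) = 1 := by field_simp
          rw [this, one_smul]
        rw [a1, hκ]
        module
      rw [e4, norm_smul, Real.norm_of_nonneg (by positivity)]
      have e5 : ‖(ρ - N n t) • X' - err n t‖ ≤ η2 * M + η1 := by
        refine (norm_sub_le _ _).trans (add_le_add ?_ e1)
        rw [norm_smul, norm_sub_rev]
        exact mul_le_mul e2 e3 (norm_nonneg _) hη2pos.le
      have e6 : η2 * M + η1 ≤ η / (K.m / K.q) := by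
        have a1 : η2 * M = η / (2 * (K.m / K.q)) := by
          rw [hη2]; field_simp
        have a2 : η1 ≤ η / (2 * (K.m / K.q)) := min_le_right _ _
        have a3 : η / (K.m / K.q) = η / (2 * (K.m / K.q)) + η / (2 * (K.m / K.q)) := by
          field_simp; norm_num
        linarith
      calc K.m / K.q * ‖(ρ - N n t) • X' - err n t‖ ≤ K.m / K.q * (η / (K.m / K.q)) :=
            mul_le_mul_of_nonneg_left (e5.trans e6) (by positivity)
        _ = η := by field_simp
    have hmv := norm_sub_le_of_hasDerivAt_Ioo hT
      (f := fun t => κ • X n t - ∫ s in t₀..t, p n s)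
      (f' := fun t => κ • deriv (X n) t - p n t)
      (((hXc n hn).const_smul κ).fun_sub (continuousOn_primitive (hpc n) ht₀))
      (fun t ht => by
        obtain ⟨X', hX', -⟩ := hXder n hn t ht
        rw [hX'.deriv]
        exact (hX'.fun_const_smul κ).fun_sub ((hasDerivWithinAt_primitive (hpc n) ht₀
          (Ioo_subset_Icc_self ht)).hasDerivAt (Icc_mem_nhds ht.1 ht.2)))
      hb ht₀ ht
    refine hmv.trans_lt ?_
    have h2 : |t - t₀| ≤ Tp - Tm :=
      abs_le.2 ⟨by linarith [ht.1, ht₀.2], by linarith [ht.2, ht₀.1]⟩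
    rw [hη, div_mul_eq_mul_div, div_lt_iff₀ hlen]
    nlinarith
  -- hence the primitives of the momenta converge to a multiple of the displacement
  have hqlim : UnifToZero Tm Tp (fun n t => (∫ s in t₀..t, p n s) - κ • (r t - r t₀)) := by
    have u1 := hXlim.const_smul κ
    have u2 : UnifToZero Tm Tp (fun n _ => κ • (X n t₀ - r t₀)) := by
      refine UnifToZero.of_tendsto ?_
      simpa using (hXlim.tendsto ht₀).const_smul κ
    refine ((u1.sub u2).sub hD).congr (Eventually.of_forall fun n t _ => ?_)
    rw [intervalIntegral.integral_same]
    module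
  -- the momentum balance, with the fields replaced by their values on the trajectory
  have hmot : UnifToZero Tm Tp (fun n t => p n t - p n t₀ -
      ∫ s in t₀..t, (N n s • L.elec K Tm Tp r s +
        (K.c⁻¹ * (K.q / K.m)) • cross (p n s) (L.magn s))) := by
    refine (((hQ01.sub hQ0).add hQ3).sub hQ0').congr (Eventually.of_forall fun n t ht => ?_)
    have e1 := momentum_sub_eq hG (h.localized.a_pos n) hT hr (hRp n) (hφ n) (hA n) (hψ n) (hU n)
      ht₀ ht
    have c1 : ContinuousOn (fun s => N n s • L.elec K Tm Tp r s +
        (K.c⁻¹ * (K.q / K.m)) • cross (p n s) (L.magn s)) (Icc Tm Tp) :=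
      ((hNc n).smul hE).fun_add (((hpc n).cross hB.continuousOn).const_smul (K.c⁻¹ * (K.q / K.m)))
    have c2 := continuousOn_ballIntegral hrc
      (continuousOn_lorentzDensity (K := K) (hΩ n) (hφ n) (hA n) (hψ n))
    have e2 : ∀ s ∈ Icc Tm Tp, (ballIntegral r (R n) (fun p => chargeDensity K (ψ n) p •
          (electricField K (tube Tm Tp r (R n)) (φ n) (A n) p - L.elec K Tm Tp r p.1)) s +
        ballIntegral r (R n) (fun p => K.c⁻¹ •
          cross (currentDensity K (tube Tm Tp r (R n)) (A n) (ψ n) p)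
            (magneticField (tube Tm Tp r (R n)) (A n) p - L.magn p.1)) s) =
        ballIntegral r (R n) (lorentzDensity K (tube Tm Tp r (R n)) (φ n) (A n) (ψ n)) s -
        (N n s • L.elec K Tm Tp r s +
          (K.c⁻¹ * (K.q / K.m)) • cross (p n s) (L.magn s)) := fun s hs => by
      rw [ballIntegral_lorentzDensity (hΩ n) (hφ n) (hA n) (hψ n) hE hB.continuousOn hs,
        add_sub_cancel_right]
    have e3 := intervalIntegral.integral_congr (μ := volume) (a := t₀) (b := t) fun s hs =>
      e2 s (uIcc_subset_Icc ht₀ ht hs)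
    rw [intervalIntegral.integral_sub (intervalIntegrable_of_continuousOn c2 ht₀ ht)
      (intervalIntegrable_of_continuousOn c1 ht₀ ht)] at e3
    rw [e1, e3]
    abel
  intro t ht
  have hfin := limit_equation_of_motion hT hr ht₀ hpc hNc hE hB hNlim hqlim hmot t ht
  have h2 := congrArg (fun v => (K.q / ρ) • v) hfin
  simp only [smul_add, smul_smul] at h2
  have c1 : K.q / ρ * κ = K.m := by rw [hκ]; field_simp
  have c2 : K.q / ρ * ρ = K.q := by field_simp
  have c3 : K.q / ρ * (K.c⁻¹ * (K.q / K.m) * κ) = K.q / K.c := by rw [hκ]; field_simp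
  rw [c1, c2, c3] at h2
  exact h2

end Newton

/-! ### The linear parts of the potentials -/

section LinearPart

variable {Tm Tp : ℝ} {r : ℝ → E3}

theorem ContDiffOn.curlLin {n : WithTop ℕ∞} {s : Set ℝ} {M : ℝ → E3 →L[ℝ] E3}
    (hM : ContDiffOn ℝ n M s) : ContDiffOn ℝ n (fun t => _root_.curlLin (M t)) s := by
  have h : ∀ i k : Fin 3, ContDiffOn ℝ n (fun t => M t (EuclideanSpace.single i 1) k) s :=
    fun i k => (hM.clm_apply contDiffOn_const).coord k
  refine contDiffOn_euclidean.2 fun i => ?_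
  fin_cases i
  · exact (h 1 2).sub (h 2 1)
  · exact (h 2 0).sub (h 0 2)
  · exact (h 0 1).sub (h 1 0)

/-- The electric field on the trajectory in terms of the derivatives of the coefficients. -/
theorem LinearPotentials.elec_eq (L : LinearPotentials) (K : NLSParams) (hT : Tm < Tp)
    (hr : ContDiffOn ℝ 2 r (Icc Tm Tp)) (h₀ : ContDiffOn ℝ 1 L.A₀ (Icc Tm Tp))
    (h₁ : ContDiffOn ℝ 1 L.A₁ (Icc Tm Tp)) {t : ℝ} (ht : t ∈ Icc Tm Tp) :
    L.elec K Tm Tp r t =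
      -L.φ₁ t - K.c⁻¹ • (derivWithin L.A₀ (Icc Tm Tp) t - L.A₁ t (vel Tm Tp r t)) := by
  have a0 := (h₀.differentiableOn (by norm_num) t ht).hasDerivWithinAt
  have a1 := (h₁.differentiableOn (by norm_num) t ht).hasDerivWithinAt
  have a2 : HasDerivWithinAt r (vel Tm Tp r t) (Icc Tm Tp) t :=
    (hr.differentiableOn (by norm_num) t ht).hasDerivWithinAt
  have a3 := a0.fun_add (a1.clm_apply (a2.const_sub (r t)))
  have a4 := a3.derivWithin (uniqueDiffOn_Icc hT t ht)
  simp only [LinearPotentials.elec, LinearPotentials.vec]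
  rw [a4]
  simp [sub_eq_add_neg]

variable {D : Set SpaceTime} {F : Type*} [NormedAddCommGroup F] [NormedSpace ℝ F]

theorem contDiffOn_graph {n : WithTop ℕ∞} {s : Set ℝ} (hr : ContDiffOn ℝ n r s) :
    ContDiffOn ℝ n (fun t => ((t, r t) : SpaceTime)) s :=
  contDiffOn_id.prodMk hr

theorem contDiffOn_fderiv_graph (hD : IsOpen D) {f : SpaceTime → F} (hf : ContDiffOn ℝ 2 f D)
    (hr : ContDiffOn ℝ 2 r (Icc Tm Tp)) (hrD : ∀ t ∈ Icc Tm Tp, (t, r t) ∈ D) :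
    ContDiffOn ℝ 1 (fun t => fderiv ℝ f (t, r t)) (Icc Tm Tp) := by
  have h1 : ContDiffOn ℝ 1 (fderiv ℝ f) D := hf.fderiv_of_isOpen hD (by norm_num)
  exact h1.comp (contDiffOn_graph (hr.of_le (by norm_num))) hrD

variable {φ : SpaceTime → ℝ} {A : SpaceTime → E3}

theorem contDiffOn_linearPart_φ₀ (hφ : ContDiffOn ℝ 2 φ D)
    (hr : ContDiffOn ℝ 2 r (Icc Tm Tp)) (hrD : ∀ t ∈ Icc Tm Tp, (t, r t) ∈ D) :
    ContDiffOn ℝ 2 (linearPart φ A r).φ₀ (Icc Tm Tp) :=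
  hφ.comp (contDiffOn_graph hr) hrD

theorem contDiffOn_linearPart_A₀ (hA : ContDiffOn ℝ 2 A D)
    (hr : ContDiffOn ℝ 2 r (Icc Tm Tp)) (hrD : ∀ t ∈ Icc Tm Tp, (t, r t) ∈ D) :
    ContDiffOn ℝ 2 (linearPart φ A r).A₀ (Icc Tm Tp) :=
  hA.comp (contDiffOn_graph hr) hrD

theorem contDiffOn_linearPart_φ₁ (hD : IsOpen D) (hφ : ContDiffOn ℝ 2 φ D)
    (hr : ContDiffOn ℝ 2 r (Icc Tm Tp)) (hrD : ∀ t ∈ Icc Tm Tp, (t, r t) ∈ D) :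
    ContDiffOn ℝ 1 (linearPart φ A r).φ₁ (Icc Tm Tp) :=
  contDiffOn_euclidean.2 fun _ =>
    (contDiffOn_fderiv_graph hD hφ hr hrD).clm_apply contDiffOn_const

theorem contDiffOn_linearPart_A₁ (hD : IsOpen D) (hA : ContDiffOn ℝ 2 A D)
    (hr : ContDiffOn ℝ 2 r (Icc Tm Tp)) (hrD : ∀ t ∈ Icc Tm Tp, (t, r t) ∈ D) :
    ContDiffOn ℝ 1 (linearPart φ A r).A₁ (Icc Tm Tp) :=
  (contDiffOn_fderiv_graph hD hA hr hrD).clm_comp contDiffOn_const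

theorem contDiffOn_linearPart_magn (hD : IsOpen D) (hA : ContDiffOn ℝ 2 A D)
    (hr : ContDiffOn ℝ 2 r (Icc Tm Tp)) (hrD : ∀ t ∈ Icc Tm Tp, (t, r t) ∈ D) :
    ContDiffOn ℝ 1 (linearPart φ A r).magn (Icc Tm Tp) :=
  (contDiffOn_linearPart_A₁ (φ := φ) hD hA hr hrD).curlLin

theorem contDiffOn_vel (hT : Tm < Tp) (hr : ContDiffOn ℝ 2 r (Icc Tm Tp)) :
    ContDiffOn ℝ 1 (vel Tm Tp r) (Icc Tm Tp) :=
  hr.derivWithin (uniqueDiffOn_Icc hT) (by norm_num)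

theorem contDiffOn_linearPart_elec (K : NLSParams) (hT : Tm < Tp) (hD : IsOpen D)
    (hφ : ContDiffOn ℝ 2 φ D) (hA : ContDiffOn ℝ 2 A D)
    (hr : ContDiffOn ℝ 2 r (Icc Tm Tp)) (hrD : ∀ t ∈ Icc Tm Tp, (t, r t) ∈ D) :
    ContDiffOn ℝ 1 ((linearPart φ A r).elec K Tm Tp r) (Icc Tm Tp) := by
  have h0 := contDiffOn_linearPart_A₀ (φ := φ) hA hr hrD
  have h1 := contDiffOn_linearPart_A₁ (φ := φ) hD hA hr hrD
  have h2 := contDiffOn_linearPart_φ₁ (A := A) hD hφ hr hrD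
  have h3 : ContDiffOn ℝ 1 (derivWithin (linearPart φ A r).A₀ (Icc Tm Tp)) (Icc Tm Tp) :=
    h0.derivWithin (uniqueDiffOn_Icc hT) (by norm_num)
  refine ContDiffOn.congr ?_ fun t ht =>
    LinearPotentials.elec_eq _ K hT hr (h0.of_le (by norm_num)) h1 ht
  exact h2.neg.sub ((h3.sub (h1.clm_apply (contDiffOn_vel hT hr))).const_smul K.c⁻¹)

/-- The derivative of `f` along the trajectory. -/
theorem hasDerivWithinAt_graph (hD : IsOpen D) {f : SpaceTime → F}
    (hf : ContDiffOn ℝ 2 f D) (hr : ContDiffOn ℝ 2 r (Icc Tm Tp))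
    (hrD : ∀ t ∈ Icc Tm Tp, (t, r t) ∈ D) {t : ℝ} (ht : t ∈ Icc Tm Tp) :
    HasDerivWithinAt (fun t => f (t, r t)) (fderiv ℝ f (t, r t) (1, vel Tm Tp r t))
      (Icc Tm Tp) t := by
  have a1 : HasFDerivAt f (fderiv ℝ f (t, r t)) (t, r t) :=
    ((hf.differentiableOn (by norm_num) _ (hrD t ht)).differentiableAt
      (hD.mem_nhds (hrD t ht))).hasFDerivAt
  have a2 : HasDerivWithinAt r (vel Tm Tp r t) (Icc Tm Tp) t :=
    (hr.differentiableOn (by norm_num) t ht).hasDerivWithinAt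
  exact a1.comp_hasDerivWithinAt t ((hasDerivWithinAt_id t _).prodMk a2)

/-- The first-order spatial expansion of `f` at the trajectory. -/
def spatialTaylor (f : SpaceTime → F) (r : ℝ → E3) (p : SpaceTime) : F :=
  f (p.1, r p.1) + fderiv ℝ f (p.1, r p.1) (0, p.2 - r p.1)

theorem linearPart_phi_eq : (linearPart φ A r).phi r = spatialTaylor φ r := by
  ext p
  simp only [LinearPotentials.phi, linearPart, spatialTaylor]
  congr 1
  set y := p.2 - r p.1
  have hy : ((0, y) : SpaceTime) = ∑ i, y i • ((0, EuclideanSpace.single i 1) : SpaceTime) := by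
    ext j
    · simp [Prod.fst_sum]
    · simp [Prod.snd_sum, Finset.sum_apply, Pi.single_apply]
  rw [hy, map_sum]
  simp only [map_smul, smul_eq_mul]
  simp [PiLp.inner_apply]

theorem linearPart_vec_eq : (linearPart φ A r).vec r = spatialTaylor A r := by
  ext p
  simp [LinearPotentials.vec, linearPart, spatialTaylor]

theorem contDiffOn_spatialTaylor {R : ℝ} (hD : IsOpen D) {f : SpaceTime → F}
    (hf : ContDiffOn ℝ 2 f D) (hr : ContDiffOn ℝ 2 r (Icc Tm Tp))
    (hrD : ∀ t ∈ Icc Tm Tp, (t, r t) ∈ D) :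
    ContDiffOn ℝ 1 (spatialTaylor f r) (tube Tm Tp r R) := by
  have hfst : MapsTo (Prod.fst : SpaceTime → ℝ) (tube Tm Tp r R) (Icc Tm Tp) := fun p hp => hp.1
  have h1 : ContDiffOn ℝ 1 (fun t => f (t, r t)) (Icc Tm Tp) :=
    (hf.comp (contDiffOn_graph hr) hrD).of_le (by norm_num)
  have h2 : ContDiffOn ℝ 1 (fun p : SpaceTime => r p.1) (tube Tm Tp r R) :=
    (hr.of_le (by norm_num)).comp contDiffOn_fst hfst
  exact (h1.comp contDiffOn_fst hfst).add
    (((contDiffOn_fderiv_graph hD hf hr hrD).comp contDiffOn_fst hfst).clm_apply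
      (contDiffOn_const.prodMk (contDiffOn_snd.sub h2)))

/-- The full space-time derivatives of `f` and of its spatial expansion agree on the trajectory: the
time derivative of `∇f(t, r(t))` drops out because it is applied to `x - r(t) = 0`. -/
theorem fderivWithin_spatialTaylor_center {R : ℝ} (hT : Tm < Tp) (hR : 0 < R) (hD : IsOpen D)
    {f : SpaceTime → F} (hf : ContDiffOn ℝ 2 f D) (hr : ContDiffOn ℝ 2 r (Icc Tm Tp))
    (hrD : ∀ t ∈ Icc Tm Tp, (t, r t) ∈ D) {t : ℝ} (ht : t ∈ Icc Tm Tp) :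
    fderivWithin ℝ (spatialTaylor f r) (tube Tm Tp r R) (t, r t) = fderiv ℝ f (t, r t) := by
  have hp := center_mem_tube (r := r) hR ht
  have hfst : MapsTo (Prod.fst : SpaceTime → ℝ) (tube Tm Tp r R) (Icc Tm Tp) := fun p hp => hp.1
  have a1 : HasFDerivWithinAt (fun p : SpaceTime => f (p.1, r p.1))
      ((ContinuousLinearMap.toSpanSingleton ℝ (fderiv ℝ f (t, r t) (1, vel Tm Tp r t))).comp
        (ContinuousLinearMap.fst ℝ ℝ E3)) (tube Tm Tp r R) (t, r t) :=
    HasFDerivWithinAt.comp (g := fun t => f (t, r t)) (f := Prod.fst) (t, r t)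
      (hasDerivWithinAt_graph hD hf hr hrD ht).hasFDerivWithinAt hasFDerivWithinAt_fst hfst
  have a2 : HasFDerivWithinAt (fun p : SpaceTime => r p.1)
      ((ContinuousLinearMap.toSpanSingleton ℝ (vel Tm Tp r t)).comp
        (ContinuousLinearMap.fst ℝ ℝ E3)) (tube Tm Tp r R) (t, r t) :=
    ((hr.differentiableOn (by norm_num) t ht).hasDerivWithinAt).hasFDerivWithinAt.comp (t, r t)
      hasFDerivWithinAt_fst hfst
  have a3 : HasFDerivWithinAt (fun p : SpaceTime => ((0, p.2 - r p.1) : SpaceTime))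
      ((0 : SpaceTime →L[ℝ] ℝ).prod (ContinuousLinearMap.snd ℝ ℝ E3 -
        (ContinuousLinearMap.toSpanSingleton ℝ (vel Tm Tp r t)).comp
        (ContinuousLinearMap.fst ℝ ℝ E3))) (tube Tm Tp r R) (t, r t) :=
    (hasFDerivWithinAt_const (0 : ℝ) (t, r t) _).prodMk (hasFDerivWithinAt_snd.sub a2)
  have a4 : DifferentiableWithinAt ℝ (fun p : SpaceTime => fderiv ℝ f (p.1, r p.1))
      (tube Tm Tp r R) (t, r t) :=
    ((contDiffOn_fderiv_graph hD hf hr hrD).comp contDiffOn_fst hfst).differentiableOn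
      (by norm_num) _ hp
  have a5 := (a1.fun_add (a4.hasFDerivWithinAt.clm_apply a3)).fderivWithin
    (uniqueDiffOn_tube hT hr hR _ hp)
  have e : spatialTaylor f r = fun p : SpaceTime =>
    f (p.1, r p.1) + fderiv ℝ f (p.1, r p.1) (0, p.2 - r p.1) := rfl
  rw [e, a5]
  refine ContinuousLinearMap.ext fun h => ?_
  have hsplit : h = h.1 • ((1, vel Tm Tp r t) : SpaceTime) + (0, h.2 - h.1 • vel Tm Tp r t) := by
    ext <;> simp
  have h1 : fderiv ℝ f (t, r t) h = h.1 • fderiv ℝ f (t, r t) (1, vel Tm Tp r t) +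
      fderiv ℝ f (t, r t) (0, h.2 - h.1 • vel Tm Tp r t) := by
    rw [← map_smul, ← map_add, ← hsplit]
  rw [h1]
  simp [Prod.mk_zero_zero]

/-- A continuous function on a tube that vanishes on the trajectory is uniformly small on thin
tubes. -/
theorem eventually_norm_lt_of_center_eq_zero {R₀ : ℝ} (hrc : ContinuousOn r (Icc Tm Tp))
    {G : Type*} [NormedAddCommGroup G] {g : SpaceTime → G}
    (hg : ContinuousOn g (tube Tm Tp r R₀)) (h0 : ∀ t ∈ Icc Tm Tp, g (t, r t) = 0)
    {R : ℕ → ℝ} (hRp : ∀ n, 0 < R n) (hRle : ∀ n, R n ≤ R₀) (hR : Tendsto R atTop (𝓝 0))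
    {ε : ℝ} (hε : 0 < ε) : ∀ᶠ n in atTop, ∀ p ∈ tube Tm Tp r (R n), ‖g p‖ < ε := by
  have hu := (isCompact_tube (R := R₀) hrc).uniformContinuousOn_of_continuous hg
  obtain ⟨δ, hδ, h⟩ := Metric.uniformContinuousOn_iff.1 hu ε hε
  filter_upwards [hR.eventually (gt_mem_nhds hδ)] with n hn p hp
  have h1 := h p (tube_mono (hRle n) hp) (p.1, r p.1)
    (center_mem_tube ((hRp n).trans_le (hRle n)) hp.1) ?_
  · rwa [h0 _ hp.1, dist_zero_right] at h1
  · rw [Prod.dist_eq, dist_self, dist_eq_norm]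
    exact max_lt hδ (hp.2.trans_lt hn)

theorem exists_tube_subset (hD : IsOpen D) (hrc : ContinuousOn r (Icc Tm Tp))
    (hrD : ∀ t ∈ Icc Tm Tp, (t, r t) ∈ D) : ∃ R₀ : ℝ, 0 < R₀ ∧ tube Tm Tp r R₀ ⊆ D := by
  have hc : IsCompact ((fun t => ((t, r t) : SpaceTime)) '' Icc Tm Tp) :=
    isCompact_Icc.image_of_continuousOn (continuousOn_id.prodMk hrc)
  obtain ⟨δ, hδ, h⟩ := hc.exists_cthickening_subset_open hD (image_subset_iff.2 hrD)
  refine ⟨δ, hδ, fun p hp => h ?_⟩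
  refine Metric.mem_cthickening_of_dist_le p (p.1, r p.1) δ _ ⟨p.1, hp.1, rfl⟩ ?_
  rw [Prod.dist_eq, dist_self, dist_eq_norm]
  exact max_le hδ.le hp.2

section Fixed

variable {R₀ : ℝ} {R : ℕ → ℝ}

theorem fderivWithin_tube_eq_fderiv (hT : Tm < Tp) (hR₀ : 0 < R₀) (hD : IsOpen D)
    (hRD : tube Tm Tp r R₀ ⊆ D) {f : SpaceTime → F} (hf : ContDiffOn ℝ 1 f D)
    (hr : ContDiffOn ℝ 2 r (Icc Tm Tp)) {p : SpaceTime} (hp : p ∈ tube Tm Tp r R₀) :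
    fderivWithin ℝ f (tube Tm Tp r R₀) p = fderiv ℝ f p :=
  ((hf.differentiableOn (by norm_num) _ (hRD hp)).differentiableAt
    (hD.mem_nhds (hRD hp))).fderivWithin (uniqueDiffOn_tube hT hr hR₀ p hp)

/-- In thin tubes, `f` is approximated to first order by its spatial expansion: the difference and
its derivative are continuous and vanish on the trajectory. -/
theorem eventually_approx_spatialTaylor (hT : Tm < Tp) (hD : IsOpen D)
    (hRD : tube Tm Tp r R₀ ⊆ D) {f : SpaceTime → F} (hf : ContDiffOn ℝ 2 f D)
    (hr : ContDiffOn ℝ 2 r (Icc Tm Tp)) (hrD : ∀ t ∈ Icc Tm Tp, (t, r t) ∈ D)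
    (hRp : ∀ n, 0 < R n) (hRle : ∀ n, R n ≤ R₀) (hR : Tendsto R atTop (𝓝 0)) {ε : ℝ}
    (hε : 0 < ε) : ∀ᶠ n in atTop, ∀ p ∈ tube Tm Tp r (R n),
      ‖f p - spatialTaylor f r p‖ + ‖fderivWithin ℝ f (tube Tm Tp r (R n)) p -
        fderivWithin ℝ (spatialTaylor f r) (tube Tm Tp r (R n)) p‖ < ε := by
  have hR₀ : 0 < R₀ := (hRp 0).trans_le (hRle 0)
  have hΩ := uniqueDiffOn_tube hT hr hR₀
  have hf1 : ContDiffOn ℝ 1 f D := hf.of_le (by norm_num)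
  have c1 : ContDiffOn ℝ 1 f (tube Tm Tp r R₀) := hf1.mono hRD
  have c2 : ContDiffOn ℝ 1 (spatialTaylor f r) (tube Tm Tp r R₀) :=
    contDiffOn_spatialTaylor hD hf hr hrD
  have e1 := eventually_norm_lt_of_center_eq_zero hr.continuousOn
    (c1.continuousOn.fun_sub c2.continuousOn)
    (fun t _ => by simp [spatialTaylor, Prod.mk_zero_zero]) hRp hRle hR (half_pos hε)
  have e2 := eventually_norm_lt_of_center_eq_zero hr.continuousOn
    ((c1.continuousOn_fderivWithin hΩ (by norm_num)).fun_sub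
      (c2.continuousOn_fderivWithin hΩ (by norm_num)))
    (fun t ht => by
      rw [fderivWithin_spatialTaylor_center hT hR₀ hD hf hr hrD ht,
        fderivWithin_tube_eq_fderiv hT hR₀ hD hRD hf1 hr (center_mem_tube hR₀ ht), sub_self])
    hRp hRle hR (half_pos hε)
  filter_upwards [e1, e2] with n h1 h2 p hp
  rw [fderivWithin_tube_eq hT hr (hRp n) (hRle n) (c1.differentiableOn (by norm_num)) hp,
    fderivWithin_tube_eq hT hr (hRp n) (hRle n) (c2.differentiableOn (by norm_num)) hp]
  linarith [h1 p hp, h2 p hp]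

theorem exists_bound_on_tubes (hT : Tm < Tp) (hRD : tube Tm Tp r R₀ ⊆ D) {f : SpaceTime → F}
    (hf : ContDiffOn ℝ 2 f D) (hr : ContDiffOn ℝ 2 r (Icc Tm Tp)) (hRp : ∀ n, 0 < R n)
    (hRle : ∀ n, R n ≤ R₀) : ∃ C : ℝ, ∀ n, ∀ p ∈ tube Tm Tp r (R n),
      ‖f p‖ ≤ C ∧ ‖fderivWithin ℝ f (tube Tm Tp r (R n)) p‖ ≤ C := by
  have hR₀ : 0 < R₀ := (hRp 0).trans_le (hRle 0)
  have c1 : ContDiffOn ℝ 1 f (tube Tm Tp r R₀) := (hf.mono hRD).of_le (by norm_num)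
  have hc := isCompact_tube (R := R₀) hr.continuousOn
  obtain ⟨C, hC⟩ := hc.exists_bound_of_continuousOn c1.continuousOn
  obtain ⟨C', hC'⟩ := hc.exists_bound_of_continuousOn
    (c1.continuousOn_fderivWithin (uniqueDiffOn_tube hT hr hR₀) (by norm_num))
  refine ⟨max C C', fun n p hp => ⟨(hC p (tube_mono (hRle n) hp)).trans (le_max_left _ _), ?_⟩⟩
  rw [fderivWithin_tube_eq hT hr (hRp n) (hRle n) (c1.differentiableOn (by norm_num)) hp]
  exact (hC' p (tube_mono (hRle n) hp)).trans (le_max_right _ _)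

/-- Fixed potentials are localized in thin tubes, with their linear part as the limit. -/
theorem localizedNLS_linearPart (hT : Tm < Tp) (hD : IsOpen D) (hRD : tube Tm Tp r R₀ ⊆ D)
    (hφ : ContDiffOn ℝ 2 φ D) (hA : ContDiffOn ℝ 2 A D) (hr : ContDiffOn ℝ 2 r (Icc Tm Tp))
    (hrD : ∀ t ∈ Icc Tm Tp, (t, r t) ∈ D) {a : ℕ → ℝ} (ha : ∀ n, 0 < a n)
    (ha0 : Tendsto a atTop (𝓝 0)) (hRp : ∀ n, 0 < R n) (hRle : ∀ n, R n ≤ R₀)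
    (hR : Tendsto R atTop (𝓝 0)) (hratio : Tendsto (fun n => R n / a n) atTop atTop) :
    LocalizedNLS Tm Tp r a R (fun _ => φ) (fun _ => A) (linearPart φ A r) := by
  have l0 := contDiffOn_linearPart_φ₀ (A := A) hφ hr hrD
  have l1 := contDiffOn_linearPart_φ₁ (A := A) hD hφ hr hrD
  have m0 := contDiffOn_linearPart_A₀ (φ := φ) hA hr hrD
  have m1 := contDiffOn_linearPart_A₁ (φ := φ) hD hA hr hrD
  have hU := uniqueDiffOn_Icc hT
  refine ⟨ha, hRp, ha0, hR, hratio, ⟨l0.differentiableOn (by norm_num),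
    l1.differentiableOn (by norm_num), m0.differentiableOn (by norm_num),
    m1.differentiableOn (by norm_num)⟩, ?_, fun n => hφ.mono ((tube_mono (hRle n)).trans hRD),
    fun n => hA.mono ((tube_mono (hRle n)).trans hRD), fun ε hε => ?_, fun ε hε => ?_, ?_, ?_⟩
  · have hb : ∀ {G : Type} [NormedAddCommGroup G] {f : ℝ → G}, ContinuousOn f (Icc Tm Tp) →
        ∃ C, ∀ t ∈ Icc Tm Tp, ‖f t‖ ≤ C := fun hf => isCompact_Icc.exists_bound_of_continuousOn hf
    obtain ⟨C1, h1⟩ := hb l0.continuousOn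
    obtain ⟨C2, h2⟩ := hb (l0.continuousOn_derivWithin hU (by norm_num))
    obtain ⟨C3, h3⟩ := hb l1.continuousOn
    obtain ⟨C4, h4⟩ := hb m0.continuousOn
    obtain ⟨C5, h5⟩ := hb (m0.continuousOn_derivWithin hU (by norm_num))
    obtain ⟨C6, h6⟩ := hb m1.continuousOn
    refine ⟨max C1 (max C2 (max C3 (max C4 (max C5 C6)))), fun t ht =>
      ⟨(h1 t ht).trans ?_, (h2 t ht).trans ?_, (h3 t ht).trans ?_, (h4 t ht).trans ?_,
        (h5 t ht).trans ?_, (h6 t ht).trans ?_⟩⟩ <;> simp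
  · rw [linearPart_phi_eq]
    exact eventually_approx_spatialTaylor hT hD hRD hφ hr hrD hRp hRle hR hε
  · rw [linearPart_vec_eq]
    exact eventually_approx_spatialTaylor hT hD hRD hA hr hrD hRp hRle hR hε
  · exact exists_bound_on_tubes hT hRD hφ hr hRp hRle
  · exact exists_bound_on_tubes hT hRD hA hr hRp hRle

end Fixed

/-- On the trajectory, the electric field of the potentials is that of their linear part. -/
theorem electricField_center {R : ℝ} (K : NLSParams) (hT : Tm < Tp) (hR : 0 < R) (hD : IsOpen D)
    (hRD : tube Tm Tp r R ⊆ D) (hφ : ContDiffOn ℝ 2 φ D) (hA : ContDiffOn ℝ 2 A D)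
    (hr : ContDiffOn ℝ 2 r (Icc Tm Tp)) (hrD : ∀ t ∈ Icc Tm Tp, (t, r t) ∈ D)
    {t : ℝ} (ht : t ∈ Icc Tm Tp) :
    electricField K (tube Tm Tp r R) φ A (t, r t) = (linearPart φ A r).elec K Tm Tp r t := by
  have hp := center_mem_tube (r := r) hR ht
  have e0 : derivWithin (linearPart φ A r).A₀ (Icc Tm Tp) t =
      fderiv ℝ A (t, r t) (1, vel Tm Tp r t) :=
    (hasDerivWithinAt_graph hD hA hr hrD ht).derivWithin (uniqueDiffOn_Icc hT t ht)
  rw [LinearPotentials.elec_eq _ K hT hr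
    ((contDiffOn_linearPart_A₀ hA hr hrD).of_le (by norm_num))
    (contDiffOn_linearPart_A₁ hD hA hr hrD) ht, e0]
  have e1 : (linearPart φ A r).A₁ t (vel Tm Tp r t) = fderiv ℝ A (t, r t) (0, vel Tm Tp r t) := by
    simp [linearPart]
  rw [e1, ← map_sub]
  ext i
  simp only [electricField, dX, dT]
  rw [fderivWithin_tube_eq_fderiv hT hR hD hRD (hφ.of_le (by norm_num)) hr hp,
    fderivWithin_tube_eq_fderiv hT hR hD hRD (hA.of_le (by norm_num)) hr hp]
  simp [linearPart]

theorem magneticField_center {R : ℝ} (hT : Tm < Tp) (hR : 0 < R) (hD : IsOpen D)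
    (hRD : tube Tm Tp r R ⊆ D) (hA : ContDiffOn ℝ 2 A D)
    (hr : ContDiffOn ℝ 2 r (Icc Tm Tp)) {t : ℝ} (ht : t ∈ Icc Tm Tp) :
    magneticField (tube Tm Tp r R) A (t, r t) = (linearPart φ A r).magn t := by
  have hp := center_mem_tube (r := r) hR ht
  simp only [magneticField, dX, LinearPotentials.magn, curlLin, linearPart]
  rw [fderivWithin_tube_eq_fderiv hT hR hD hRD (hA.of_le (by norm_num)) hr hp]
  simp

/-! ### The potentials of the wave-corpuscle -/

/-- Linear potentials with the same fields on the trajectory as `L`, whose vector potential has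
only an antisymmetric linear part `y ↦ ½ B × y`; the coefficient `φ₁` is then determined by the
electric field. The quadratic form of `A₁` vanishes, so that the phase of the wave-corpuscle is `C²`
without a second derivative of `L.A₁`. -/
def antisymmetrized (L : LinearPotentials) (K : NLSParams) (Tm Tp : ℝ) (r : ℝ → E3) :
    LinearPotentials where
  φ₀ := L.φ₀
  φ₁ t := -L.elec K Tm Tp r t -
    K.c⁻¹ • (derivWithin L.A₀ (Icc Tm Tp) t - ((1 / 2 : ℝ) • crossL (L.magn t)) (vel Tm Tp r t))
  A₀ := L.A₀
  A₁ t := (1 / 2 : ℝ) • crossL (L.magn t)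

theorem curlLin_half_crossL (B : E3) : curlLin ((1 / 2 : ℝ) • crossL B) = B := by
  ext i
  fin_cases i <;> simp [curlLin, crossL_apply, cross, crossProduct] <;> ring

theorem inner_crossL_self (B y : E3) : inner ℝ y (crossL B y) = 0 := by
  simp [crossL_apply, cross, crossProduct, PiLp.inner_apply, Fin.sum_univ_three]
  ring

/-- Newton's law improves the regularity of the trajectory by one order. -/
theorem contDiffOn_two_vel {K : NLSParams} (hT : Tm < Tp) (hr : ContDiffOn ℝ 2 r (Icc Tm Tp))
    {E B : ℝ → E3} (hE : ContDiffOn ℝ 1 E (Icc Tm Tp)) (hB : ContDiffOn ℝ 1 B (Icc Tm Tp))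
    (hN : ∀ t ∈ Icc Tm Tp, K.m • acc Tm Tp r t =
      K.q • E t + (K.q / K.c) • cross (vel Tm Tp r t) (B t)) :
    ContDiffOn ℝ 2 (vel Tm Tp r) (Icc Tm Tp) := by
  have hv := contDiffOn_vel hT hr
  have h2 : (2 : WithTop ℕ∞) = 1 + 1 := by norm_num
  rw [h2, contDiffOn_succ_iff_derivWithin (uniqueDiffOn_Icc hT)]
  refine ⟨hv.differentiableOn (by norm_num), by simp, ?_⟩
  have h3 : ContDiffOn ℝ 1 (fun t => K.m⁻¹ • (K.q • E t +
      (K.q / K.c) • cross (vel Tm Tp r t) (B t))) (Icc Tm Tp) :=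
    ((hE.const_smul K.q).add ((hv.cross hB).const_smul (K.q / K.c))).const_smul K.m⁻¹
  refine h3.congr fun t ht => ?_
  rw [← hN t ht, smul_smul, inv_mul_cancel₀ K.m_pos.ne', one_smul]
  rfl

end LinearPart

/-! ### Densities of a wave function in polar form -/

section Polar

variable {K : NLSParams} {Ω : Set SpaceTime} {φ : SpaceTime → ℝ} {A : SpaceTime → E3}
  {σ u : SpaceTime → ℝ}

/-- The wave function `u e^{iσ}` with real amplitude `u` and phase `σ`. -/
def polar (σ u : SpaceTime → ℝ) (p : SpaceTime) : ℂ :=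
  Complex.exp (Complex.I * (σ p : ℂ)) * ((u p : ℝ) : ℂ)

/-- The kinetic momentum `χ ∇σ - (q/c) A` of a wave function with phase `σ`. -/
def kineticMomentum (K : NLSParams) (Ω : Set SpaceTime) (A : SpaceTime → E3) (σ : SpaceTime → ℝ)
    (p : SpaceTime) : E3 :=
  WithLp.toLp 2 fun i => K.χ * dX Ω σ i p - K.q / K.c * A p i

theorem contDiffOn_polar {n : WithTop ℕ∞} (hσ : ContDiffOn ℝ n σ Ω) (hu : ContDiffOn ℝ n u Ω) :
    ContDiffOn ℝ n (polar σ u) Ω :=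
  (contDiffOn_const.mul hσ.ofReal_complex).cexp.mul hu.ofReal_complex

theorem contDiffOn_kineticMomentum (hΩ : UniqueDiffOn ℝ Ω) (hA : ContDiffOn ℝ 2 A Ω)
    (hσ : ContDiffOn ℝ 2 σ Ω) : ContDiffOn ℝ 1 (kineticMomentum K Ω A σ) Ω :=
  contDiffOn_euclidean.2 fun i => (contDiffOn_const.mul (contDiffOn_dX hΩ hσ (by norm_num) i)).sub
    (contDiffOn_const.mul ((hA.coord i).of_le (by norm_num)))

theorem norm_exp_I_mul (x : ℝ) : ‖Complex.exp (Complex.I * x)‖ = 1 := by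
  rw [mul_comm]; exact Complex.norm_exp_ofReal_mul_I x

theorem conj_exp_mul_exp (x : ℝ) :
    starRingEnd ℂ (Complex.exp (Complex.I * x)) * Complex.exp (Complex.I * x) = 1 := by
  rw [Complex.conj_mul', norm_exp_I_mul]; simp

theorem fderivWithin_polar (hΩ : UniqueDiffOn ℝ Ω) (hσ : DifferentiableOn ℝ σ Ω)
    (hu : DifferentiableOn ℝ u Ω) {p : SpaceTime} (hp : p ∈ Ω) (h : SpaceTime) :
    fderivWithin ℝ (polar σ u) Ω p h = Complex.exp (Complex.I * (σ p : ℂ)) *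
      ((fderivWithin ℝ u Ω p h : ℂ) + Complex.I * (fderivWithin ℝ σ Ω p h : ℂ) * (u p : ℂ)) := by
  have h1 : HasFDerivWithinAt (fun p => (σ p : ℂ))
      (Complex.ofRealCLM.comp (fderivWithin ℝ σ Ω p)) Ω p :=
    Complex.ofRealCLM.hasFDerivAt.comp_hasFDerivWithinAt p (hσ p hp).hasFDerivWithinAt
  have h2 : HasFDerivWithinAt (fun p => (u p : ℂ))
      (Complex.ofRealCLM.comp (fderivWithin ℝ u Ω p)) Ω p :=
    Complex.ofRealCLM.hasFDerivAt.comp_hasFDerivWithinAt p (hu p hp).hasFDerivWithinAt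
  have h3 := ((h1.const_mul Complex.I).cexp.mul h2).fderivWithin (hΩ p hp)
  have e : polar σ u = (fun p => Complex.exp (Complex.I * (σ p : ℂ))) * fun p => (u p : ℂ) := rfl
  rw [e, h3]
  simp
  ring

theorem chargeDensity_polar (p : SpaceTime) : chargeDensity K (polar σ u) p = K.q * u p ^ 2 := by
  simp only [chargeDensity, polar]
  rw [norm_mul, norm_exp_I_mul, one_mul, Complex.norm_real, Real.norm_eq_abs, sq_abs]

theorem covX_polar (hΩ : UniqueDiffOn ℝ Ω) (hσ : DifferentiableOn ℝ σ Ω)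
    (hu : DifferentiableOn ℝ u Ω) {p : SpaceTime} (hp : p ∈ Ω) (i : Fin 3) :
    covX K Ω A (polar σ u) i p = Complex.exp (Complex.I * (σ p : ℂ)) *
      (((dX Ω u i p : ℝ) : ℂ) +
        Complex.I * ((K.χ⁻¹ * kineticMomentum K Ω A σ p i : ℝ) : ℂ) * (u p : ℂ)) := by
  have e : K.χ⁻¹ * kineticMomentum K Ω A σ p i = dX Ω σ i p - K.q / (K.χ * K.c) * A p i := by
    have := K.χ_pos.ne'
    have := K.c_pos.ne'
    simp only [kineticMomentum]
    field_simp
  rw [e]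
  simp only [covX, dX, fderivWithin_polar hΩ hσ hu hp, polar]
  push_cast
  ring

theorem covT_polar (hΩ : UniqueDiffOn ℝ Ω) (hσ : DifferentiableOn ℝ σ Ω)
    (hu : DifferentiableOn ℝ u Ω) {p : SpaceTime} (hp : p ∈ Ω) :
    covT K Ω φ (polar σ u) p = Complex.exp (Complex.I * (σ p : ℂ)) *
      (((dT Ω u p : ℝ) : ℂ) + Complex.I * ((dT Ω σ p + K.q / K.χ * φ p : ℝ) : ℂ) * (u p : ℂ)) := by
  simp only [covT, dT, fderivWithin_polar hΩ hσ hu hp, polar]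
  push_cast
  ring

theorem im_conj_mul_phase {x a b y : ℝ} :
    (starRingEnd ℂ (Complex.exp (Complex.I * (x : ℂ)) * (y : ℂ)) *
      (Complex.exp (Complex.I * (x : ℂ)) * ((a : ℂ) + Complex.I * (b : ℂ) * (y : ℂ)))).im =
      b * y ^ 2 := by
  have : starRingEnd ℂ (Complex.exp (Complex.I * (x : ℂ)) * (y : ℂ)) *
      (Complex.exp (Complex.I * (x : ℂ)) * ((a : ℂ) + Complex.I * (b : ℂ) * (y : ℂ))) =
      (y : ℂ) * ((a : ℂ) + Complex.I * (b : ℂ) * (y : ℂ)) := by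
    rw [map_mul, Complex.conj_ofReal]
    linear_combination (y : ℂ) * ((a : ℂ) + Complex.I * (b : ℂ) * (y : ℂ)) * conj_exp_mul_exp x
  rw [this]
  simp
  ring

theorem re_mul_conj_phase {x a a' b b' y : ℝ} :
    (Complex.exp (Complex.I * (x : ℂ)) * ((a : ℂ) + Complex.I * (b : ℂ) * (y : ℂ)) *
      starRingEnd ℂ (Complex.exp (Complex.I * (x : ℂ)) *
        ((a' : ℂ) + Complex.I * (b' : ℂ) * (y : ℂ)))).re = a * a' + b * b' * y ^ 2 := by
  have : Complex.exp (Complex.I * (x : ℂ)) * ((a : ℂ) + Complex.I * (b : ℂ) * (y : ℂ)) *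
      starRingEnd ℂ (Complex.exp (Complex.I * (x : ℂ)) *
        ((a' : ℂ) + Complex.I * (b' : ℂ) * (y : ℂ))) =
      ((a : ℂ) + Complex.I * (b : ℂ) * (y : ℂ)) *
        starRingEnd ℂ ((a' : ℂ) + Complex.I * (b' : ℂ) * (y : ℂ)) := by
    rw [map_mul]
    linear_combination ((a : ℂ) + Complex.I * (b : ℂ) * (y : ℂ)) *
        starRingEnd ℂ ((a' : ℂ) + Complex.I * (b' : ℂ) * (y : ℂ)) * conj_exp_mul_exp x
  rw [this]
  simp
  ring

theorem momentumDensity_polar (hΩ : UniqueDiffOn ℝ Ω) (hσ : DifferentiableOn ℝ σ Ω)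
    (hu : DifferentiableOn ℝ u Ω) {p : SpaceTime} (hp : p ∈ Ω) :
    momentumDensity K Ω A (polar σ u) p = u p ^ 2 • kineticMomentum K Ω A σ p := by
  ext i
  simp only [momentumDensity, covX_polar hΩ hσ hu hp, PiLp.smul_apply, smul_eq_mul]
  rw [polar, im_conj_mul_phase, ← mul_assoc, ← mul_assoc, mul_inv_cancel₀ K.χ_pos.ne', one_mul,
    mul_comm]

/-- The stress of a wave function in polar form: the nonlinear term and a quadratic form in `∇u` and
`u`, whose coefficients depend on the derivatives of the phase and on the potentials. -/
theorem stress_polar (hΩ : UniqueDiffOn ℝ Ω) (hσ : DifferentiableOn ℝ σ Ω)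
    (hu : DifferentiableOn ℝ u Ω) {p : SpaceTime} (hp : p ∈ Ω) (G : ℝ → ℝ) (i j : Fin 3) :
    stress K Ω G φ A (polar σ u) i j p =
      K.χ ^ 2 / K.m * (dX Ω u i p * dX Ω u j p + K.χ⁻¹ * kineticMomentum K Ω A σ p i *
        (K.χ⁻¹ * kineticMomentum K Ω A σ p j) * u p ^ 2) -
      if i = j then
        K.χ ^ 2 / (2 * K.m) * (∑ k, (dX Ω u k p ^ 2 +
          (K.χ⁻¹ * kineticMomentum K Ω A σ p k) ^ 2 * u p ^ 2) + G (u p ^ 2)) +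
        K.χ * ((dT Ω σ p + K.q / K.χ * φ p) * u p ^ 2)
      else 0 := by
  have h1 : ∀ k, ‖covX K Ω A (polar σ u) k p‖ ^ 2 = dX Ω u k p ^ 2 +
      (K.χ⁻¹ * kineticMomentum K Ω A σ p k) ^ 2 * u p ^ 2 := fun k => by
    have h := Complex.mul_conj' (covX K Ω A (polar σ u) k p)
    have h' := congrArg Complex.re h
    rw [← Complex.ofReal_pow, Complex.ofReal_re] at h'
    rw [← h', covX_polar hΩ hσ hu hp, re_mul_conj_phase]
    ring
  have h2 : ‖polar σ u p‖ ^ 2 = u p ^ 2 := by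
    simp only [polar]
    rw [norm_mul, norm_exp_I_mul, one_mul, Complex.norm_real, Real.norm_eq_abs, sq_abs]
  have h3 : (starRingEnd ℂ (polar σ u p) * covT K Ω φ (polar σ u) p).im =
      (dT Ω σ p + K.q / K.χ * φ p) * u p ^ 2 := by
    rw [covT_polar hΩ hσ hu hp, polar, im_conj_mul_phase]
  simp only [stress, energyDensity, h1, h2, h3]
  rw [covX_polar hΩ hσ hu hp, covX_polar hΩ hσ hu hp, re_mul_conj_phase]

end Polar

/-! ### Phase and amplitude of the wave-corpuscle -/

section Corpuscle

variable {K : NLSParams} {Tm Tp R : ℝ} {r : ℝ → E3} {W : LinearPotentials} {ψ₁ : ℝ → ℝ} {a : ℝ}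

/-- The phase of the wave-corpuscle as a function on space-time. -/
def corpusclePhase (K : NLSParams) (Tm Tp : ℝ) (r : ℝ → E3) (W : LinearPotentials)
    (p : SpaceTime) : ℝ :=
  wavePhase K Tm Tp r W p.1 (p.2 - r p.1)

/-- The amplitude `a^{-3/2} ψ₁(a⁻¹ |x - r(t)|)` of the wave-corpuscle. -/
def corpuscleAmplitude (r : ℝ → E3) (ψ₁ : ℝ → ℝ) (a : ℝ) (p : SpaceTime) : ℝ :=
  a ^ (-(3 / 2) : ℝ) * ψ₁ (a⁻¹ * ‖p.2 - r p.1‖)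

/-- Only the quadratic form of `A₁` enters the phase: it may be replaced by any `S₁` with the same
quadratic form, and `S₁` carries the regularity. -/
theorem contDiffOn_corpusclePhase (hT : Tm < Tp) (hr : ContDiffOn ℝ 2 r (Icc Tm Tp))
    (hv : ContDiffOn ℝ 2 (vel Tm Tp r) (Icc Tm Tp)) (h₀ : ContDiffOn ℝ 1 W.φ₀ (Icc Tm Tp))
    (hA₀ : ContDiffOn ℝ 2 W.A₀ (Icc Tm Tp)) {S₁ : ℝ → E3 →L[ℝ] E3}
    (hS : ContDiffOn ℝ 2 S₁ (Icc Tm Tp))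
    (hSA : ∀ t ∈ Icc Tm Tp, ∀ y, inner ℝ y (W.A₁ t y) = inner ℝ y (S₁ t y)) :
    ContDiffOn ℝ 2 (corpusclePhase K Tm Tp r W) (tube Tm Tp r R) := by
  have hfst : MapsTo (Prod.fst : SpaceTime → ℝ) (tube Tm Tp r R) (Icc Tm Tp) := fun p hp => hp.1
  have hc : ∀ {G : Type} [NormedAddCommGroup G] [NormedSpace ℝ G] {f : ℝ → G},
      ContDiffOn ℝ 2 f (Icc Tm Tp) →
      ContDiffOn ℝ 2 (fun p : SpaceTime => f p.1) (tube Tm Tp r R) :=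
    fun hf => hf.comp contDiffOn_fst hfst
  have hy : ContDiffOn ℝ 2 (fun p : SpaceTime => p.2 - r p.1) (tube Tm Tp r R) :=
    contDiffOn_snd.sub (hc hr)
  have hv1 : ContDiffOn ℝ 1 (vel Tm Tp r) (Icc Tm Tp) := hv.of_le (by norm_num)
  have hA1 : ContDiffOn ℝ 1 W.A₀ (Icc Tm Tp) := hA₀.of_le (by norm_num)
  have hI : ContDiffOn ℝ ((1 : ℕ) : WithTop ℕ∞) (fun s => K.m / 2 * ‖vel Tm Tp r s‖ ^ 2 +
      K.q / K.c * inner ℝ (vel Tm Tp r s) (W.A₀ s) - K.q * W.φ₀ s) (Icc Tm Tp) :=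
    ((contDiffOn_const.mul (hv1.norm_sq ℝ)).add (contDiffOn_const.mul (hv1.inner ℝ hA1))).sub
      (contDiffOn_const.mul h₀)
  have hP := contDiffOn_primitive hT hI (left_mem_Icc.2 hT.le)
  have h1 := ((((contDiffOn_const (c := K.m)).mul ((hc hv).inner ℝ hy)).add
    ((contDiffOn_const (c := K.q / K.c)).mul (hy.inner ℝ (hc hA₀)))).add (hc hP)).add
    ((contDiffOn_const (c := K.q / (2 * K.c))).mul (hy.inner ℝ ((hc hS).clm_apply hy)))
  refine ((contDiffOn_const (c := K.χ⁻¹)).mul h1).congr fun p hp => ?_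
  simp only [corpusclePhase, wavePhase, hSA _ hp.1]

theorem corpuscleAmplitude_eq (ha : 0 < a) (p : SpaceTime) : corpuscleAmplitude r ψ₁ a p =
    a ^ (-(3 / 2) : ℝ) * ψ₁ ‖a⁻¹ • (p.2 - r p.1)‖ := by
  rw [norm_smul, norm_inv, Real.norm_of_nonneg ha.le, corpuscleAmplitude]

theorem contDiffOn_corpuscleAmplitude (ha : 0 < a) (hψ : ContDiff ℝ 2 (fun x : E3 => ψ₁ ‖x‖))
    (hr : ContDiffOn ℝ 2 r (Icc Tm Tp)) :
    ContDiffOn ℝ 2 (corpuscleAmplitude r ψ₁ a) (tube Tm Tp r R) := by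
  have hfst : MapsTo (Prod.fst : SpaceTime → ℝ) (tube Tm Tp r R) (Icc Tm Tp) := fun p hp => hp.1
  have hy : ContDiffOn ℝ 2 (fun p : SpaceTime => a⁻¹ • (p.2 - r p.1)) (tube Tm Tp r R) :=
    (contDiffOn_snd.sub (hr.comp contDiffOn_fst hfst)).const_smul a⁻¹
  exact ((contDiffOn_const (c := a ^ (-(3 / 2) : ℝ))).mul (hψ.comp_contDiffOn hy)).congr
    fun p _ => corpuscleAmplitude_eq ha p

theorem fderivWithin_corpuscleAmplitude (hT : Tm < Tp) (ha : 0 < a) (hR : 0 < R)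
    (hψ : ContDiff ℝ 2 (fun x : E3 => ψ₁ ‖x‖)) (hr : ContDiffOn ℝ 2 r (Icc Tm Tp))
    {p : SpaceTime} (hp : p ∈ tube Tm Tp r R) (h : SpaceTime) :
    fderivWithin ℝ (corpuscleAmplitude r ψ₁ a) (tube Tm Tp r R) p h =
      a ^ (-(3 / 2) : ℝ) * fderiv ℝ (fun x : E3 => ψ₁ ‖x‖) (a⁻¹ • (p.2 - r p.1))
        (a⁻¹ • (h.2 - h.1 • vel Tm Tp r p.1)) := by
  have hfst : MapsTo (Prod.fst : SpaceTime → ℝ) (tube Tm Tp r R) (Icc Tm Tp) := fun p hp => hp.1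
  have a2 : HasFDerivWithinAt (fun p : SpaceTime => r p.1)
      ((ContinuousLinearMap.toSpanSingleton ℝ (vel Tm Tp r p.1)).comp
        (ContinuousLinearMap.fst ℝ ℝ E3)) (tube Tm Tp r R) p :=
    HasFDerivWithinAt.comp (g := r) (f := Prod.fst) p
      ((hr.differentiableOn (by norm_num) p.1 hp.1).hasDerivWithinAt).hasFDerivWithinAt
      hasFDerivWithinAt_fst hfst
  have a3 := (hasFDerivWithinAt_snd.fun_sub a2).const_smul a⁻¹
  have a4 : HasFDerivAt (fun x : E3 => ψ₁ ‖x‖)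
      (fderiv ℝ (fun x : E3 => ψ₁ ‖x‖) (a⁻¹ • (p.2 - r p.1))) (a⁻¹ • (p.2 - r p.1)) :=
    (hψ.differentiable (by norm_num) _).hasFDerivAt
  have a5 := (a4.comp_hasFDerivWithinAt p a3).const_mul (a ^ (-(3 / 2) : ℝ))
  have e : corpuscleAmplitude r ψ₁ a = fun q : SpaceTime =>
      a ^ (-(3 / 2) : ℝ) * ((fun x : E3 => ψ₁ ‖x‖) ∘ fun q : SpaceTime =>
        a⁻¹ • (q.2 - r q.1)) q := funext fun q => corpuscleAmplitude_eq ha q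
  rw [e]
  erw [a5.fderivWithin (uniqueDiffOn_tube hT hr hR p hp)]
  simp

/-- The phase gradient at the center of the wave-corpuscle is that of a particle with velocity
`∂_t r`. -/
theorem kineticMomentum_center {A : SpaceTime → E3} (hR : 0 < R)
    (hσ : DifferentiableOn ℝ (corpusclePhase K Tm Tp r W) (tube Tm Tp r R)) {t : ℝ}
    (ht : t ∈ Icc Tm Tp) (hA : W.A₀ t = A (t, r t)) :
    kineticMomentum K (tube Tm Tp r R) A (corpusclePhase K Tm Tp r W) (t, r t) =
      K.m • vel Tm Tp r t := by
  ext i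
  set e : E3 := EuclideanSpace.single i 1 with he
  have hne : ‖e‖ = 1 := by simp [he]
  have h1 : HasFDerivWithinAt (corpusclePhase K Tm Tp r W)
      (fderivWithin ℝ (corpusclePhase K Tm Tp r W) (tube Tm Tp r R) (t, r t))
      (tube Tm Tp r R) (t, r t + (0 : ℝ) • e) := by
    rw [zero_smul, add_zero]
    exact (hσ _ (center_mem_tube hR ht)).hasFDerivWithinAt
  have h2 : HasDerivWithinAt (fun s : ℝ => ((t, r t + s • e) : SpaceTime)) (0, e)
      (Icc (-R) R) 0 := by
    refine (hasDerivWithinAt_const _ _ _).prodMk ?_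
    simpa using ((hasDerivWithinAt_id (0 : ℝ) (Icc (-R) R)).smul_const e).const_add (r t)
  have h3 := (h1.comp_hasDerivWithinAt (0 : ℝ) h2 fun s hs => mk_mem_tube ht (by
    rw [norm_smul, hne, mul_one, Real.norm_eq_abs]; exact abs_le.2 hs)).hasDerivAt
    (Icc_mem_nhds (by linarith) hR)
  have h4 : HasDerivAt (fun s : ℝ => corpusclePhase K Tm Tp r W (t, r t + s • e))
      (K.χ⁻¹ * (K.m * inner ℝ (vel Tm Tp r t) e + K.q / K.c * inner ℝ e (W.A₀ t))) 0 := by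
    have e1 : (fun s : ℝ => corpusclePhase K Tm Tp r W (t, r t + s • e)) = fun s =>
        K.χ⁻¹ * (s * (K.m * inner ℝ (vel Tm Tp r t) e + K.q / K.c * inner ℝ e (W.A₀ t)) +
          (∫ s in Tm..t, (K.m / 2 * ‖vel Tm Tp r s‖ ^ 2 +
            K.q / K.c * inner ℝ (vel Tm Tp r s) (W.A₀ s) - K.q * W.φ₀ s)) +
          s ^ 2 * (K.q / (2 * K.c) * inner ℝ e (W.A₁ t e))) := by
      funext s
      simp only [corpusclePhase, wavePhase, add_sub_cancel_left, map_smul, inner_smul_left,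
        inner_smul_right, RCLike.conj_to_real]
      ring
    rw [e1]
    have := ((((hasDerivAt_id (0 : ℝ)).mul_const
      (K.m * inner ℝ (vel Tm Tp r t) e + K.q / K.c * inner ℝ e (W.A₀ t))).add_const
      (∫ s in Tm..t, (K.m / 2 * ‖vel Tm Tp r s‖ ^ 2 +
            K.q / K.c * inner ℝ (vel Tm Tp r s) (W.A₀ s) - K.q * W.φ₀ s))).add
      (((hasDerivAt_id (0 : ℝ)).pow 2).mul_const
        (K.q / (2 * K.c) * inner ℝ e (W.A₁ t e)))).const_mul K.χ⁻¹
    simpa using this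
  have h5 := h3.unique h4
  have h6 : inner ℝ (vel Tm Tp r t) e = vel Tm Tp r t i := by
    simp [he, EuclideanSpace.inner_single_right]
  have h7 : inner ℝ e (W.A₀ t) = W.A₀ t i := by
    simp [he, EuclideanSpace.inner_single_left]
  rw [h6, h7] at h5
  simp only [kineticMomentum, dX, PiLp.smul_apply, smul_eq_mul]
  rw [← he, h5, ← hA]
  have := K.χ_pos.ne'
  field_simp
  ring

end Corpuscle

/-! ### Mass and decay of the form factor -/

section FormFactor

variable {Tm Tp R : ℝ} {r : ℝ → E3} {ψ₁ g₁ : ℝ → ℝ} {a : ℝ}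

theorem IsFormFactor.mass_pos (h : IsFormFactor g₁ ψ₁) : 0 < ∫ x : E3, ψ₁ ‖x‖ ^ 2 := by
  rw [integral_pos_iff_support_of_nonneg (fun x => sq_nonneg _) h.sq_integrable]
  have : Function.support (fun x : E3 => ψ₁ ‖x‖ ^ 2) = univ :=
    eq_univ_of_forall fun x => (pow_pos (h.pos _ (norm_nonneg x)) 2).ne'
  rw [this]
  exact Measure.measure_univ_pos.2 (NeZero.ne _)

theorem rpow_neg_three_halves_sq (ha : 0 < a) : (a ^ (-(3 / 2) : ℝ)) ^ 2 = (a ^ 3)⁻¹ := by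
  rw [← Real.rpow_natCast, ← Real.rpow_mul ha.le, ← Real.rpow_natCast, ← Real.rpow_neg ha.le]
  norm_num

/-- Scaling: the mass of the wave-corpuscle of size `a` in a ball of radius `R` is that of the form
factor in a ball of radius `R / a`. -/
theorem ballIntegral_corpuscleAmplitude_sq (ha : 0 < a) (t : ℝ) :
    ballIntegral r R (fun p => corpuscleAmplitude r ψ₁ a p ^ 2) t =
      ∫ x in Metric.closedBall (0 : E3) (R / a), ψ₁ ‖x‖ ^ 2 := by
  rw [ballIntegral_eq]
  have h1 : ∀ y : E3, corpuscleAmplitude r ψ₁ a (t, r t + y) ^ 2 =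
      (a ^ 3)⁻¹ * (fun x : E3 => ψ₁ ‖x‖ ^ 2) (a⁻¹ • y) := fun y => by
    rw [corpuscleAmplitude_eq ha, mul_pow, rpow_neg_three_halves_sq ha, add_sub_cancel_left]
  simp only [h1]
  rw [integral_const_mul, Measure.setIntegral_comp_smul_of_pos volume (fun x : E3 => ψ₁ ‖x‖ ^ 2)
      _ (inv_pos.2 ha),
    smul_closedBall' (inv_ne_zero ha.ne'), smul_zero, norm_inv, Real.norm_of_nonneg ha.le,
    finrank_euclideanSpace_fin, smul_eq_mul, ← mul_assoc, div_eq_inv_mul]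
  have : (a ^ 3)⁻¹ * (a⁻¹ ^ 3)⁻¹ = 1 := by field_simp
  rw [this, one_mul]

theorem IsFormFactor.setIntegral_le_mass (h : IsFormFactor g₁ ψ₁) (s : Set E3) :
    ∫ x in s, ψ₁ ‖x‖ ^ 2 ≤ ∫ x : E3, ψ₁ ‖x‖ ^ 2 :=
  setIntegral_le_integral h.sq_integrable (Eventually.of_forall fun _ => sq_nonneg _)

theorem IsFormFactor.tendsto_mass (h : IsFormFactor g₁ ψ₁) {θ : ℕ → ℝ}
    (hθ : Tendsto θ atTop atTop) :
    Tendsto (fun n => ∫ x in Metric.closedBall (0 : E3) (θ n), ψ₁ ‖x‖ ^ 2) atTop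
      (𝓝 (∫ x : E3, ψ₁ ‖x‖ ^ 2)) :=
  (aecover_closedBall hθ).integral_tendsto_of_countably_generated h.sq_integrable

/-- By symmetry the first moment of the squared amplitude about the center vanishes. -/
theorem integral_corpuscleAmplitude_sq_smul (t : ℝ) :
    ∫ y in Metric.closedBall (0 : E3) R, corpuscleAmplitude r ψ₁ a (t, r t + y) ^ 2 • y = 0 := by
  set f : E3 → E3 := fun y => corpuscleAmplitude r ψ₁ a (t, r t + y) ^ 2 • y
  have h1 : ∀ y, f (-y) = -f y := fun y => by simp [f, corpuscleAmplitude]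
  have h2 : ∫ y in Metric.closedBall (0 : E3) R, f (-y) =
      ∫ y in Metric.closedBall (0 : E3) R, f y := by
    rw [← integral_indicator Metric.isClosed_closedBall.measurableSet,
      ← integral_indicator Metric.isClosed_closedBall.measurableSet, ← integral_neg_eq_self]
    congr 1
    ext1 y
    simp [indicator]
  simp only [h1, integral_neg] at h2
  have h3 : (2 : ℝ) • ∫ y in Metric.closedBall (0 : E3) R, f y = 0 := by
    rw [two_smul]; nth_rewrite 1 [← h2]; simp
  simpa using h3

/-- Away from the origin the gradient of a radial function is controlled by the radial
derivative. -/
theorem abs_fderiv_radial_le (hψ : ContDiff ℝ 2 (fun x : E3 => ψ₁ ‖x‖)) {z : E3} (hz : z ≠ 0)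
    (h : E3) : |fderiv ℝ (fun x : E3 => ψ₁ ‖x‖) z h| ≤ |deriv ψ₁ ‖z‖| * ‖h‖ := by
  have hz' : 0 < ‖z‖ := norm_pos_iff.2 hz
  have h1 : DifferentiableAt ℝ ψ₁ ‖z‖ := by
    have h2 : DifferentiableAt ℝ (fun s : ℝ => ψ₁ ‖(s * ‖z‖⁻¹) • z‖) ‖z‖ := by
      have h3 : DifferentiableAt ℝ (fun s : ℝ => (s * ‖z‖⁻¹) • z) ‖z‖ := by fun_prop
      exact DifferentiableAt.comp (g := fun x : E3 => ψ₁ ‖x‖) ‖z‖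
        (hψ.differentiable (by norm_num) _) h3
    refine h2.congr_of_eventuallyEq ?_
    filter_upwards [lt_mem_nhds hz'] with s hs
    rw [norm_smul, Real.norm_of_nonneg (mul_nonneg hs.le (inv_nonneg.2 hz'.le)), mul_assoc,
      inv_mul_cancel₀ hz'.ne', mul_one]
  have h4 : HasFDerivAt (fun x : E3 => ‖x‖) (fderiv ℝ (fun x : E3 => ‖x‖) z) z :=
    ((contDiffAt_norm ℝ hz (n := 1)).differentiableAt (by norm_num)).hasFDerivAt
  have h5 := (h1.hasDerivAt.comp_hasFDerivAt z h4).fderiv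
  have h6 : fderiv ℝ (fun x : E3 => ψ₁ ‖x‖) z = deriv ψ₁ ‖z‖ • fderiv ℝ (fun x : E3 => ‖x‖) z := h5
  have h7 : ‖fderiv ℝ (fun x : E3 => ‖x‖) z‖ ≤ 1 := by
    simpa using norm_fderiv_le_of_lipschitz ℝ (lipschitzWith_one_norm (E := E3)) (x₀ := z)
  rw [h6, smul_apply, smul_eq_mul, abs_mul]
  refine mul_le_mul_of_nonneg_left ?_ (abs_nonneg _)
  exact (ContinuousLinearMap.le_opNorm _ h).trans (mul_le_of_le_one_left (norm_nonneg h) h7)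

/-- For size `a = R⁵` the decay of the form factor makes the amplitude and its gradient negligible
on the sphere of radius `R`: their squares are `o(R⁻²)`. -/
theorem FormFactorDecay.eventually_amplitude_le (h : FormFactorDecay ψ₁) :
    ∃ C : ℝ, ∀ᶠ R in 𝓝[>] (0 : ℝ),
      R ^ 2 * ((R ^ 5) ^ (-(3 / 2) : ℝ) * ψ₁ ((R ^ 5)⁻¹ * R)) ^ 2 ≤ C * R ∧
      R ^ 2 * ((R ^ 5) ^ (-(3 / 2) : ℝ) * (|deriv ψ₁ ((R ^ 5)⁻¹ * R)| * (R ^ 5)⁻¹)) ^ 2 ≤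
        C * R := by
  obtain ⟨C₁, h₁⟩ := h.decay
  obtain ⟨C₂, h₂⟩ := h.decay_deriv
  -- the scaled radius `R / R⁵ = R⁻⁴` tends to infinity, where the decay applies
  have hθ : Tendsto (fun R : ℝ => (R ^ 4)⁻¹) (𝓝[>] 0) atTop := by
    refine tendsto_inv_nhdsGT_zero.comp (tendsto_nhdsWithin_iff.2 ⟨?_, ?_⟩)
    · have : Tendsto (fun R : ℝ => R ^ 4) (𝓝 0) (𝓝 (0 ^ 4)) := (continuous_pow 4).tendsto 0
      rw [zero_pow (by norm_num)] at this
      exact this.mono_left nhdsWithin_le_nhds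
    · filter_upwards [self_mem_nhdsWithin] with R hR
      exact pow_pos (mem_Ioi.1 hR) 4
  have hone : ∀ᶠ R : ℝ in 𝓝[>] 0, R < 1 := nhdsWithin_le_nhds (gt_mem_nhds one_pos)
  refine ⟨max (C₁ ^ 2) (C₂ ^ 2), ?_⟩
  filter_upwards [hθ.eventually h₁, hθ.eventually h₂, hone, self_mem_nhdsWithin]
    with R b₁ b₂ hR1 hR
  have hR : 0 < R := hR
  have e : (R ^ 5)⁻¹ * R = (R ^ 4)⁻¹ := by field_simp
  have hR5 : 0 < R ^ 5 := pow_pos hR 5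
  rw [e, mul_pow, mul_pow, rpow_neg_three_halves_sq hR5]
  have c₁ : (((R ^ 4)⁻¹) ^ 2 * |ψ₁ (R ^ 4)⁻¹|) ^ 2 ≤ C₁ ^ 2 :=
    pow_le_pow_left₀ (by positivity) b₁ 2
  have c₂ : (((R ^ 4)⁻¹) ^ 3 * |deriv ψ₁ (R ^ 4)⁻¹|) ^ 2 ≤ C₂ ^ 2 :=
    pow_le_pow_left₀ (by positivity) b₂ 2
  constructor
  · have e₁ : R ^ 2 * (((R ^ 5) ^ 3)⁻¹ * ψ₁ (R ^ 4)⁻¹ ^ 2) =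
        (((R ^ 4)⁻¹) ^ 2 * |ψ₁ (R ^ 4)⁻¹|) ^ 2 * R ^ 3 := by
      rw [mul_pow, sq_abs]; field_simp
    rw [e₁]
    refine mul_le_mul (c₁.trans (le_max_left _ _)) ?_ (by positivity) (by positivity)
    exact pow_le_of_le_one hR.le hR1.le (by norm_num)
  · have e₂ : R ^ 2 * (((R ^ 5) ^ 3)⁻¹ * (|deriv ψ₁ (R ^ 4)⁻¹| * (R ^ 5)⁻¹) ^ 2) =
        (((R ^ 4)⁻¹) ^ 3 * |deriv ψ₁ (R ^ 4)⁻¹|) ^ 2 * R := by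
      field_simp
    rw [e₂]
    exact mul_le_mul_of_nonneg_right (c₂.trans (le_max_right _ _)) hR.le

end FormFactor

/-! ### Estimates of ball and boundary integrals -/

section Estimates

variable {Tm Tp R : ℝ} {r : ℝ → E3} {F : Type*} [NormedAddCommGroup F] [NormedSpace ℝ F]

theorem norm_boundaryIntegral_le (hR : 0 < R) {f : SpaceTime → E3 → F} {B t : ℝ}
    (ht : t ∈ Icc Tm Tp)
    (hB : ∀ p ∈ tube Tm Tp r R, ‖p.2 - r p.1‖ = R → ∀ ν : E3, ‖ν‖ = 1 → R ^ 2 * ‖f p ν‖ ≤ B) :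
    ‖boundaryIntegral r R f t‖ ≤ B * ((volume : Measure E3).toSphere).real univ := by
  simp only [boundaryIntegral, sphereIntegral]
  rw [← integral_smul]
  refine norm_integral_le_of_norm_le_const (Eventually.of_forall fun ω => ?_)
  have hω : ‖(ω : E3)‖ = 1 := by simp
  rw [norm_smul, Real.norm_of_nonneg (sq_nonneg R)]
  refine hB _ (sphere_mem_tube hR ht ω) ?_ _ hω
  simp [norm_smul, abs_of_pos hR]

theorem unifToZero_boundaryIntegral {R : ℕ → ℝ} (hRp : ∀ n, 0 < R n)
    (hR : Tendsto R atTop (𝓝 0)) {f : ℕ → SpaceTime → E3 → F} {C : ℝ}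
    (hf : ∀ᶠ n in atTop, ∀ p ∈ tube Tm Tp r (R n), ‖p.2 - r p.1‖ = R n → ∀ ν : E3, ‖ν‖ = 1 →
      R n ^ 2 * ‖f n p ν‖ ≤ C * R n) :
    UnifToZero Tm Tp (fun n t => boundaryIntegral r (R n) (f n) t) := by
  refine (UnifToZero.of_tendsto (Tm := Tm) (Tp := Tp) hR).of_bound
    (C * ((volume : Measure E3).toSphere).real univ) ?_
  filter_upwards [hf] with n hn t ht
  rw [Real.norm_of_nonneg (hRp n).le, mul_right_comm]
  exact norm_boundaryIntegral_le (hRp n) ht hn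

theorem norm_ballIntegral_le {f : SpaceTime → F} {g : SpaceTime → ℝ} {ε t : ℝ}
    (ht : t ∈ Icc Tm Tp) (hg : ContinuousOn g (tube Tm Tp r R))
    (h : ∀ p ∈ tube Tm Tp r R, ‖f p‖ ≤ ε * g p) :
    ‖ballIntegral r R f t‖ ≤ ε * ballIntegral r R g t := by
  simp only [ballIntegral]
  rw [← integral_const_mul]
  refine norm_integral_le_of_norm_le ((integrableOn_ball_slice hg ht).const_mul ε) ?_
  refine (ae_restrict_iff' Metric.isClosed_closedBall.measurableSet).2
    (Eventually.of_forall fun x hx => h (t, x) ⟨ht, ?_⟩)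
  simpa [dist_eq_norm] using hx

/-- The total normal vector of a sphere vanishes. -/
theorem boundaryIntegral_normal (r : ℝ → E3) (R t : ℝ) :
    boundaryIntegral r R (fun _ ν => ν) t = 0 := by
  simp only [boundaryIntegral, sphereIntegral]
  refine smul_eq_zero_of_right _ (ext_inner_right ℝ fun v => ?_)
  have h1 := integral_closedBall_lineDeriv_real (f := fun _ => 1) (f' := fun _ => 0) one_pos
    (v := v) continuousOn_const continuousOn_const
    (fun x _ => by simpa using (hasFDerivAt_const (1 : ℝ) x).hasLineDerivAt v)
  simp only [integral_zero, mul_one, one_pow, one_mul] at h1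
  have h2 : Integrable (fun ω : Metric.sphere (0 : E3) 1 => (ω : E3))
      (volume : Measure E3).toSphere := by
    refine Integrable.of_bound (C := 1) continuous_subtype_val.aestronglyMeasurable
      (Eventually.of_forall fun ω => ?_)
    simp
  rw [inner_zero_left, real_inner_comm, ← integral_inner h2 v, h1]
  simp only [real_inner_comm]

end Estimates

/-! ### The perturbation for a rigidly transported charge -/

section Transport

variable {K : NLSParams} {Tm Tp R : ℝ} {r : ℝ → E3} {φ : SpaceTime → ℝ} {A : SpaceTime → E3}
  {ψ : SpaceTime → ℂ}

/-- Perturbation terms for a wave function whose charge is transported with velocity `v`: the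
current is completed to the convective current `ρ v`, and the defect of the momentum equation is
counted as a force. -/
def transportPerturbation (K : NLSParams) (Ω : Set SpaceTime) (G : ℝ → ℝ) (φ : SpaceTime → ℝ)
    (A : SpaceTime → E3) (ψ : SpaceTime → ℂ) (v : ℝ → E3) : Perturbation where
  ρ _ := 0
  J p := chargeDensity K ψ p • v p.1 - currentDensity K Ω A ψ p
  P _ := 0
  T _ _ _ := 0
  f p := dT Ω (momentumDensity K Ω A ψ) p + ∑ i, dX Ω (stressRow K Ω G φ A ψ i) i p -
    lorentzDensity K Ω φ A ψ p

theorem dX_smul_fst (hΩ : UniqueDiffOn ℝ (tube Tm Tp r R)) {f : SpaceTime → ℝ}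
    (hf : ContDiffOn ℝ 1 f (tube Tm Tp r R)) {c : ℝ → E3} (hc : ContDiffOn ℝ 1 c (Icc Tm Tp))
    (i : Fin 3) {p : SpaceTime} (hp : p ∈ tube Tm Tp r R) :
    dX (tube Tm Tp r R) (fun p => f p • c p.1) i p = dX (tube Tm Tp r R) f i p • c p.1 := by
  have hfst : MapsTo (Prod.fst : SpaceTime → ℝ) (tube Tm Tp r R) (Icc Tm Tp) := fun p hp => hp.1
  have a1 := (hf.differentiableOn (by norm_num) p hp).hasFDerivWithinAt
  have a2 : HasFDerivWithinAt (fun p : SpaceTime => c p.1)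
      ((fderivWithin ℝ c (Icc Tm Tp) p.1).comp (ContinuousLinearMap.fst ℝ ℝ E3))
      (tube Tm Tp r R) p :=
    HasFDerivWithinAt.comp (g := c) (f := Prod.fst) p
      (hc.differentiableOn (by norm_num) p.1 hp.1).hasFDerivWithinAt hasFDerivWithinAt_fst hfst
  have a3 := (a1.fun_smul a2).fderivWithin (hΩ p hp)
  simp only [dX]
  rw [a3]
  simp

/-- The completed current is `ρ v`, whose continuity equation is the transport equation for `ρ`; the
momentum equation holds by the choice of the force. -/
theorem perturbedLaws_transport {G₁ g₁ : ℝ → ℝ} {a : ℝ} (hG : RegularNonlinearity G₁ g₁)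
    (ha : 0 < a) (hT : Tm < Tp) (hr : ContDiffOn ℝ 2 r (Icc Tm Tp)) (hR : 0 < R)
    (hφ : ContDiffOn ℝ 2 φ (tube Tm Tp r R)) (hA : ContDiffOn ℝ 2 A (tube Tm Tp r R))
    (hψ : ContDiffOn ℝ 2 ψ (tube Tm Tp r R))
    (htr : ∀ p ∈ tube Tm Tp r R,
      fderivWithin ℝ (chargeDensity K ψ) (tube Tm Tp r R) p (1, vel Tm Tp r p.1) = 0) :
    PerturbedLaws K (tube Tm Tp r R) (scaledG G₁ a) φ A ψ
      (transportPerturbation K (tube Tm Tp r R) (scaledG G₁ a) φ A ψ (vel Tm Tp r)) := by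
  have hΩ := uniqueDiffOn_tube hT hr hR
  have hfst : MapsTo (Prod.fst : SpaceTime → ℝ) (tube Tm Tp r R) (Icc Tm Tp) := fun p hp => hp.1
  have hv := contDiffOn_vel hT hr
  have hρ : ContDiffOn ℝ 1 (chargeDensity K ψ) (tube Tm Tp r R) :=
    (contDiffOn_chargeDensity hψ).of_le (by norm_num)
  have hP : ContDiffOn ℝ 1 (momentumDensity K (tube Tm Tp r R) A ψ) (tube Tm Tp r R) :=
    contDiffOn_momentumDensity hΩ hA hψ
  have hJ : ContDiffOn ℝ 1 (currentDensity K (tube Tm Tp r R) A ψ) (tube Tm Tp r R) :=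
    contDiffOn_currentDensity hΩ hA hψ
  have hS := contDiffOn_stressRow (K := K) hG ha hΩ hφ hA hψ
  have hJ' : ContDiffOn ℝ 1 (fun p => chargeDensity K ψ p • vel Tm Tp r p.1 -
      currentDensity K (tube Tm Tp r R) A ψ p) (tube Tm Tp r R) :=
    (hρ.smul (hv.comp contDiffOn_fst hfst)).sub hJ
  refine ⟨contDiffOn_const, hJ', contDiffOn_const, fun _ _ => contDiffOn_const, ?_,
    fun p hp => ?_, fun p hp j => ?_⟩
  · exact ((continuousOn_dT hΩ hP).add (continuousOn_finsetSum Finset.univ fun i _ =>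
      continuousOn_dX hΩ (hS i) i)).sub (continuousOn_lorentzDensity hΩ hφ hA hψ)
  · have e : ∀ i, dX (tube Tm Tp r R) (currentDensity K (tube Tm Tp r R) A ψ) i p +
        dX (tube Tm Tp r R) (fun p => chargeDensity K ψ p • vel Tm Tp r p.1 -
          currentDensity K (tube Tm Tp r R) A ψ p) i p =
        dX (tube Tm Tp r R) (chargeDensity K ψ) i p • vel Tm Tp r p.1 := fun i => by
      rw [← dX_add hΩ hJ hJ' i hp, ← dX_smul_fst hΩ hρ hv i hp]
      simp only [add_sub_cancel]
    have h := htr p hp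
    rw [fderivWithin_one_prod_eq] at h
    have h0 : dT (tube Tm Tp r R) (fun _ => (0 : ℝ)) p = 0 := by simp [dT]
    simp only [transportPerturbation]
    rw [h0, add_zero, add_assoc, ← Finset.sum_add_distrib, ← h]
    congr 1
    refine Finset.sum_congr rfl fun i _ => ?_
    rw [← PiLp.add_apply, e i, PiLp.smul_apply, smul_eq_mul, smul_eq_mul, mul_comm]
  · have h0 : dT (tube Tm Tp r R) (fun _ => (0 : E3)) p = 0 := by simp [dT]
    have h1 : ∀ i, dX (tube Tm Tp r R) (fun _ => (0 : ℝ)) i p = 0 := fun i => by simp [dX]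
    have h2 : ∀ i, dX (tube Tm Tp r R) (stress K (tube Tm Tp r R) (scaledG G₁ a) φ A ψ i j) i p =
        dX (tube Tm Tp r R) (stressRow K (tube Tm Tp r R) (scaledG G₁ a) φ A ψ i) i p j :=
      fun i => dX_coord hΩ (hS i) i j hp
    simp only [transportPerturbation, h0, h1, h2]
    simp

end Transport

/-! ### The stress on the boundary sphere -/

section Estimates

variable {Tm Tp R : ℝ} {r : ℝ → E3} {F : Type*} [NormedAddCommGroup F] [NormedSpace ℝ F]

theorem norm_le_sum_abs (v : E3) : ‖v‖ ≤ ∑ i, |v i| := by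
  have h := (EuclideanSpace.basisFun (Fin 3) ℝ).sum_repr v
  calc ‖v‖ = ‖∑ i, v i • EuclideanSpace.single i (1 : ℝ)‖ := by
        conv_lhs => rw [← h]
        simp
    _ ≤ ∑ i, ‖v i • EuclideanSpace.single i (1 : ℝ)‖ := norm_sum_le _ _
    _ = ∑ i, |v i| := by simp [norm_smul]

/-- Only the values on the sphere, where `|x - r(t)| = R`, enter the boundary integral. -/
theorem boundaryIntegral_congr_sphere (hR : 0 < R) {f g : SpaceTime → E3 → F} {t : ℝ}
    (ht : t ∈ Icc Tm Tp)
    (h : ∀ p ∈ tube Tm Tp r R, ‖p.2 - r p.1‖ = R → ∀ ν, f p ν = g p ν) :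
    boundaryIntegral r R f t = boundaryIntegral r R g t := by
  simp only [boundaryIntegral, sphereIntegral]
  congr 1
  refine integral_congr_ae (Eventually.of_forall fun ω => h _ (sphere_mem_tube hR ht ω) ?_ _)
  simp [norm_smul, abs_of_pos hR]

/-- The part `G(|ψ|²)` of the stress exerts no total force on a sphere on which `|ψ|` is
constant. -/
theorem boundaryIntegral_stress {K : NLSParams} {φ : SpaceTime → ℝ} {A : SpaceTime → E3}
    {ψ : SpaceTime → ℂ} {G₁ g₁ : ℝ → ℝ} {a : ℝ} (hG : RegularNonlinearity G₁ g₁)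
    (ha : 0 < a) (hT : Tm < Tp) (hr : ContDiffOn ℝ 2 r (Icc Tm Tp)) (hR : 0 < R)
    (hφ : ContDiffOn ℝ 2 φ (tube Tm Tp r R)) (hA : ContDiffOn ℝ 2 A (tube Tm Tp r R))
    (hψ : ContDiffOn ℝ 2 ψ (tube Tm Tp r R)) {b : ℝ}
    (hb : ∀ p ∈ tube Tm Tp r R, ‖p.2 - r p.1‖ = R → ‖ψ p‖ ^ 2 = b) {t : ℝ}
    (ht : t ∈ Icc Tm Tp) :
    boundaryIntegral r R (fun p ν => (WithLp.toLp 2 fun j => ∑ i, ν i *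
        stress K (tube Tm Tp r R) (scaledG G₁ a) φ A ψ i j p : E3)) t =
      boundaryIntegral r R (fun p ν => (WithLp.toLp 2 fun j => ∑ i, ν i *
        stress K (tube Tm Tp r R) (fun _ => 0) φ A ψ i j p : E3)) t := by
  have hΩ := uniqueDiffOn_tube hT hr hR
  -- on the sphere the two stresses differ by `c δ_ij`, whose flux is `c ∫ ν = 0`
  set c : ℝ := K.χ ^ 2 / (2 * K.m) * scaledG G₁ a b
  have h1 : boundaryIntegral r R (fun p ν => (WithLp.toLp 2 fun j => ∑ i, ν i *
        stress K (tube Tm Tp r R) (fun _ => 0) φ A ψ i j p : E3)) t =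
      boundaryIntegral r R (fun p ν => (WithLp.toLp 2 fun j => ∑ i, ν i *
        stress K (tube Tm Tp r R) (scaledG G₁ a) φ A ψ i j p : E3) + c • ν) t := by
    refine boundaryIntegral_congr_sphere hR ht fun p hp hpR ν => ?_
    have e : ∀ i j, stress K (tube Tm Tp r R) (fun _ => 0) φ A ψ i j p =
        stress K (tube Tm Tp r R) (scaledG G₁ a) φ A ψ i j p + if i = j then c else 0 :=
      fun i j => by
        simp only [stress, energyDensity, hb p hp hpR, c]
        split_ifs <;> ring
    ext j
    simp only [e, mul_add, Finset.sum_add_distrib, PiLp.add_apply, PiLp.smul_apply]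
    simp [mul_comm]
  have h2 : ContinuousOn (fun z : SpaceTime × E3 => (WithLp.toLp 2 fun j => ∑ i, z.2 i *
      stress K (tube Tm Tp r R) (scaledG G₁ a) φ A ψ i j z.1 : E3))
      (tube Tm Tp r R ×ˢ univ) := by
    have := continuousOn_flux fun i =>
      (contDiffOn_stressRow (K := K) hG ha hΩ hφ hA hψ i).continuousOn
    simpa only [sum_smul_stressRow] using this
  have h3 : ContinuousOn (fun z : SpaceTime × E3 => c • z.2) (tube Tm Tp r R ×ˢ univ) :=
    (continuous_snd.const_smul c).continuousOn
  have h4 : boundaryIntegral r R (fun _ ν => c • ν) t =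
      c • boundaryIntegral r R (fun _ ν => ν) t := by
    simp only [boundaryIntegral, sphereIntegral]
    rw [integral_smul, smul_comm]
  rw [h1, boundaryIntegral_add hr.continuousOn hR h2 h3 ht, h4, boundaryIntegral_normal,
    smul_zero, add_zero]

end Estimates

/-! ### Asymptotics of the wave-corpuscle in thin tubes -/

section Concentration

variable {K : NLSParams} {Tm Tp R₀ : ℝ} {r : ℝ → E3} {R : ℕ → ℝ} {ψ₁ g₁ : ℝ → ℝ}
  {F : Type*} [NormedAddCommGroup F] [NormedSpace ℝ F]

/-- Radii of a sequence of tubes that shrinks to the trajectory inside the tube of radius `R₀`. -/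
structure IsShrinking (R₀ : ℝ) (R : ℕ → ℝ) : Prop where
  pos : ∀ n, 0 < R n
  le : ∀ n, R n ≤ R₀
  le_one : ∀ n, R n ≤ 1
  tendsto : Tendsto R atTop (𝓝 0)

/-- On the boundary spheres the squares of the amplitude and of its gradient are `O(R⁻¹)`. -/
theorem eventually_sphere_amplitude (hT : Tm < Tp) (hr : ContDiffOn ℝ 2 r (Icc Tm Tp))
    (hR : IsShrinking R₀ R) (hψ : ContDiff ℝ 2 (fun x : E3 => ψ₁ ‖x‖))
    (hdecay : FormFactorDecay ψ₁) :
    ∃ C : ℝ, 0 ≤ C ∧ ∀ᶠ n in atTop, ∀ p ∈ tube Tm Tp r (R n), ‖p.2 - r p.1‖ = R n →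
      R n ^ 2 * corpuscleAmplitude r ψ₁ (R n ^ 5) p ^ 2 ≤ C * R n ∧
      ∀ i, R n ^ 2 * dX (tube Tm Tp r (R n)) (corpuscleAmplitude r ψ₁ (R n ^ 5)) i p ^ 2 ≤
        C * R n := by
  obtain ⟨C, hC⟩ := hdecay.eventually_amplitude_le
  have hR' : Tendsto R atTop (𝓝[>] 0) :=
    tendsto_nhdsWithin_iff.2 ⟨hR.tendsto, Eventually.of_forall hR.pos⟩
  refine ⟨max C 0, le_max_right _ _, ?_⟩
  filter_upwards [hR'.eventually hC] with n hn p hp hpR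
  have hRn := hR.pos n
  have ha : 0 < R n ^ 5 := pow_pos hRn 5
  have hle : C * R n ≤ max C 0 * R n := mul_le_mul_of_nonneg_right (le_max_left _ _) hRn.le
  refine ⟨?_, fun i => le_trans ?_ (hn.2.trans hle)⟩
  · rw [corpuscleAmplitude, hpR]
    exact hn.1.trans hle
  · have hz : ‖(R n ^ 5)⁻¹ • (p.2 - r p.1)‖ = (R n ^ 5)⁻¹ * R n := by
      rw [norm_smul, norm_inv, Real.norm_of_nonneg ha.le, hpR]
    have hz0 : (R n ^ 5)⁻¹ • (p.2 - r p.1) ≠ 0 := by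
      rw [← norm_pos_iff, hz]; positivity
    have h1 := abs_fderiv_radial_le hψ hz0
      ((R n ^ 5)⁻¹ • ((EuclideanSpace.single i 1 : E3) - (0 : ℝ) • vel Tm Tp r p.1))
    rw [hz] at h1
    have h2 : ‖(R n ^ 5)⁻¹ • ((EuclideanSpace.single i 1 : E3) - (0 : ℝ) • vel Tm Tp r p.1)‖ =
        (R n ^ 5)⁻¹ := by
      rw [norm_smul, norm_inv, Real.norm_of_nonneg ha.le]; simp
    rw [h2] at h1
    simp only [dX]
    rw [fderivWithin_corpuscleAmplitude hT ha hRn hψ hr hp, mul_pow, mul_pow _ (_ * _)]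
    refine mul_le_mul_of_nonneg_left (mul_le_mul_of_nonneg_left ?_ (sq_nonneg _)) (sq_nonneg _)
    rw [← sq_abs]
    exact pow_le_pow_left₀ (abs_nonneg _) h1 2

/-- Boundary integrals of densities bounded by the squared amplitude are negligible. -/
theorem unifToZero_boundaryIntegral_of_le_amplitude (hT : Tm < Tp)
    (hr : ContDiffOn ℝ 2 r (Icc Tm Tp)) (hR : IsShrinking R₀ R)
    (hψ : ContDiff ℝ 2 (fun x : E3 => ψ₁ ‖x‖)) (hdecay : FormFactorDecay ψ₁)
    {f : ℕ → SpaceTime → E3 → F} {c : ℝ} (hc : 0 ≤ c)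
    (hf : ∀ n, ∀ p ∈ tube Tm Tp r (R n), ‖p.2 - r p.1‖ = R n → ∀ ν : E3, ‖ν‖ = 1 →
      ‖f n p ν‖ ≤ c * corpuscleAmplitude r ψ₁ (R n ^ 5) p ^ 2) :
    UnifToZero Tm Tp (fun n t => boundaryIntegral r (R n) (f n) t) := by
  obtain ⟨C, -, hC⟩ := eventually_sphere_amplitude hT hr hR hψ hdecay
  refine unifToZero_boundaryIntegral hR.pos hR.tendsto (C := c * C) ?_
  filter_upwards [hC] with n hn p hp hpR ν hν
  calc R n ^ 2 * ‖f n p ν‖ ≤ R n ^ 2 * (c * corpuscleAmplitude r ψ₁ (R n ^ 5) p ^ 2) :=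
        mul_le_mul_of_nonneg_left (hf n p hp hpR ν hν) (sq_nonneg _)
    _ = c * (R n ^ 2 * corpuscleAmplitude r ψ₁ (R n ^ 5) p ^ 2) := by ring
    _ ≤ c * (C * R n) := mul_le_mul_of_nonneg_left (hn p hp hpR).1 hc
    _ = c * C * R n := by ring

theorem continuousOn_amplitude_sq {a R : ℝ} (ha : 0 < a) (hr : ContDiffOn ℝ 2 r (Icc Tm Tp))
    (hψ : ContDiff ℝ 2 (fun x : E3 => ψ₁ ‖x‖)) :
    ContinuousOn (fun p => corpuscleAmplitude r ψ₁ a p ^ 2) (tube Tm Tp r R) :=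
  (contDiffOn_corpuscleAmplitude ha hψ hr).continuousOn.pow 2

theorem norm_ballIntegral_le_mass {a R : ℝ} (ha : 0 < a) (hr : ContDiffOn ℝ 2 r (Icc Tm Tp))
    (hψ : IsFormFactor g₁ ψ₁) {f : SpaceTime → F} {c t : ℝ} (hc : 0 ≤ c) (ht : t ∈ Icc Tm Tp)
    (hf : ∀ p ∈ tube Tm Tp r R, ‖f p‖ ≤ c * corpuscleAmplitude r ψ₁ a p ^ 2) :
    ‖ballIntegral r R f t‖ ≤ c * ∫ x : E3, ψ₁ ‖x‖ ^ 2 := by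
  refine (norm_ballIntegral_le ht (continuousOn_amplitude_sq ha hr hψ.contDiff) hf).trans ?_
  rw [ballIntegral_corpuscleAmplitude_sq ha]
  exact mul_le_mul_of_nonneg_left (hψ.setIntegral_le_mass _) hc

/-- Ball integrals of densities that are small relative to the squared amplitude are negligible,
since the total mass is bounded. -/
theorem unifToZero_ballIntegral_of_le_amplitude (hr : ContDiffOn ℝ 2 r (Icc Tm Tp))
    (hR : IsShrinking R₀ R) (hψ : IsFormFactor g₁ ψ₁) {f : ℕ → SpaceTime → F}
    (hf : ∀ ε > 0, ∀ᶠ n in atTop, ∀ p ∈ tube Tm Tp r (R n),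
      ‖f n p‖ ≤ ε * corpuscleAmplitude r ψ₁ (R n ^ 5) p ^ 2) :
    UnifToZero Tm Tp (fun n t => ballIntegral r (R n) (f n) t) := by
  refine unifToZero_iff.2 fun ε hε => ?_
  have hM := hψ.mass_pos
  filter_upwards [hf (ε / 2 / ∫ x : E3, ψ₁ ‖x‖ ^ 2) (by positivity)] with n hn t ht
  have h := norm_ballIntegral_le_mass (pow_pos (hR.pos n) 5) hr hψ (by positivity) ht hn
  rw [div_mul_cancel₀ _ hM.ne'] at h
  linarith

variable {σ : SpaceTime → ℝ}

/-- The charge in the moving ball does not depend on time. -/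
theorem localCharge_polar {a R : ℝ} (ha : 0 < a) (t : ℝ) :
    localCharge K r R (polar σ (corpuscleAmplitude r ψ₁ a)) t =
      K.q * ∫ x in Metric.closedBall (0 : E3) (R / a), ψ₁ ‖x‖ ^ 2 := by
  rw [← ballIntegral_corpuscleAmplitude_sq (r := r) ha t]
  simp only [localCharge, ballIntegral, chargeDensity_polar]
  rw [integral_const_mul]

theorem setIntegral_formFactor_pos (hψ : IsFormFactor g₁ ψ₁) {θ : ℝ} (hθ : 0 < θ) :
    0 < ∫ x in Metric.closedBall (0 : E3) θ, ψ₁ ‖x‖ ^ 2 := by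
  rw [integral_pos_iff_support_of_nonneg (fun x => sq_nonneg _) hψ.sq_integrable.integrableOn]
  have : Function.support (fun x : E3 => ψ₁ ‖x‖ ^ 2) = univ :=
    eq_univ_of_forall fun x => (pow_pos (hψ.pos _ (norm_nonneg x)) 2).ne'
  rw [this, Measure.restrict_apply_univ]
  exact Metric.measure_closedBall_pos volume 0 hθ

/-- By symmetry the charge center is exactly the center of the ball. -/
theorem chargeCenter_polar {a R : ℝ} (ha : 0 < a) (hR : 0 < R) (hq : K.q ≠ 0)
    (hψ : IsFormFactor g₁ ψ₁) (hr : ContDiffOn ℝ 2 r (Icc Tm Tp)) {t : ℝ} (ht : t ∈ Icc Tm Tp) :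
    chargeCenter K r R (polar σ (corpuscleAmplitude r ψ₁ a)) t = r t := by
  have hN : localCharge K r R (polar σ (corpuscleAmplitude r ψ₁ a)) t ≠ 0 := by
    rw [localCharge_polar ha]
    exact mul_ne_zero hq (setIntegral_formFactor_pos hψ (div_pos hR ha)).ne'
  have hc : ContinuousOn (fun p => corpuscleAmplitude r ψ₁ a p ^ 2) (tube Tm Tp r R) :=
    continuousOn_amplitude_sq ha hr hψ.contDiff
  have h1 : ballIntegral r R (fun p => chargeDensity K (polar σ (corpuscleAmplitude r ψ₁ a)) p •
      p.2) t = localCharge K r R (polar σ (corpuscleAmplitude r ψ₁ a)) t • r t := by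
    have hfst : MapsTo (Prod.fst : SpaceTime → ℝ) (tube Tm Tp r R) (Icc Tm Tp) := fun p hp => hp.1
    have hrc : ContinuousOn (fun p : SpaceTime => r p.1) (tube Tm Tp r R) :=
      hr.continuousOn.comp continuousOn_fst hfst
    have h2 : ballIntegral r R
        (fun p => corpuscleAmplitude r ψ₁ a p ^ 2 • (p.2 - r p.1)) t = 0 := by
      rw [ballIntegral_eq]
      simpa using integral_corpuscleAmplitude_sq_smul (r := r) (ψ₁ := ψ₁) (a := a) (R := R) t
    have h3 : ballIntegral r R (fun p => corpuscleAmplitude r ψ₁ a p ^ 2 • p.2) t =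
        ballIntegral r R (fun p => corpuscleAmplitude r ψ₁ a p ^ 2) t • r t := by
      have h4 := ballIntegral_sub (hc.fun_smul continuousOn_snd) (hc.fun_smul hrc) ht
      simp only [← smul_sub] at h4
      rw [h2] at h4
      rw [sub_eq_zero.1 h4.symm]
      simp only [ballIntegral]
      rw [integral_smul_const]
    simp only [localCharge, ballIntegral, chargeDensity_polar, mul_smul] at h3 ⊢
    rw [integral_smul, h3, integral_const_mul, mul_smul]
  rw [chargeCenter, h1, smul_smul, inv_mul_cancel₀ hN, one_smul]

/-- The charge density is transported rigidly with the trajectory. -/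
theorem fderivWithin_chargeDensity_convective {a R : ℝ} (hT : Tm < Tp) (ha : 0 < a) (hR : 0 < R)
    (hψ : ContDiff ℝ 2 (fun x : E3 => ψ₁ ‖x‖)) (hr : ContDiffOn ℝ 2 r (Icc Tm Tp))
    {p : SpaceTime} (hp : p ∈ tube Tm Tp r R) :
    fderivWithin ℝ (chargeDensity K (polar σ (corpuscleAmplitude r ψ₁ a))) (tube Tm Tp r R) p
      (1, vel Tm Tp r p.1) = 0 := by
  have h1 : HasFDerivWithinAt (corpuscleAmplitude r ψ₁ a)
      (fderivWithin ℝ (corpuscleAmplitude r ψ₁ a) (tube Tm Tp r R) p) (tube Tm Tp r R) p :=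
    ((contDiffOn_corpuscleAmplitude ha hψ hr).differentiableOn (by norm_num) p hp).hasFDerivWithinAt
  have h2 := ((h1.fun_mul h1).const_mul K.q).fderivWithin (uniqueDiffOn_tube hT hr hR p hp)
  have e : chargeDensity K (polar σ (corpuscleAmplitude r ψ₁ a)) = fun p =>
      K.q * (corpuscleAmplitude r ψ₁ a p * corpuscleAmplitude r ψ₁ a p) := funext fun p => by
    rw [chargeDensity_polar, sq]
  rw [e, h2]
  simp [fderivWithin_corpuscleAmplitude hT ha hR hψ hr hp]

end Concentration

/-! ### Bounds for the stress -/

section Stress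

variable {K : NLSParams} {Ω : Set SpaceTime} {φ : SpaceTime → ℝ} {A : SpaceTime → E3}
  {σ u : SpaceTime → ℝ}

theorem mul_abs_mul_le {s B x y : ℝ} (hs : 0 ≤ s) (hx : s * x ^ 2 ≤ B) (hy : s * y ^ 2 ≤ B) :
    s * |x * y| ≤ B := by
  have h := two_mul_le_add_sq |x| |y|
  rw [sq_abs, sq_abs] at h
  rw [abs_mul]
  nlinarith

/-- The stress without the nonlinear term is controlled by `u²` and `|∇u|²`. -/
theorem mul_abs_stress_le (hΩ : UniqueDiffOn ℝ Ω) (hσ : DifferentiableOn ℝ σ Ω)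
    (hu : DifferentiableOn ℝ u Ω) {p : SpaceTime} (hp : p ∈ Ω) {s B C Cω : ℝ} (hs : 0 ≤ s)
    (hk : ‖kineticMomentum K Ω A σ p‖ ≤ C) (hω : |dT Ω σ p + K.q / K.χ * φ p| ≤ Cω)
    (h0 : s * u p ^ 2 ≤ B) (h1 : ∀ i, s * dX Ω u i p ^ 2 ≤ B) (i j : Fin 3) :
    s * |stress K Ω (fun _ => 0) φ A (polar σ u) i j p| ≤
      (K.χ ^ 2 / K.m * (1 + (K.χ⁻¹ * C) ^ 2) +
        (K.χ ^ 2 / (2 * K.m) * (3 * (1 + (K.χ⁻¹ * C) ^ 2)) + K.χ * Cω)) * B := by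
  have hχ := K.χ_pos
  have hm := K.m_pos
  have hC : 0 ≤ C := (norm_nonneg _).trans hk
  have hB : 0 ≤ B := (by positivity : 0 ≤ s * u p ^ 2).trans h0
  have hCω : 0 ≤ Cω := (abs_nonneg _).trans hω
  rw [stress_polar hΩ hσ hu hp]
  set κ : Fin 3 → ℝ := fun i => K.χ⁻¹ * kineticMomentum K Ω A σ p i with hκ
  have hκle : ∀ i, |κ i| ≤ K.χ⁻¹ * C := fun i => by
    rw [hκ, abs_mul, abs_of_pos (inv_pos.2 hχ)]
    exact mul_le_mul_of_nonneg_left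
      ((PiLp.norm_apply_le (kineticMomentum K Ω A σ p) i).trans hk) (inv_pos.2 hχ).le
  have hκ2 : ∀ i j, |κ i * κ j| ≤ (K.χ⁻¹ * C) ^ 2 := fun i j => by
    rw [abs_mul, sq]
    exact mul_le_mul (hκle i) (hκle j) (abs_nonneg _) (by positivity)
  have t1 : ∀ i j, s * |dX Ω u i p * dX Ω u j p + κ i * κ j * u p ^ 2| ≤
      (1 + (K.χ⁻¹ * C) ^ 2) * B := fun i j => by
    have e1 := mul_abs_mul_le hs (h1 i) (h1 j)
    have e2 : |κ i * κ j| * (s * u p ^ 2) ≤ (K.χ⁻¹ * C) ^ 2 * B :=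
      mul_le_mul (hκ2 i j) h0 (by positivity) (by positivity)
    calc s * |dX Ω u i p * dX Ω u j p + κ i * κ j * u p ^ 2|
        ≤ s * (|dX Ω u i p * dX Ω u j p| + |κ i * κ j * u p ^ 2|) :=
          mul_le_mul_of_nonneg_left (abs_add_le _ _) hs
      _ = s * |dX Ω u i p * dX Ω u j p| + |κ i * κ j| * (s * u p ^ 2) := by
          rw [abs_mul (κ i * κ j), abs_of_nonneg (sq_nonneg (u p))]; ring
      _ ≤ (1 + (K.χ⁻¹ * C) ^ 2) * B := by linarith
  have t2 : s * |∑ k, (dX Ω u k p ^ 2 + κ k ^ 2 * u p ^ 2)| ≤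
      3 * (1 + (K.χ⁻¹ * C) ^ 2) * B := by
    have e : ∀ k, s * |dX Ω u k p ^ 2 + κ k ^ 2 * u p ^ 2| ≤ (1 + (K.χ⁻¹ * C) ^ 2) * B :=
      fun k => by simpa only [sq] using t1 k k
    calc s * |∑ k, (dX Ω u k p ^ 2 + κ k ^ 2 * u p ^ 2)|
        ≤ s * ∑ k, |dX Ω u k p ^ 2 + κ k ^ 2 * u p ^ 2| :=
          mul_le_mul_of_nonneg_left (Finset.abs_sum_le_sum_abs _ _) hs
      _ = ∑ k, s * |dX Ω u k p ^ 2 + κ k ^ 2 * u p ^ 2| := Finset.mul_sum _ _ _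
      _ ≤ ∑ _k : Fin 3, (1 + (K.χ⁻¹ * C) ^ 2) * B := Finset.sum_le_sum fun k _ => e k
      _ = 3 * (1 + (K.χ⁻¹ * C) ^ 2) * B := by simp; ring
  have t3 : s * |(dT Ω σ p + K.q / K.χ * φ p) * u p ^ 2| ≤ Cω * B := by
    rw [abs_mul, abs_of_nonneg (sq_nonneg (u p)), mul_left_comm]
    exact mul_le_mul hω h0 (by positivity) hCω
  have t4 : s * |if i = j then
        K.χ ^ 2 / (2 * K.m) * (∑ k, (dX Ω u k p ^ 2 + κ k ^ 2 * u p ^ 2) + 0) +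
        K.χ * ((dT Ω σ p + K.q / K.χ * φ p) * u p ^ 2) else 0| ≤
      (K.χ ^ 2 / (2 * K.m) * (3 * (1 + (K.χ⁻¹ * C) ^ 2)) + K.χ * Cω) * B := by
    split_ifs
    · rw [add_zero]
      set x := ∑ k, (dX Ω u k p ^ 2 + κ k ^ 2 * u p ^ 2)
      set y := (dT Ω σ p + K.q / K.χ * φ p) * u p ^ 2
      have hα : 0 ≤ K.χ ^ 2 / (2 * K.m) := by positivity
      calc s * |K.χ ^ 2 / (2 * K.m) * x + K.χ * y|
          ≤ s * (|K.χ ^ 2 / (2 * K.m) * x| + |K.χ * y|) :=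
            mul_le_mul_of_nonneg_left (abs_add_le _ _) hs
        _ = K.χ ^ 2 / (2 * K.m) * (s * |x|) + K.χ * (s * |y|) := by
            rw [abs_mul, abs_mul, abs_of_nonneg hα, abs_of_pos hχ]; ring
        _ ≤ K.χ ^ 2 / (2 * K.m) * (3 * (1 + (K.χ⁻¹ * C) ^ 2) * B) + K.χ * (Cω * B) :=
            add_le_add (mul_le_mul_of_nonneg_left t2 hα) (mul_le_mul_of_nonneg_left t3 hχ.le)
        _ = _ := by ring
    · rw [abs_zero, mul_zero]; positivity
  have hα : 0 ≤ K.χ ^ 2 / K.m := by positivity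
  set x := dX Ω u i p * dX Ω u j p + κ i * κ j * u p ^ 2
  refine (mul_le_mul_of_nonneg_left (abs_sub _ _) hs).trans ?_
  rw [mul_add, add_mul (K.χ ^ 2 / K.m * _)]
  refine add_le_add ?_ t4
  rw [abs_mul, abs_of_nonneg hα, mul_left_comm, mul_assoc]
  exact mul_le_mul_of_nonneg_left (t1 i j) hα

theorem norm_sum_mul_le {T : Fin 3 → Fin 3 → ℝ} {ν : E3} (hν : ‖ν‖ = 1) {s B : ℝ} (hs : 0 ≤ s)
    (hT : ∀ i j, s * |T i j| ≤ B) :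
    s * ‖(WithLp.toLp 2 fun j => ∑ i, ν i * T i j : E3)‖ ≤ 9 * B := by
  have h1 : ∀ i, |ν i| ≤ 1 := fun i => (PiLp.norm_apply_le ν i).trans hν.le
  calc s * ‖(WithLp.toLp 2 fun j => ∑ i, ν i * T i j : E3)‖
      ≤ s * ∑ j, ∑ i, |T i j| := by
        refine mul_le_mul_of_nonneg_left ((norm_le_sum_abs _).trans ?_) hs
        refine Finset.sum_le_sum fun j _ => ?_
        change |∑ i, ν i * T i j| ≤ _
        refine (Finset.abs_sum_le_sum_abs _ _).trans ?_
        refine Finset.sum_le_sum fun i _ => ?_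
        rw [abs_mul]
        exact mul_le_of_le_one_left (abs_nonneg _) (h1 i)
    _ = ∑ j, ∑ i, s * |T i j| := by simp only [Finset.mul_sum]
    _ ≤ ∑ _j : Fin 3, ∑ _i : Fin 3, B :=
        Finset.sum_le_sum fun j _ => Finset.sum_le_sum fun i _ => hT i j
    _ = 9 * B := by simp; ring

end Stress

/-! ### Independence of the width of the tube -/

section Tubes

variable {K : NLSParams} {Tm Tp R R₀ : ℝ} {r : ℝ → E3} {φ σ : SpaceTime → ℝ} {A : SpaceTime → E3}
  {p : SpaceTime}

/-- The kinetic momentum does not depend on the tube used to form derivatives. -/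
theorem kineticMomentum_tube_eq (hT : Tm < Tp) (hr : ContDiffOn ℝ 2 r (Icc Tm Tp)) (hR : 0 < R)
    (hRR : R ≤ R₀) (hσ : DifferentiableOn ℝ σ (tube Tm Tp r R₀)) (hp : p ∈ tube Tm Tp r R) :
    kineticMomentum K (tube Tm Tp r R) A σ p = kineticMomentum K (tube Tm Tp r R₀) A σ p := by
  simp only [kineticMomentum, dX, fderivWithin_tube_eq hT hr hR hRR hσ hp]

theorem electricField_tube_eq (hT : Tm < Tp) (hr : ContDiffOn ℝ 2 r (Icc Tm Tp)) (hR : 0 < R)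
    (hRR : R ≤ R₀) (hφ : DifferentiableOn ℝ φ (tube Tm Tp r R₀))
    (hA : DifferentiableOn ℝ A (tube Tm Tp r R₀)) (hp : p ∈ tube Tm Tp r R) :
    electricField K (tube Tm Tp r R) φ A p = electricField K (tube Tm Tp r R₀) φ A p := by
  simp only [electricField, dX, dT, fderivWithin_tube_eq hT hr hR hRR hφ hp,
    fderivWithin_tube_eq hT hr hR hRR hA hp]

theorem magneticField_tube_eq (hT : Tm < Tp) (hr : ContDiffOn ℝ 2 r (Icc Tm Tp)) (hR : 0 < R)
    (hRR : R ≤ R₀) (hA : DifferentiableOn ℝ A (tube Tm Tp r R₀)) (hp : p ∈ tube Tm Tp r R) :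
    magneticField (tube Tm Tp r R) A p = magneticField (tube Tm Tp r R₀) A p := by
  simp only [magneticField, dX, fderivWithin_tube_eq hT hr hR hRR hA hp]

end Tubes

/-! ### Concentration of the wave-corpuscles -/

section Corpuscles

variable {K : NLSParams} {Tm Tp R₀ : ℝ} {r : ℝ → E3} {R : ℕ → ℝ} {ψ₁ g₁ G₁ : ℝ → ℝ}
  {D : Set SpaceTime} {φ σ : SpaceTime → ℝ} {A : SpaceTime → E3}

/-- The wave functions of fixed phase `σ` whose amplitudes are those of wave-corpuscles of
size `R⁵`. For `σ = corpusclePhase K Tm Tp r W` they are, by definition, the wave-corpuscles of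
these sizes built on `W`. -/
def corpuscles (r : ℝ → E3) (ψ₁ : ℝ → ℝ) (R : ℕ → ℝ) (σ : SpaceTime → ℝ) (n : ℕ) :
    SpaceTime → ℂ :=
  polar σ (corpuscleAmplitude r ψ₁ (R n ^ 5))

theorem contDiffOn_corpuscles (hr : ContDiffOn ℝ 2 r (Icc Tm Tp)) (hR : IsShrinking R₀ R)
    (hψ : ContDiff ℝ 2 (fun x : E3 => ψ₁ ‖x‖)) (hσ : ContDiffOn ℝ 2 σ (tube Tm Tp r R₀)) (n : ℕ) :
    ContDiffOn ℝ 2 (corpuscles r ψ₁ R σ n) (tube Tm Tp r (R n)) :=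
  contDiffOn_polar (hσ.mono (tube_mono (hR.le n)))
    (contDiffOn_corpuscleAmplitude (pow_pos (hR.pos n) 5) hψ hr)

theorem momentumDensity_corpuscles (hT : Tm < Tp) (hr : ContDiffOn ℝ 2 r (Icc Tm Tp))
    (hR : IsShrinking R₀ R) (hψ : ContDiff ℝ 2 (fun x : E3 => ψ₁ ‖x‖))
    (hσ : ContDiffOn ℝ 2 σ (tube Tm Tp r R₀)) (n : ℕ) {p : SpaceTime}
    (hp : p ∈ tube Tm Tp r (R n)) :
    momentumDensity K (tube Tm Tp r (R n)) A (corpuscles r ψ₁ R σ n) p =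
      corpuscleAmplitude r ψ₁ (R n ^ 5) p ^ 2 • kineticMomentum K (tube Tm Tp r R₀) A σ p := by
  have hσ1 : DifferentiableOn ℝ σ (tube Tm Tp r R₀) := hσ.differentiableOn (by norm_num)
  rw [corpuscles, momentumDensity_polar (uniqueDiffOn_tube hT hr (hR.pos n))
    (hσ1.mono (tube_mono (hR.le n)))
    ((contDiffOn_corpuscleAmplitude (pow_pos (hR.pos n) 5) hψ hr).differentiableOn
      (by norm_num)) hp,
    kineticMomentum_tube_eq hT hr (hR.pos n) (hR.le n) hσ1 hp]

theorem norm_momentumDensity_corpuscles_le (hT : Tm < Tp) (hr : ContDiffOn ℝ 2 r (Icc Tm Tp))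
    (hR : IsShrinking R₀ R) (hψ : ContDiff ℝ 2 (fun x : E3 => ψ₁ ‖x‖))
    (hσ : ContDiffOn ℝ 2 σ (tube Tm Tp r R₀)) {C : ℝ}
    (hC : ∀ p ∈ tube Tm Tp r R₀, ‖kineticMomentum K (tube Tm Tp r R₀) A σ p‖ ≤ C) (n : ℕ)
    {p : SpaceTime} (hp : p ∈ tube Tm Tp r (R n)) :
    ‖momentumDensity K (tube Tm Tp r (R n)) A (corpuscles r ψ₁ R σ n) p‖ ≤
      C * corpuscleAmplitude r ψ₁ (R n ^ 5) p ^ 2 := by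
  rw [momentumDensity_corpuscles hT hr hR hψ hσ n hp, norm_smul,
    Real.norm_of_nonneg (sq_nonneg _), mul_comm]
  exact mul_le_mul_of_nonneg_right (hC p (tube_mono (hR.le n) hp)) (sq_nonneg _)

theorem norm_currentDensity_corpuscles_le (hT : Tm < Tp) (hr : ContDiffOn ℝ 2 r (Icc Tm Tp))
    (hR : IsShrinking R₀ R) (hψ : ContDiff ℝ 2 (fun x : E3 => ψ₁ ‖x‖))
    (hσ : ContDiffOn ℝ 2 σ (tube Tm Tp r R₀)) {C : ℝ}
    (hC : ∀ p ∈ tube Tm Tp r R₀, ‖kineticMomentum K (tube Tm Tp r R₀) A σ p‖ ≤ C) (n : ℕ)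
    {p : SpaceTime} (hp : p ∈ tube Tm Tp r (R n)) :
    ‖currentDensity K (tube Tm Tp r (R n)) A (corpuscles r ψ₁ R σ n) p‖ ≤
      |K.q / K.m| * C * corpuscleAmplitude r ψ₁ (R n ^ 5) p ^ 2 := by
  rw [currentDensity_eq_smul, norm_smul, Real.norm_eq_abs, mul_assoc]
  exact mul_le_mul_of_nonneg_left
    (norm_momentumDensity_corpuscles_le hT hr hR hψ hσ hC n hp) (abs_nonneg _)

theorem IsShrinking.tendsto_ratio (hR : IsShrinking R₀ R) :
    Tendsto (fun n => R n / R n ^ 5) atTop atTop := by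
  have h1 : Tendsto (fun n => R n ^ 4) atTop (𝓝[>] 0) := by
    refine tendsto_nhdsWithin_iff.2 ⟨?_, Eventually.of_forall fun n => pow_pos (hR.pos n) 4⟩
    simpa using hR.tendsto.pow 4
  refine (tendsto_inv_nhdsGT_zero.comp h1).congr fun n => ?_
  have := (hR.pos n).ne'
  simp only [Function.comp]
  field_simp

theorem IsShrinking.tendsto_mass (hR : IsShrinking R₀ R) (hψ : IsFormFactor g₁ ψ₁) :
    Tendsto (fun n => (∫ x in Metric.closedBall (0 : E3) (R n / R n ^ 5), ψ₁ ‖x‖ ^ 2) -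
      ∫ x : E3, ψ₁ ‖x‖ ^ 2) atTop (𝓝 0) :=
  tendsto_sub_nhds_zero_iff.2 (hψ.tendsto_mass hR.tendsto_ratio)

theorem unifToZero_localCharge_corpuscles (hR : IsShrinking R₀ R) (hψ : IsFormFactor g₁ ψ₁) :
    UnifToZero Tm Tp (fun n t => localCharge K r (R n) (corpuscles r ψ₁ R σ n) t -
      K.q * ∫ x : E3, ψ₁ ‖x‖ ^ 2) := by
  refine ((UnifToZero.of_tendsto (hR.tendsto_mass hψ)).const_smul K.q).congr
    (Eventually.of_forall fun n t _ => ?_)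
  rw [corpuscles, localCharge_polar (pow_pos (hR.pos n) 5), smul_eq_mul, mul_sub]

/-- The kinetic momentum is close to `m ∂_t r` near the trajectory. -/
theorem eventually_kineticMomentum_sub_lt (hT : Tm < Tp) (hr : ContDiffOn ℝ 2 r (Icc Tm Tp))
    (hR : IsShrinking R₀ R) (hA : ContDiffOn ℝ 2 A (tube Tm Tp r R₀))
    (hσ : ContDiffOn ℝ 2 σ (tube Tm Tp r R₀))
    (hk : ∀ t ∈ Icc Tm Tp,
      kineticMomentum K (tube Tm Tp r R₀) A σ (t, r t) = K.m • vel Tm Tp r t) {ε : ℝ}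
    (hε : 0 < ε) : ∀ᶠ n in atTop, ∀ p ∈ tube Tm Tp r (R n),
      ‖kineticMomentum K (tube Tm Tp r R₀) A σ p - K.m • vel Tm Tp r p.1‖ < ε := by
  have hΩ := uniqueDiffOn_tube hT hr ((hR.pos 0).trans_le (hR.le 0))
  have hfst : MapsTo (Prod.fst : SpaceTime → ℝ) (tube Tm Tp r R₀) (Icc Tm Tp) := fun p hp => hp.1
  have hv : ContinuousOn (fun p : SpaceTime => vel Tm Tp r p.1) (tube Tm Tp r R₀) :=
    (continuousOn_vel hT hr).comp continuousOn_fst hfst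
  exact eventually_norm_lt_of_center_eq_zero hr.continuousOn
    ((contDiffOn_kineticMomentum hΩ hA hσ).continuousOn.fun_sub (hv.fun_const_smul K.m))
    (fun t ht => by rw [hk t ht, sub_self]) hR.pos hR.le hR.tendsto hε

/-- The total momentum tends to that of a particle. -/
theorem unifToZero_momentum_corpuscles (hT : Tm < Tp) (hr : ContDiffOn ℝ 2 r (Icc Tm Tp))
    (hR : IsShrinking R₀ R) (hψ : IsFormFactor g₁ ψ₁) (hA : ContDiffOn ℝ 2 A (tube Tm Tp r R₀))
    (hσ : ContDiffOn ℝ 2 σ (tube Tm Tp r R₀))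
    (hk : ∀ t ∈ Icc Tm Tp,
      kineticMomentum K (tube Tm Tp r R₀) A σ (t, r t) = K.m • vel Tm Tp r t) :
    UnifToZero Tm Tp (fun n t =>
      ballIntegral r (R n) (momentumDensity K (tube Tm Tp r (R n)) A (corpuscles r ψ₁ R σ n)) t -
        (K.m * ∫ x : E3, ψ₁ ‖x‖ ^ 2) • vel Tm Tp r t) := by
  obtain ⟨Cv, hCv⟩ := isCompact_Icc.exists_bound_of_continuousOn (continuousOn_vel hT hr)
  -- replace the kinetic momentum by its value on the trajectory, then the mass by its limit
  have h1 : UnifToZero Tm Tp (fun n t => ballIntegral r (R n) (fun p =>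
      momentumDensity K (tube Tm Tp r (R n)) A (corpuscles r ψ₁ R σ n) p -
        corpuscleAmplitude r ψ₁ (R n ^ 5) p ^ 2 • (K.m • vel Tm Tp r p.1)) t) := by
    refine unifToZero_ballIntegral_of_le_amplitude hr hR hψ fun ε hε => ?_
    filter_upwards [eventually_kineticMomentum_sub_lt hT hr hR hA hσ hk hε] with n hn p hp
    rw [momentumDensity_corpuscles hT hr hR hψ.contDiff hσ n hp, ← smul_sub, norm_smul,
      Real.norm_of_nonneg (sq_nonneg _), mul_comm]
    exact mul_le_mul_of_nonneg_right (hn p hp).le (sq_nonneg _)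
  have h2 : UnifToZero Tm Tp (fun n t =>
      (((∫ x in Metric.closedBall (0 : E3) (R n / R n ^ 5), ψ₁ ‖x‖ ^ 2) -
        ∫ x : E3, ψ₁ ‖x‖ ^ 2) * K.m) • vel Tm Tp r t) := by
    refine (UnifToZero.of_tendsto (hR.tendsto_mass hψ)).of_bound (K.m * Cv)
      (Eventually.of_forall fun n t ht => ?_)
    rw [norm_smul, norm_mul, Real.norm_of_nonneg K.m_pos.le]
    have := mul_le_mul_of_nonneg_left (hCv t ht) (mul_nonneg (norm_nonneg
      ((∫ x in Metric.closedBall (0 : E3) (R n / R n ^ 5), ψ₁ ‖x‖ ^ 2) -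
        ∫ x : E3, ψ₁ ‖x‖ ^ 2)) K.m_pos.le)
    linarith
  refine (h1.add h2).congr (Eventually.of_forall fun n t ht => ?_)
  have ha := pow_pos (hR.pos n) 5
  have hΩ := uniqueDiffOn_tube hT hr (hR.pos n)
  have hfst : MapsTo (Prod.fst : SpaceTime → ℝ) (tube Tm Tp r (R n)) (Icc Tm Tp) :=
    fun p hp => hp.1
  have hv : ContinuousOn (fun p : SpaceTime => vel Tm Tp r p.1) (tube Tm Tp r (R n)) :=
    (continuousOn_vel hT hr).comp continuousOn_fst hfst
  have e1 : ballIntegral r (R n) (fun p => corpuscleAmplitude r ψ₁ (R n ^ 5) p ^ 2 •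
      (K.m • vel Tm Tp r p.1)) t =
      (∫ x in Metric.closedBall (0 : E3) (R n / R n ^ 5), ψ₁ ‖x‖ ^ 2) •
        (K.m • vel Tm Tp r t) := by
    rw [← ballIntegral_corpuscleAmplitude_sq (r := r) ha t]
    simp only [ballIntegral]
    rw [integral_smul_const]
  rw [ballIntegral_sub (contDiffOn_momentumDensity hΩ (hA.mono (tube_mono (hR.le n)))
      (contDiffOn_corpuscles hr hR hψ.contDiff hσ n)).continuousOn
    ((continuousOn_amplitude_sq ha hr hψ.contDiff).fun_smul (hv.fun_const_smul K.m)) ht, e1]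
  module

/-- The fields of the potentials may be replaced by those of their linear parts. -/
theorem unifToZero_field_corpuscles (hT : Tm < Tp) (hr : ContDiffOn ℝ 2 r (Icc Tm Tp))
    (hR : IsShrinking R₀ R) (hψ : IsFormFactor g₁ ψ₁) (hD : IsOpen D)
    (hRD : tube Tm Tp r R₀ ⊆ D) (hφ : ContDiffOn ℝ 2 φ D) (hA : ContDiffOn ℝ 2 A D)
    (hrD : ∀ t ∈ Icc Tm Tp, (t, r t) ∈ D) (hσ : ContDiffOn ℝ 2 σ (tube Tm Tp r R₀)) :
    UnifToZero Tm Tp (fun n t =>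
      ballIntegral r (R n) (fun p => chargeDensity K (corpuscles r ψ₁ R σ n) p •
          (electricField K (tube Tm Tp r (R n)) φ A p -
            (linearPart φ A r).elec K Tm Tp r p.1)) t +
        ballIntegral r (R n) (fun p => K.c⁻¹ •
          cross (currentDensity K (tube Tm Tp r (R n)) A (corpuscles r ψ₁ R σ n) p)
            (magneticField (tube Tm Tp r (R n)) A p - (linearPart φ A r).magn p.1)) t) := by
  have hR₀ : 0 < R₀ := (hR.pos 0).trans_le (hR.le 0)
  have hΩ := uniqueDiffOn_tube hT hr hR₀
  have hfst : MapsTo (Prod.fst : SpaceTime → ℝ) (tube Tm Tp r R₀) (Icc Tm Tp) := fun p hp => hp.1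
  have hφ1 : ContDiffOn ℝ 1 φ (tube Tm Tp r R₀) := (hφ.mono hRD).of_le (by norm_num)
  have hA1 : ContDiffOn ℝ 1 A (tube Tm Tp r R₀) := (hA.mono hRD).of_le (by norm_num)
  obtain ⟨C, hC⟩ := (isCompact_tube (R := R₀) hr.continuousOn).exists_bound_of_continuousOn
    (contDiffOn_kineticMomentum (K := K) hΩ (hA.mono hRD) hσ).continuousOn
  have cE : ContinuousOn (fun p : SpaceTime => (linearPart φ A r).elec K Tm Tp r p.1)
      (tube Tm Tp r R₀) :=
    (contDiffOn_linearPart_elec K hT hD hφ hA hr hrD).continuousOn.comp continuousOn_fst hfst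
  have cB : ContinuousOn (fun p : SpaceTime => (linearPart φ A r).magn p.1) (tube Tm Tp r R₀) :=
    (contDiffOn_linearPart_magn hD hA hr hrD).continuousOn.comp continuousOn_fst hfst
  have hE : ∀ ε > 0, ∀ᶠ n in atTop, ∀ p ∈ tube Tm Tp r (R n),
      ‖electricField K (tube Tm Tp r R₀) φ A p - (linearPart φ A r).elec K Tm Tp r p.1‖ < ε :=
    fun ε hε => eventually_norm_lt_of_center_eq_zero hr.continuousOn
      ((continuousOn_electricField hΩ hφ1 hA1).fun_sub cE)
      (fun t ht => by rw [electricField_center K hT hR₀ hD hRD hφ hA hr hrD ht, sub_self])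
      hR.pos hR.le hR.tendsto hε
  have hB : ∀ ε > 0, ∀ᶠ n in atTop, ∀ p ∈ tube Tm Tp r (R n),
      ‖magneticField (tube Tm Tp r R₀) A p - (linearPart φ A r).magn p.1‖ < ε :=
    fun ε hε => eventually_norm_lt_of_center_eq_zero hr.continuousOn
      ((continuousOn_magneticField hΩ hA1).fun_sub cB)
      (fun t ht => by rw [magneticField_center (φ := φ) hT hR₀ hD hRD hA hr ht, sub_self])
      hR.pos hR.le hR.tendsto hε
  refine UnifToZero.add ?_ ?_
  · refine unifToZero_ballIntegral_of_le_amplitude hr hR hψ fun ε hε => ?_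
    filter_upwards [hE (ε / (|K.q| + 1)) (by positivity)] with n hn p hp
    rw [electricField_tube_eq hT hr (hR.pos n) (hR.le n) (hφ1.differentiableOn (by norm_num))
      (hA1.differentiableOn (by norm_num)) hp, corpuscles, chargeDensity_polar, norm_smul,
      norm_mul, Real.norm_of_nonneg (sq_nonneg _), mul_right_comm]
    refine mul_le_mul_of_nonneg_right ?_ (sq_nonneg _)
    have h1 := (lt_div_iff₀ (by positivity)).1 (hn p hp)
    rw [Real.norm_eq_abs]
    nlinarith [norm_nonneg (electricField K (tube Tm Tp r R₀) φ A p -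
      (linearPart φ A r).elec K Tm Tp r p.1)]
  · refine unifToZero_ballIntegral_of_le_amplitude hr hR hψ fun ε hε => ?_
    set b : ℝ := |K.c⁻¹| * ‖crossL‖ * (|K.q / K.m| * C) with hb
    have hC0 : 0 ≤ C := (norm_nonneg _).trans (hC _ (center_mem_tube hR₀ (left_mem_Icc.2 hT.le)))
    have hb0 : 0 ≤ b := by positivity
    filter_upwards [hB (ε / (b + 1)) (by positivity)] with n hn p hp
    rw [magneticField_tube_eq hT hr (hR.pos n) (hR.le n)
      (hA1.differentiableOn (by norm_num)) hp, norm_smul, Real.norm_eq_abs]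
    have h1 := (lt_div_iff₀ (by positivity)).1 (hn p hp)
    have h2 := norm_currentDensity_corpuscles_le hT hr hR hψ.contDiff hσ hC n hp
    set δ := magneticField (tube Tm Tp r R₀) A p - (linearPart φ A r).magn p.1
    set J := currentDensity K (tube Tm Tp r (R n)) A (corpuscles r ψ₁ R σ n) p
    set u := corpuscleAmplitude r ψ₁ (R n ^ 5) p
    have h3 : b * ‖δ‖ ≤ ε := by nlinarith [norm_nonneg δ]
    calc |K.c⁻¹| * ‖cross J δ‖ ≤ |K.c⁻¹| * (‖crossL‖ * ‖J‖ * ‖δ‖) :=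
          mul_le_mul_of_nonneg_left (norm_cross_le _ _) (abs_nonneg _)
      _ ≤ |K.c⁻¹| * (‖crossL‖ * (|K.q / K.m| * C * u ^ 2) * ‖δ‖) := by gcongr
      _ = b * ‖δ‖ * u ^ 2 := by rw [hb]; ring
      _ ≤ ε * u ^ 2 := mul_le_mul_of_nonneg_right h3 (sq_nonneg _)

/-- The momentum flux through the boundary is negligible. -/
theorem unifToZero_boundaryIntegral_stress_corpuscles (hG : RegularNonlinearity G₁ g₁)
    (hT : Tm < Tp) (hr : ContDiffOn ℝ 2 r (Icc Tm Tp)) (hR : IsShrinking R₀ R)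
    (hψ : IsFormFactor g₁ ψ₁) (hdecay : FormFactorDecay ψ₁)
    (hφ : ContDiffOn ℝ 2 φ (tube Tm Tp r R₀)) (hA : ContDiffOn ℝ 2 A (tube Tm Tp r R₀))
    (hσ : ContDiffOn ℝ 2 σ (tube Tm Tp r R₀)) :
    UnifToZero Tm Tp (fun n t => boundaryIntegral r (R n) (fun p ν =>
      (WithLp.toLp 2 fun j => ∑ i, ν i * stress K (tube Tm Tp r (R n)) (scaledG G₁ (R n ^ 5)) φ A
        (corpuscles r ψ₁ R σ n) i j p : E3)) t) := by
  have hΩ := uniqueDiffOn_tube hT hr ((hR.pos 0).trans_le (hR.le 0))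
  have hσ1 : ContDiffOn ℝ 1 σ (tube Tm Tp r R₀) := hσ.of_le (by norm_num)
  have hc := isCompact_tube (R := R₀) hr.continuousOn
  obtain ⟨C, hC⟩ := hc.exists_bound_of_continuousOn
    (contDiffOn_kineticMomentum (K := K) hΩ hA hσ).continuousOn
  obtain ⟨Cω, hCω⟩ := hc.exists_bound_of_continuousOn
    ((continuousOn_dT hΩ hσ1).fun_add (hφ.continuousOn.const_smul (K.q / K.χ)))
  obtain ⟨B, -, hB⟩ := eventually_sphere_amplitude hT hr hR hψ.contDiff hdecay
  have h1 : UnifToZero Tm Tp (fun n t => boundaryIntegral r (R n) (fun p ν =>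
      (WithLp.toLp 2 fun j => ∑ i, ν i * stress K (tube Tm Tp r (R n)) (fun _ => 0) φ A
        (corpuscles r ψ₁ R σ n) i j p : E3)) t) := by
    refine unifToZero_boundaryIntegral hR.pos hR.tendsto (C := 9 * ((K.χ ^ 2 / K.m *
      (1 + (K.χ⁻¹ * C) ^ 2) + (K.χ ^ 2 / (2 * K.m) * (3 * (1 + (K.χ⁻¹ * C) ^ 2)) +
        K.χ * Cω)) * B)) ?_
    filter_upwards [hB] with n hn p hp hpR ν hν
    rw [mul_assoc 9, mul_assoc _ B]
    have hp₀ := tube_mono (hR.le n) hp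
    refine norm_sum_mul_le hν (sq_nonneg _) fun i j => ?_
    refine mul_abs_stress_le (uniqueDiffOn_tube hT hr (hR.pos n))
      ((hσ1.mono (tube_mono (hR.le n))).differentiableOn (by norm_num))
      ((contDiffOn_corpuscleAmplitude (pow_pos (hR.pos n) 5) hψ.contDiff hr).differentiableOn
        (by norm_num)) hp (sq_nonneg _) ?_ ?_ (hn p hp hpR).1 (hn p hp hpR).2 i j
    · rw [kineticMomentum_tube_eq hT hr (hR.pos n) (hR.le n)
        (hσ1.differentiableOn (by norm_num)) hp]
      exact hC p hp₀
    · have h := hCω p hp₀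
      rw [Real.norm_eq_abs, dT, ← fderivWithin_tube_eq hT hr (hR.pos n) (hR.le n)
        (hσ1.differentiableOn (by norm_num)) hp] at h
      exact h
  refine h1.congr (Eventually.of_forall fun n t ht => ?_)
  refine boundaryIntegral_stress hG (pow_pos (hR.pos n) 5) hT hr (hR.pos n)
    (hφ.mono (tube_mono (hR.le n))) (hA.mono (tube_mono (hR.le n)))
    (contDiffOn_corpuscles hr hR hψ.contDiff hσ n)
    (b := ((R n ^ 5) ^ (-(3 / 2) : ℝ) * ψ₁ ((R n ^ 5)⁻¹ * R n)) ^ 2) (fun p _ hpR => ?_) ht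
  rw [corpuscles, polar, norm_mul, norm_exp_I_mul, one_mul, Complex.norm_real, Real.norm_eq_abs,
    sq_abs, corpuscleAmplitude, hpR]

end Corpuscles

/-! ### Force balance and concentration -/

section Final

variable {K : NLSParams} {Tm Tp R₀ : ℝ} {r : ℝ → E3} {R : ℕ → ℝ} {ψ₁ g₁ G₁ : ℝ → ℝ}
  {D : Set SpaceTime} {φ σ : SpaceTime → ℝ} {A : SpaceTime → E3}

/-- By Newton's law the momentum of the wave-corpuscles changes at the rate of the total Lorentz
force, up to a vanishing error. -/
theorem unifToZero_force_balance_corpuscles (hT : Tm < Tp) (hr : ContDiffOn ℝ 2 r (Icc Tm Tp))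
    (hR : IsShrinking R₀ R) (hψ : IsFormFactor g₁ ψ₁) (hD : IsOpen D)
    (hRD : tube Tm Tp r R₀ ⊆ D) (hφ : ContDiffOn ℝ 2 φ D) (hA : ContDiffOn ℝ 2 A D)
    (hrD : ∀ t ∈ Icc Tm Tp, (t, r t) ∈ D) (hσ : ContDiffOn ℝ 2 σ (tube Tm Tp r R₀))
    (hk : ∀ t ∈ Icc Tm Tp,
      kineticMomentum K (tube Tm Tp r R₀) A σ (t, r t) = K.m • vel Tm Tp r t)
    (hN : ∀ t ∈ Icc Tm Tp, K.m • acc Tm Tp r t = K.q • (linearPart φ A r).elec K Tm Tp r t +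
      (K.q / K.c) • cross (vel Tm Tp r t) ((linearPart φ A r).magn t)) {t₀ : ℝ}
    (ht₀ : t₀ ∈ Icc Tm Tp) :
    UnifToZero Tm Tp (fun n t =>
      (∫ s in t₀..t, ballIntegral r (R n)
        (lorentzDensity K (tube Tm Tp r (R n)) φ A (corpuscles r ψ₁ R σ n)) s) -
      (ballIntegral r (R n)
        (momentumDensity K (tube Tm Tp r (R n)) A (corpuscles r ψ₁ R σ n)) t -
      ballIntegral r (R n)
        (momentumDensity K (tube Tm Tp r (R n)) A (corpuscles r ψ₁ R σ n)) t₀)) := by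
  set E := (linearPart φ A r).elec K Tm Tp r with hE
  set B := (linearPart φ A r).magn with hB
  set v := vel Tm Tp r with hv
  set M := ∫ x : E3, ψ₁ ‖x‖ ^ 2 with hM
  set P : ℕ → ℝ → E3 := fun n t => ballIntegral r (R n)
    (momentumDensity K (tube Tm Tp r (R n)) A (corpuscles r ψ₁ R σ n)) t with hP
  set N : ℕ → ℝ → ℝ := fun n t => localCharge K r (R n) (corpuscles r ψ₁ R σ n) t with hN'
  set f : ℕ → ℝ → E3 := fun n t => ballIntegral r (R n)
    (lorentzDensity K (tube Tm Tp r (R n)) φ A (corpuscles r ψ₁ R σ n)) t with hf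
  have cE : ContinuousOn E (Icc Tm Tp) :=
    (contDiffOn_linearPart_elec K hT hD hφ hA hr hrD).continuousOn
  have cB : ContinuousOn B (Icc Tm Tp) :=
    (contDiffOn_linearPart_magn hD hA hr hrD).continuousOn
  have cv : ContinuousOn v (Icc Tm Tp) := continuousOn_vel hT hr
  obtain ⟨CE, hCE⟩ := isCompact_Icc.exists_bound_of_continuousOn cE
  obtain ⟨CB, hCB⟩ := isCompact_Icc.exists_bound_of_continuousOn cB
  have q1 := unifToZero_field_corpuscles (K := K) hT hr hR hψ hD hRD hφ hA hrD hσ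
  have q2 : UnifToZero Tm Tp (fun n t => (N n t - K.q * M) • E t) := by
    refine (unifToZero_localCharge_corpuscles (K := K) (r := r) (σ := σ) hR hψ).of_bound CE
      (Eventually.of_forall fun n t ht => ?_)
    rw [norm_smul, mul_comm]
    exact mul_le_mul_of_nonneg_right (hCE t ht) (norm_nonneg _)
  have qP := unifToZero_momentum_corpuscles hT hr hR hψ (hA.mono hRD) hσ hk
  have q3 : UnifToZero Tm Tp (fun n t => (K.c⁻¹ * (K.q / K.m)) •
      cross (P n t - (K.m * M) • v t) (B t)) := by
    refine UnifToZero.const_smul (qP.of_bound (‖crossL‖ * CB)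
      (Eventually.of_forall fun n t ht => ?_)) _
    refine (norm_cross_le _ _).trans ?_
    rw [mul_right_comm]
    exact mul_le_mul_of_nonneg_right
      (mul_le_mul_of_nonneg_left (hCB t ht) (norm_nonneg crossL)) (norm_nonneg _)
  have ca : ContinuousOn (fun t => M • (K.q • E t + (K.q / K.c) • cross (v t) (B t)))
      (Icc Tm Tp) :=
    ((cE.fun_const_smul K.q).fun_add ((cv.cross cB).fun_const_smul (K.q / K.c))).fun_const_smul M
  have cf : ∀ n, ContinuousOn (f n) (Icc Tm Tp) := fun n =>
    continuousOn_ballIntegral hr.continuousOn (continuousOn_lorentzDensity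
      (uniqueDiffOn_tube hT hr (hR.pos n)) (hφ.mono ((tube_mono (hR.le n)).trans hRD))
      (hA.mono ((tube_mono (hR.le n)).trans hRD)) (contDiffOn_corpuscles hr hR hψ.contDiff hσ n))
  have q4 := ((q1.add (q2.add q3)).integral ht₀).sub
    (qP.sub (UnifToZero.of_tendsto (Tm := Tm) (Tp := Tp) (qP.tendsto ht₀)))
  refine q4.congr (Eventually.of_forall fun n t ht => ?_)
  -- by Newton's law the momentum of the particle is the integral of the force
  have e1 : ∫ s in t₀..t, M • (K.q • E s + (K.q / K.c) • cross (v s) (B s)) =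
      (K.m * M) • v t - (K.m * M) • v t₀ := by
    refine integral_eq_sub_of_hasDerivWithinAt (f := fun s => (K.m * M) • v s)
      (fun s hs => ?_) ca ht₀ ht
    have h1 : HasDerivWithinAt v (acc Tm Tp r s) (Icc Tm Tp) s :=
      ((contDiffOn_vel hT hr).differentiableOn (by norm_num) s hs).hasDerivWithinAt
    rw [← hN s hs, smul_smul, mul_comm M]
    exact h1.const_smul (K.m * M)
  have e2 : ∫ s in t₀..t, (f n s - M • (K.q • E s + (K.q / K.c) • cross (v s) (B s))) =
      (∫ s in t₀..t, f n s) - ((K.m * M) • v t - (K.m * M) • v t₀) := by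
    rw [intervalIntegral.integral_sub (intervalIntegrable_of_continuousOn (cf n) ht₀ ht)
      (intervalIntegrable_of_continuousOn ca ht₀ ht), e1]
  have e3 : ∫ s in t₀..t, (f n s - M • (K.q • E s + (K.q / K.c) • cross (v s) (B s))) =
      ∫ s in t₀..t, (ballIntegral r (R n) (fun p => chargeDensity K (corpuscles r ψ₁ R σ n) p •
          (electricField K (tube Tm Tp r (R n)) φ A p - E p.1)) s +
        ballIntegral r (R n) (fun p => K.c⁻¹ •
          cross (currentDensity K (tube Tm Tp r (R n)) A (corpuscles r ψ₁ R σ n) p)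
            (magneticField (tube Tm Tp r (R n)) A p - B p.1)) s +
        ((N n s - K.q * M) • E s + (K.c⁻¹ * (K.q / K.m)) •
          cross (P n s - (K.m * M) • v s) (B s))) := by
    refine intervalIntegral.integral_congr fun s hs => ?_
    have hs : s ∈ Icc Tm Tp := (convex_Icc Tm Tp).ordConnected.uIcc_subset ht₀ ht hs
    have h1 := ballIntegral_lorentzDensity (uniqueDiffOn_tube hT hr (hR.pos n))
      (hφ.mono ((tube_mono (hR.le n)).trans hRD)) (hA.mono ((tube_mono (hR.le n)).trans hRD))
      (contDiffOn_corpuscles (σ := σ) hr hR hψ.contDiff hσ n) cE cB (K := K) hs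
    have h2 : cross (P n s - (K.m * M) • v s) (B s) =
        cross (P n s) (B s) - (K.m * M) • cross (v s) (B s) := by
      simp only [← crossL_apply, map_sub, map_smul, sub_apply, smul_apply]
    have h3 : K.c⁻¹ * (K.q / K.m) * (K.m * M) = M * (K.q / K.c) := by
      have := K.m_pos.ne'
      have := K.c_pos.ne'
      field_simp
    simp only [hf, h1, h2, smul_sub, smul_smul, h3, smul_add, sub_smul]
    rw [mul_comm K.q M]
    abel
  rw [← e3, e2]
  abel

/-- The current is asymptotically convective. -/
theorem unifToZero_current_corpuscles (hT : Tm < Tp) (hr : ContDiffOn ℝ 2 r (Icc Tm Tp))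
    (hR : IsShrinking R₀ R) (hψ : IsFormFactor g₁ ψ₁) (hA : ContDiffOn ℝ 2 A (tube Tm Tp r R₀))
    (hσ : ContDiffOn ℝ 2 σ (tube Tm Tp r R₀))
    (hk : ∀ t ∈ Icc Tm Tp,
      kineticMomentum K (tube Tm Tp r R₀) A σ (t, r t) = K.m • vel Tm Tp r t) :
    UnifToZero Tm Tp (fun n t => ballIntegral r (R n) (fun p =>
      chargeDensity K (corpuscles r ψ₁ R σ n) p • vel Tm Tp r p.1 -
        currentDensity K (tube Tm Tp r (R n)) A (corpuscles r ψ₁ R σ n) p) t) := by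
  have hm := K.m_pos
  refine unifToZero_ballIntegral_of_le_amplitude hr hR hψ fun ε hε => ?_
  filter_upwards [eventually_kineticMomentum_sub_lt hT hr hR hA hσ hk
    (ε := ε / (|K.q / K.m| + 1)) (by positivity)] with n hn p hp
  have e : chargeDensity K (corpuscles r ψ₁ R σ n) p • vel Tm Tp r p.1 -
      currentDensity K (tube Tm Tp r (R n)) A (corpuscles r ψ₁ R σ n) p =
      -((K.q / K.m * corpuscleAmplitude r ψ₁ (R n ^ 5) p ^ 2) •
        (kineticMomentum K (tube Tm Tp r R₀) A σ p - K.m • vel Tm Tp r p.1)) := by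
    rw [currentDensity_eq_smul, momentumDensity_corpuscles hT hr hR hψ.contDiff hσ n hp,
      corpuscles, chargeDensity_polar, smul_sub, smul_smul, smul_smul, neg_sub]
    congr 2
    field_simp
  rw [e, norm_neg, norm_smul, norm_mul, Real.norm_of_nonneg (sq_nonneg _), mul_right_comm]
  refine mul_le_mul_of_nonneg_right ?_ (sq_nonneg _)
  have h1 := (lt_div_iff₀ (by positivity)).1 (hn p hp)
  rw [Real.norm_eq_abs]
  nlinarith [norm_nonneg (kineticMomentum K (tube Tm Tp r R₀) A σ p - K.m • vel Tm Tp r p.1)]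

/-- Given Newton's law, wave functions of a fixed phase whose kinetic momentum on the trajectory is
`m ∂_t r`, with the amplitudes of wave-corpuscles of size `R⁵`, concentrate at the trajectory. -/
theorem concentratesAsymptotically_corpuscles (hq : 0 < K.q) (hG : RegularNonlinearity G₁ g₁)
    (hψ : IsFormFactor g₁ ψ₁) (hdecay : FormFactorDecay ψ₁) (hT : Tm < Tp)
    (hr : ContDiffOn ℝ 2 r (Icc Tm Tp)) (hR : IsShrinking R₀ R) (hD : IsOpen D)
    (hRD : tube Tm Tp r R₀ ⊆ D) (hφ : ContDiffOn ℝ 2 φ D) (hA : ContDiffOn ℝ 2 A D)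
    (hrD : ∀ t ∈ Icc Tm Tp, (t, r t) ∈ D) (hσ : ContDiffOn ℝ 2 σ (tube Tm Tp r R₀))
    (hk : ∀ t ∈ Icc Tm Tp,
      kineticMomentum K (tube Tm Tp r R₀) A σ (t, r t) = K.m • vel Tm Tp r t)
    (hN : ∀ t ∈ Icc Tm Tp, K.m • acc Tm Tp r t = K.q • (linearPart φ A r).elec K Tm Tp r t +
      (K.q / K.c) • cross (vel Tm Tp r t) ((linearPart φ A r).magn t)) :
    ConcentratesAsymptotically K G₁ Tm Tp r (fun n => R n ^ 5) R (fun _ => φ) (fun _ => A)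
      (corpuscles r ψ₁ R σ) (linearPart φ A r) := by
  have hR₀ : 0 < R₀ := (hR.pos 0).trans_le (hR.le 0)
  have ha : ∀ n, 0 < R n ^ 5 := fun n => pow_pos (hR.pos n) 5
  have ht₀ : Tm ∈ Icc Tm Tp := left_mem_Icc.2 hT.le
  have hΩ := fun n => uniqueDiffOn_tube hT hr (hR.pos n)
  have hφn := fun n => hφ.mono ((tube_mono (Tm := Tm) (Tp := Tp) (r := r) (hR.le n)).trans hRD)
  have hAn := fun n => hA.mono ((tube_mono (Tm := Tm) (Tp := Tp) (r := r) (hR.le n)).trans hRD)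
  have hψn := contDiffOn_corpuscles hr hR hψ.contDiff hσ
  have hM := hψ.mass_pos
  set M := ∫ x : E3, ψ₁ ‖x‖ ^ 2
  obtain ⟨C, hC⟩ := (isCompact_tube (R := R₀) hr.continuousOn).exists_bound_of_continuousOn
    (contDiffOn_kineticMomentum (K := K) (uniqueDiffOn_tube hT hr hR₀)
      (hA.mono hRD) hσ).continuousOn
  have hC0 : 0 ≤ C := (norm_nonneg _).trans (hC _ (center_mem_tube hR₀ ht₀))
  obtain ⟨Cv, hCv⟩ := isCompact_Icc.exists_bound_of_continuousOn (continuousOn_vel hT hr)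
  have hCv0 : 0 ≤ Cv := (norm_nonneg _).trans (hCv _ ht₀)
  have hPle := norm_momentumDensity_corpuscles_le (K := K) hT hr hR hψ.contDiff hσ hC
  have hJle := norm_currentDensity_corpuscles_le (K := K) hT hr hR hψ.contDiff hσ hC
  have hcenter : ∀ n, ∀ p ∈ tube Tm Tp r (R n),
      chargeCenter K r (R n) (corpuscles r ψ₁ R σ n) p.1 = r p.1 := fun n p hp =>
    chargeCenter_polar (ha n) (hR.pos n) hq.ne' hψ hr hp.1
  have hoff : ∀ n, ∀ p ∈ tube Tm Tp r (R n),
      ‖p.2 - chargeCenter K r (R n) (corpuscles r ψ₁ R σ n) p.1‖ ≤ 1 := fun n p hp => by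
    rw [hcenter n p hp]; exact hp.2.trans (hR.le_one n)
  have hvν : ∀ n, ∀ p ∈ tube Tm Tp r (R n), ∀ ν : E3, ‖ν‖ = 1 →
      |inner ℝ (vel Tm Tp r p.1) ν| ≤ Cv := fun n p hp ν hν => by
    have h := abs_real_inner_le_norm (vel Tm Tp r p.1) ν
    rw [hν, mul_one] at h
    exact h.trans (hCv _ hp.1)
  have hνJ : ∀ J ν : E3, ‖ν‖ = 1 → |inner ℝ ν J| ≤ ‖J‖ := fun J ν hν => by
    have h := abs_real_inner_le_norm ν J
    rwa [hν, one_mul] at h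
  have hρ : ∀ n p, |chargeDensity K (corpuscles r ψ₁ R σ n) p| =
      K.q * corpuscleAmplitude r ψ₁ (R n ^ 5) p ^ 2 := fun n p => by
    rw [corpuscles, chargeDensity_polar, abs_of_nonneg (by positivity)]
  -- the boundary terms
  have b0 := unifToZero_boundaryIntegral_stress_corpuscles hG hT hr hR hψ hdecay
    (hφ.mono hRD) (hA.mono hRD) hσ (K := K)
  have b1 : UnifToZero Tm Tp (fun n t => boundaryIntegral r (R n) (fun p ν =>
      inner ℝ (vel Tm Tp r p.1) ν •
        momentumDensity K (tube Tm Tp r (R n)) A (corpuscles r ψ₁ R σ n) p) t) := by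
    refine unifToZero_boundaryIntegral_of_le_amplitude hT hr hR hψ.contDiff hdecay
      (c := Cv * C) (by positivity) fun n p hp _ ν hν => ?_
    rw [norm_smul, mul_assoc]
    exact mul_le_mul (hvν n p hp ν hν) (hPle n hp) (norm_nonneg _) hCv0
  have b2 : UnifToZero Tm Tp (fun n t => boundaryIntegral r (R n) (fun p ν =>
      inner ℝ (vel Tm Tp r p.1) ν * chargeDensity K (corpuscles r ψ₁ R σ n) p) t) := by
    refine unifToZero_boundaryIntegral_of_le_amplitude hT hr hR hψ.contDiff hdecay
      (c := Cv * K.q) (by positivity) fun n p hp _ ν hν => ?_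
    rw [norm_mul, Real.norm_eq_abs, Real.norm_eq_abs, hρ, mul_assoc]
    exact mul_le_mul_of_nonneg_right (hvν n p hp ν hν) (by positivity)
  have b3 : UnifToZero Tm Tp (fun n t => boundaryIntegral r (R n) (fun p ν =>
      inner ℝ ν (currentDensity K (tube Tm Tp r (R n)) A (corpuscles r ψ₁ R σ n) p)) t) := by
    refine unifToZero_boundaryIntegral_of_le_amplitude hT hr hR hψ.contDiff hdecay
      (c := |K.q / K.m| * C) (by positivity) fun n p hp _ ν hν => ?_
    exact (hνJ _ ν hν).trans (hJle n hp)
  have b4 : UnifToZero Tm Tp (fun n t => boundaryIntegral r (R n) (fun p ν =>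
      (inner ℝ (vel Tm Tp r p.1) ν * chargeDensity K (corpuscles r ψ₁ R σ n) p) •
        (p.2 - chargeCenter K r (R n) (corpuscles r ψ₁ R σ n) p.1)) t) := by
    refine unifToZero_boundaryIntegral_of_le_amplitude hT hr hR hψ.contDiff hdecay
      (c := Cv * K.q) (by positivity) fun n p hp _ ν hν => ?_
    rw [norm_smul, norm_mul, Real.norm_eq_abs, Real.norm_eq_abs, hρ, mul_assoc Cv]
    refine (mul_le_of_le_one_right (by positivity) (hoff n p hp)).trans ?_
    exact mul_le_mul_of_nonneg_right (hvν n p hp ν hν) (by positivity)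
  have b5 : UnifToZero Tm Tp (fun n t => boundaryIntegral r (R n) (fun p ν =>
      inner ℝ ν (currentDensity K (tube Tm Tp r (R n)) A (corpuscles r ψ₁ R σ n) p) •
        (p.2 - chargeCenter K r (R n) (corpuscles r ψ₁ R σ n) p.1)) t) := by
    refine unifToZero_boundaryIntegral_of_le_amplitude hT hr hR hψ.contDiff hdecay
      (c := |K.q / K.m| * C) (by positivity) fun n p hp _ ν hν => ?_
    rw [norm_smul]
    refine (mul_le_of_le_one_right (norm_nonneg _) (hoff n p hp)).trans ?_
    exact (hνJ _ ν hν).trans (hJle n hp)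
  have hNlim := unifToZero_localCharge_corpuscles (K := K) (Tm := Tm) (Tp := Tp) (r := r)
    (σ := σ) hR hψ
  have hU := fun n => perturbedLaws_transport (K := K) hG (ha n) hT hr (hR.pos n) (hφn n) (hAn n)
    (hψn n) (fun p hp => fderivWithin_chargeDensity_convective hT (ha n) (hR.pos n) hψ.contDiff
      hr hp)
  refine ⟨localizedNLS_linearPart hT hD hRD hφ hA hr hrD ha (by simpa using hR.tendsto.pow 5)
    hR.pos hR.le hR.tendsto hR.tendsto_ratio, hψn, ⟨C * M, fun n t ht =>
    norm_ballIntegral_le_mass (ha n) hr hψ hC0 ht (fun p hp => hPle n hp)⟩, ?_,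
    Tm, ht₀, ⟨K.q * M, tendsto_sub_nhds_zero_iff.1 (hNlim.tendsto ht₀)⟩, b0.integral ht₀,
    b1.integral ht₀, b4.neg, b5, (b2.integral ht₀).sub (b3.integral ht₀),
    (unifToZero_field_corpuscles hT hr hR hψ hD hRD hφ hA hrD hσ).integral ht₀,
    fun n => transportPerturbation K (tube Tm Tp r (R n)) (scaledG G₁ (R n ^ 5)) φ A
      (corpuscles r ψ₁ R σ n) (vel Tm Tp r), hU, ?_, ?_, ?_⟩
  · have hqM : 0 < K.q * M / 2 := by positivity
    obtain ⟨n₀, hn₀⟩ := eventually_atTop.1 (unifToZero_iff.1 hNlim _ hqM)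
    refine ⟨3 * (K.q * M / 2), K.q * M / 2, hqM, n₀, fun n hn t ht => ?_⟩
    have h := abs_lt.1 (hn₀ n hn t ht)
    constructor <;> linarith [h.1, h.2]
  · -- the momentum balance, read as an identity for the perturbation terms
    refine (((b1.integral ht₀).sub (b0.integral ht₀)).add
      (unifToZero_force_balance_corpuscles hT hr hR hψ hD hRD hφ hA hrD hσ hk hN ht₀)).congr
      (Eventually.of_forall fun n t ht => ?_)
    have h := momentum_sub_eq hG (ha n) hT hr (hR.pos n) (hφn n) (hAn n) (hψn n) (hU n) ht₀ ht
    rw [h]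
    abel
  · have h1 : UnifToZero Tm Tp (fun n t => boundaryIntegral r (R n) (fun p ν =>
        inner ℝ ν (chargeDensity K (corpuscles r ψ₁ R σ n) p • vel Tm Tp r p.1 -
          currentDensity K (tube Tm Tp r (R n)) A (corpuscles r ψ₁ R σ n) p) •
        (p.2 - chargeCenter K r (R n) (corpuscles r ψ₁ R σ n) p.1)) t) := by
      refine unifToZero_boundaryIntegral_of_le_amplitude hT hr hR hψ.contDiff hdecay
        (c := K.q * Cv + |K.q / K.m| * C) (by positivity) fun n p hp _ ν hν => ?_
      rw [norm_smul]
      refine (mul_le_of_le_one_right (norm_nonneg _) (hoff n p hp)).trans ?_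
      refine (hνJ _ ν hν).trans ((norm_sub_le _ _).trans ?_)
      rw [add_mul]
      refine add_le_add ?_ (hJle n hp)
      rw [norm_smul, Real.norm_eq_abs, hρ, mul_right_comm]
      exact mul_le_mul_of_nonneg_right (mul_le_mul_of_nonneg_left (hCv _ hp.1) hq.le)
        (sq_nonneg _)
    refine (h1.sub (unifToZero_current_corpuscles hT hr hR hψ (hA.mono hRD) hσ hk)).congr
      (Eventually.of_forall fun n t ht => ?_)
    have e1 : ballIntegral r (R n) (dT (tube Tm Tp r (R n)) (fun p => (0 : ℝ) •
        (p.2 - chargeCenter K r (R n) (corpuscles r ψ₁ R σ n) p.1))) t = 0 := by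
      simp [ballIntegral, dT]
    have e2 : ballIntegral r (R n) (fun _ => (0 : ℝ)) t = 0 := by simp [ballIntegral]
    simp only [transportPerturbation]
    rw [e1, e2, zero_smul, zero_add, zero_add]
  · -- the charge is conserved, so that its balance determines the perturbation terms
    refine ((b2.integral ht₀).sub (b3.integral ht₀)).congr
      (Eventually.of_forall fun n t ht => ?_)
    have h := localCharge_sub_eq hT hr (hR.pos n) (hAn n) (hψn n) (hU n) ht₀ ht
    have h0 : localCharge K r (R n) (corpuscles r ψ₁ R σ n) t -
        localCharge K r (R n) (corpuscles r ψ₁ R σ n) Tm = 0 := by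
      rw [corpuscles, localCharge_polar (ha n), localCharge_polar (ha n), sub_self]
    rw [h0] at h
    linarith

end Final
end

theorem mainTheorem8 (K : NLSParams) (G₁ g₁ : ℝ → ℝ) (hG : RegularNonlinearity G₁ g₁)
    (ψ₁ : ℝ → ℝ) (hψ₁ : IsFormFactor g₁ ψ₁) (hdecay : FormFactorDecay ψ₁)
    (D : Set SpaceTime) (hD : IsOpen D)
    (φ : SpaceTime → ℝ) (A : SpaceTime → E3)
    (hφ : ContDiffOn ℝ 2 φ D) (hA : ContDiffOn ℝ 2 A D)
    (Tm Tp : ℝ) (hT : Tm < Tp) (r : ℝ → E3) (hr : IsTrajectory Tm Tp r)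
    (hrD : ∀ t ∈ Set.Icc Tm Tp, (t, r t) ∈ D)
    (hconc : ∃ (a R : ℕ → ℝ) (φn : ℕ → SpaceTime → ℝ) (An : ℕ → SpaceTime → E3)
      (ψn : ℕ → SpaceTime → ℂ),
      ConcentratesAsymptotically K G₁ Tm Tp r a R φn An ψn (linearPart φ A r)) :
    ∃ (a R : ℕ → ℝ) (W : LinearPotentials),
      (∀ n, tube Tm Tp r (R n) ⊆ D) ∧
      WaveCorpusclePotentials K Tm Tp r W ∧
      (∀ t ∈ Set.Icc Tm Tp,
        W.φ₀ t = φ (t, r t) ∧ W.A₀ t = A (t, r t) ∧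
        W.elec K Tm Tp r t = (linearPart φ A r).elec K Tm Tp r t ∧
        W.magn t = (linearPart φ A r).magn t) ∧
      (ContDiffOn ℝ 2 (linearPart φ A r).A₁ (Set.Icc Tm Tp) → W = linearPart φ A r) ∧
      ConcentratesAsymptotically K G₁ Tm Tp r a R (fun _ => φ) (fun _ => A)
        (fun n => waveCorpuscle K Tm Tp r W ψ₁ (a n)) (linearPart φ A r) := by
  obtain ⟨_, _, _, _, _, hc⟩ := hconc
  have hr2 := hr.contDiffOn
  have cE := contDiffOn_linearPart_elec K hT hD hφ hA hr2 hrD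
  have cB := contDiffOn_linearPart_magn (φ := φ) hD hA hr2 hrD
  obtain ⟨hq, hN⟩ := newton_of_concentratesAsymptotically hG hT hr2 hc cE.continuousOn cB
  have hv := contDiffOn_two_vel hT hr2 cE cB hN
  obtain ⟨R₀, hR₀, hRD⟩ := exists_tube_subset hD hr2.continuousOn hrD
  -- the radii are `min R₀ 1 / (n + 1)`, the sizes their fifth powers
  have hR : IsShrinking R₀ (fun n : ℕ => min R₀ 1 * (1 / ((n : ℝ) + 1))) := by
    have h1 : ∀ n : ℕ, 1 / ((n : ℝ) + 1) ≤ 1 := fun n => by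
      rw [div_le_one (by positivity)]; linarith [(Nat.cast_nonneg n : (0 : ℝ) ≤ n)]
    have h2 : ∀ n : ℕ, min R₀ 1 * (1 / ((n : ℝ) + 1)) ≤ min R₀ 1 := fun n =>
      mul_le_of_le_one_right (le_min hR₀.le zero_le_one) (h1 n)
    refine ⟨fun n => by positivity, fun n => (h2 n).trans (min_le_left _ _),
      fun n => (h2 n).trans (min_le_right _ _), ?_⟩
    simpa using tendsto_one_div_add_atTop_nhds_zero_nat.const_mul (min R₀ 1)
  set R : ℕ → ℝ := fun n : ℕ => min R₀ 1 * (1 / ((n : ℝ) + 1))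
  have l0 := contDiffOn_linearPart_φ₀ (A := A) hφ hr2 hrD
  have l1 := contDiffOn_linearPart_φ₁ (A := A) hD hφ hr2 hrD
  have m0 := contDiffOn_linearPart_A₀ (φ := φ) hA hr2 hrD
  have m1 := contDiffOn_linearPart_A₁ (φ := φ) hD hA hr2 hrD
  -- any data with the right coefficients of order zero and a regular quadratic form will do
  have key : ∀ W : LinearPotentials, W.φ₀ = (linearPart φ A r).φ₀ →
      W.A₀ = (linearPart φ A r).A₀ →
      (∃ S₁ : ℝ → E3 →L[ℝ] E3, ContDiffOn ℝ 2 S₁ (Icc Tm Tp) ∧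
        ∀ t ∈ Icc Tm Tp, ∀ y, inner ℝ y (W.A₁ t y) = inner ℝ y (S₁ t y)) →
      ConcentratesAsymptotically K G₁ Tm Tp r (fun n => R n ^ 5) R (fun _ => φ) (fun _ => A)
        (fun n => waveCorpuscle K Tm Tp r W ψ₁ (R n ^ 5)) (linearPart φ A r) := by
    rintro W h0 hA0 ⟨S₁, hS, hSA⟩
    have hσ : ContDiffOn ℝ 2 (corpusclePhase K Tm Tp r W) (tube Tm Tp r R₀) :=
      contDiffOn_corpusclePhase hT hr2 hv (h0 ▸ l0.of_le (by norm_num)) (hA0 ▸ m0) hS hSA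
    exact concentratesAsymptotically_corpuscles hq hG hψ₁ hdecay hT hr2 hR hD hRD hφ hA hrD hσ
      (fun t ht => kineticMomentum_center hR₀ (hσ.differentiableOn (by norm_num)) ht
        (by rw [hA0]; rfl)) hN
  refine ⟨fun n => R n ^ 5, R, ?_⟩
  have hRn : ∀ n, tube Tm Tp r (R n) ⊆ D := fun n => (tube_mono (hR.le n)).trans hRD
  by_cases h2 : ContDiffOn ℝ 2 (linearPart φ A r).A₁ (Icc Tm Tp)
  · exact ⟨linearPart φ A r, hRn, ⟨l0.of_le (by norm_num), l1, m0.of_le (by norm_num), m1, hN⟩,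
      fun t _ => ⟨rfl, rfl, rfl, rfl⟩, fun _ => rfl,
      key _ rfl rfl ⟨_, h2, fun _ _ _ => rfl⟩⟩
  -- otherwise the symmetric part of `∇A` is dropped, and the quadratic form vanishes
  · set W := antisymmetrized (linearPart φ A r) K Tm Tp r with hW
    have w1 : ContDiffOn ℝ 1 W.A₁ (Icc Tm Tp) :=
      (crossL.contDiff.comp_contDiffOn cB).const_smul (1 / 2 : ℝ)
    have hmagn : ∀ t, W.magn t = (linearPart φ A r).magn t := fun t => curlLin_half_crossL _
    have helec : ∀ t ∈ Icc Tm Tp,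
        W.elec K Tm Tp r t = (linearPart φ A r).elec K Tm Tp r t := fun t ht => by
      rw [W.elec_eq K hT hr2 (m0.of_le (by norm_num)) w1 ht]
      simp only [hW, antisymmetrized]
      abel
    have wφ : ContDiffOn ℝ 1 W.φ₁ (Icc Tm Tp) :=
      cE.neg.sub (((m0.derivWithin (uniqueDiffOn_Icc hT) (by norm_num)).sub
        (w1.clm_apply (contDiffOn_vel hT hr2))).const_smul K.c⁻¹)
    refine ⟨W, hRn, ⟨l0.of_le (by norm_num), wφ, m0.of_le (by norm_num), w1, fun t ht => ?_⟩,
      fun t ht => ⟨rfl, rfl, helec t ht, hmagn t⟩, fun h => absurd h h2,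
      key W rfl rfl ⟨fun _ => 0, contDiffOn_const, fun t _ y => ?_⟩⟩
    · rw [helec t ht, hmagn t]
      exact hN t ht
    · have := inner_crossL_self ((linearPart φ A r).magn t) y
      simp only [hW, antisymmetrized, smul_apply, inner_smul_right, this, zero_apply,
        inner_zero_right, mul_zero]
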